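/- **Conventions.** A block is a sequence of distinct symbols. A sequence $S$ is $\sigma$-free if no subsequence of $S$ equals $\sigma$ up to an injective renaming of letters. $\mathrm{dbl}(\sigma)$ is $\sigma$ with every letter except the first and the last doubled. $\mathrm{DS}_s(n,m)$, resp. $\mathrm{dblDS}_s(n,m)$, is the maximum length of a sequence with exactly $n$ distinct letters that can be partitioned into at most $m$ blocks and is $\sigma$-free, resp. $\mathrm{dbl}(\sigma)$-free, where $\sigma=abab\cdots$ has length $s+2$. *Canonical derivation tree.* For a sequence $S$ given as a list of $m$ (possibly empty) blocks, group the blocks into consecutive pairs (the last group may be a single block). Contract $S$ by keeping only the symbols occurring in at least two groups and replacing each group by one block containing its surviving symbols once each, ordered by first occurrence. The level-$k$ nodes of the tree are the blocks of the $k$-fold contraction (the leaves, $k=0$, are the blocks of $S$); the parent of the $p$th node (from 0) of level $k$ is the $\lfloor p/2\rfloor$th node of level $k+1$. For a symbol $a$ occurring in at least two blocks, let $k$ be the last level at which $a$ occurs; there it occurs in exactly two blocks, which are siblings, called the left and right head of $a$; their common parent is the crown of $a$. The projection tree of $a$ consists of its crown and all nodes whose blocks contain $a$. Its left (right) wing is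 the path from the left (right) head to the leftmost (rightmost) leaf. A dove (hawk) quill is a child of a left (right) wing node that is not itself on that wing; a dove (hawk) feather is the rightmost (leftmost) leaf descendant of a dove (hawk) quill. $\mathrm{Feather}_s(n,m)$ is the maximum number of feathers of one type (dove or hawk), counted over all symbols, in an $m$-block sequence with $n$ letters that is free of $abab\cdots$ (length $s+2$). *Ackermann's function.* $a_{1,j}=2^j$ $(j\ge1)$, $a_{i,1}=2$ $(i\ge2)$, $a_{i,j}=w\cdot a_{i-1,w}$ with $w=a_{i,j-1}$ $(i,j\ge2)$; $\alpha(n,m)=\min\{i\ge1: a_{i,j}\ge m,\ j=\max(\lceil n/m\rceil,3)\}$. *Coefficients*, for $i\ge1$: $\mathrm{fea}_{2,i}=0$, $\mathrm{ds}_{1,i}=1$, $\mathrm{ds}_{2,i}=2$, $\mathrm{dblds}_{1,i}=2$, $\mathrm{dblds}_{2,i}=5$. For $s\ge3$: $\mathrm{fea}_{s,1}=\mathrm{fea}_{s-1,1}+1$, $\mathrm{ds}_{s,1}=2\,\mathrm{ds}_{s-1,1}$, $\mathrm{dblds}_{s,1}=2(\mathrm{dblds}_{s-1,1}+1)$. For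 $s\ge3$, $i\ge2$: $\mathrm{fea}_{s,i}=\mathrm{fea}_{s,i-1}+\mathrm{fea}_{s-1,i}+1$; if $s=3$ or $s$ is even, $$\mathrm{ds}_{s,i}=2\,\mathrm{ds}_{s-1,i}+\mathrm{ds}_{s-2,i}(\mathrm{ds}_{s,i-1}-2),$$ $$\mathrm{dblds}_{s,i}=\mathrm{dblds}_{s,i-1}+2\,\mathrm{dblds}_{s-1,i}+(\mathrm{dblds}_{s-2,i}+2)\,\mathrm{ds}_{s,i-1};$$ if $s\ge5$ is odd, $$\mathrm{ds}_{s,i}=2\,\mathrm{ds}_{s-1,i}+2\,\mathrm{ds}_{s-2,i}\,\mathrm{fea}_{s,i-1}+\mathrm{ds}_{s-3,i}\,\mathrm{ds}_{s,i-1},$$ $$\mathrm{dblds}_{s,i}=\mathrm{dblds}_{s,i-1}+2\,\mathrm{dblds}_{s-1,i}+2(\mathrm{dblds}_{s-2,i}+2)\,\mathrm{fea}_{s,i-1}+(\mathrm{dblds}_{s-3,i}+2)\,\mathrm{ds}_{s,i-1}.$$ **Theorem.** (1) There is an absolute constant $C>0$ such that for all integers $i\ge1$, $s\ge3$, all real $c\ge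 s-2$ and all $n,m\ge 0$, if $j\ge1$ is minimal with $m\le(a_{i,j})^c$, then $$\mathrm{Feather}_s(n,m)\le \mathrm{fea}_{s,i}\,(n+C(cj)^{s-2}m),\qquad \mathrm{DS}_s(n,m)\le \mathrm{ds}_{s,i}\,(n+C(cj)^{s-2}m),$$ $$\mathrm{dblDS}_s(n,m)\le 2\,\mathrm{dblds}_{s,i}\,(n+C(cj)^{s-2}m).$$ (2) For $s\ge3$: $\mathrm{ds}_{s,1}=2^{s-1}$, $\mathrm{dblds}_{s,1}=2^{s+1}-2^{s-2}-2$, and for all $i\ge1$, $\mathrm{fea}_{s,i}=\binom{i+s-2}{s-2}-1$. Moreover $\mathrm{ds}_{3,i}=2i+2$ for all $i\ge 1$; and, as $i\to\infty$, $\mathrm{dblds}_{3,i}=\Theta(i^2)$; $\mathrm{ds}_{4,i},\mathrm{dblds}_{4,i}=\Theta(2^i)$; $\mathrm{ds}_{5,i},\mathrm{dblds}_{5,i}=\Theta(i2^i)$. For every $s\ge4$, $s\ne5$, with $t=\lfloor (s-2)/2\rfloor$, there is a constant $D_s\in\mathbb N$ with $\mathrm{ds}_{s,i},\ \mathrm{dblds}_{s,i}\le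 2^{\binom{i+D_s}{t}}$ for all $i\ge1$. (3) Consequently, for all $n,m\ge1$, with $\alpha=\alpha(n,m)$: $\mathrm{dblDS}_4(n,m)=O((n+m)2^{\alpha})$, $\mathrm{dblDS}_5(n,m)=O((n+m)\,\alpha\,2^{\alpha})$, and for every $s\ge6$, $\mathrm{dblDS}_s(n,m)=O\big((n+m)\,2^{\alpha^t/t!+O(\alpha^{t-1})}\big)$ with $t=\lfloor (s-2)/2\rfloor$ and constants depending only on $s$. -/

import Mathlib

namespace DoubleDS

/-! ### Sequences, blocks, forbidden patterns

Sequences are lists over the countable alphabet `ℕ`. -/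

/-- `σ ≺ S`: some subsequence of `S` is equal to `σ` up to an (injective) renaming of letters. -/
def Contained (σ S : List ℕ) : Prop :=
  ∃ f : ℕ → ℕ, Set.InjOn f {x | x ∈ σ} ∧ (σ.map f).Sublist S

/-- The alternating sequence `abab⋯` of length `k`, with `a = 0` and `b = 1`. -/
def alt (k : ℕ) : List ℕ := (List.range k).map (fun x => x % 2)

/-- Double every letter except for the last one. -/
def dblInit : List ℕ → List ℕ
  | [] => []
  | [x] => [x]
  | x :: y :: l => x :: x :: dblInit (y :: l)

/-- Double every letter except for the first and the last one, e.g.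
`dbl (abcabc) = abbccaabbc`. -/
def dbl : List ℕ → List ℕ
  | [] => []
  | x :: l => x :: dblInit l

/-- `B` is a list of blocks: every block consists of distinct symbols. Blocks may be empty. -/
def IsBlocked (B : List (List ℕ)) : Prop := ∀ b ∈ B, b.Nodup

/-- The lengths of the `σ`-free sequences with exactly `n` distinct letters that can be
partitioned into at most `m` blocks. -/
def exSet (σ : List ℕ) (n m : ℕ) : Set ℕ :=
  {l | ∃ S : List ℕ, S.length = l ∧ ¬ Contained σ S ∧ S.toFinset.card = n ∧
    ∃ B : List (List ℕ), B.flatten = S ∧ IsBlocked B ∧ B.length ≤ m}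

/-- The extremal function `Ex(σ, n, m)`; the set is bounded, see `exSet_bddAbove`. -/
noncomputable def Ex (σ : List ℕ) (n m : ℕ) : ℕ := sSup (exSet σ n m)

theorem length_flatten_le (B : List (List ℕ)) (A : Finset ℕ) (hB : IsBlocked B)
    (hA : ∀ b ∈ B, ∀ x ∈ b, x ∈ A) : B.flatten.length ≤ B.length * A.card := by
  induction B with
  | nil => simp
  | cons b B ih =>
    have h1 : b.length ≤ A.card := by
      rw [← List.toFinset_card_of_nodup (hB b (by simp))]
      apply Finset.card_le_card
      intro x hx
      exact hA b (by simp) x (by simpa using hx)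
    have h2 := ih (fun c hc => hB c (by simp [hc])) (fun c hc => hA c (by simp [hc]))
    simp only [List.flatten_cons, List.length_append, List.length_cons]
    linarith [Nat.succ_mul B.length A.card]

theorem exSet_bddAbove (σ : List ℕ) (n m : ℕ) : BddAbove (exSet σ n m) := by
  refine ⟨m * n, ?_⟩
  rintro l ⟨S, rfl, -, rfl, B, rfl, hB, hm⟩
  refine (length_flatten_le B B.flatten.toFinset hB ?_).trans (Nat.mul_le_mul_right _ hm)
  intro b hb x hx
  simp only [List.mem_toFinset, List.mem_flatten]
  exact ⟨b, hb, hx⟩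

/-- Maximum length of an order-`s` Davenport-Schinzel sequence with `n` letters, `m` blocks. -/
noncomputable def DS (s n m : ℕ) : ℕ := Ex (alt (s + 2)) n m

/-- Maximum length of an order-`s` double Davenport-Schinzel sequence with `n` letters,
`m` blocks. -/
noncomputable def dblDS (s n m : ℕ) : ℕ := Ex (dbl (alt (s + 2))) n m

/-! ### The canonical derivation tree -/

/-- Group the blocks into intervals of two consecutive blocks (the last interval may consist of
one block). -/
def pairUp : List (List ℕ) → List (List ℕ)
  | [] => []
  | [b] => [b]
  | b :: c :: l => (b ++ c) :: pairUp l

/-- The contracted global sequence for intervals of two blocks: only the symbols that appear in at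
least two intervals are kept, and every interval becomes one block, ordered by first occurrence. -/
def contract (B : List (List ℕ)) : List (List ℕ) :=
  (pairUp B).map fun I =>
    I.reverse.dedup.reverse.filter fun a =>
      decide (2 ≤ (pairUp B).countP fun J => decide (a ∈ J))

/-- A node of the canonical derivation tree, as (level, position from the left). Leaves have
level `0`; the parent of `(k, p)` is `(k + 1, p / 2)`. -/
abbrev Node := ℕ × ℕ

/-- The block of a node. Level `k` holds the `k`-fold contracted sequence, since the tree of `B`
is the tree of `contract B` with the blocks of `B` attached below its leaves, two to each. The
root of a base-case tree has no block; it gets the empty one here, as do all further nodes. -/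
def block (B : List (List ℕ)) (v : Node) : List ℕ := (contract^[v.1] B).getD v.2 []

/-- `u` is a descendant of `v`, or `u = v`. -/
def Below (u v : Node) : Prop := u.1 ≤ v.1 ∧ u.2 / 2 ^ (v.1 - u.1) = v.2

/-- `(k + 1, q)` is the crown of `a`, with left head `(k, 2 * q)` and right head `(k, 2 * q + 1)`:
at level `k` the symbol `a` is local to the `q`th pair of blocks and appears in both of them. A
symbol that appears in only one block of `B` has no crown. -/
def IsCrown (B : List (List ℕ)) (a k q : ℕ) : Prop :=
  a ∈ block B (k, 2 * q) ∧ a ∈ block B (k, 2 * q + 1) ∧ a ∉ block B (k + 1, q)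

/-- The positions of the leaves of the projection tree of `a`. -/
def leafSet (B : List (List ℕ)) (a : ℕ) : Set ℕ := {p | a ∈ block B (0, p)}

/-- The left wing of the projection tree of `a`: the path from the left head to the leftmost leaf.
-/
def OnLeftWing (B : List (List ℕ)) (a : ℕ) (v : Node) : Prop :=
  a ∈ block B v ∧ ∃ k q t, IsCrown B a k q ∧ IsLeast (leafSet B a) t ∧
    Below v (k, 2 * q) ∧ Below (0, t) v

/-- The right wing of the projection tree of `a`: the path from the right head to the rightmost
leaf. -/
def OnRightWing (B : List (List ℕ)) (a : ℕ) (v : Node) : Prop :=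
  a ∈ block B v ∧ ∃ k q t, IsCrown B a k q ∧ IsGreatest (leafSet B a) t ∧
    Below v (k, 2 * q + 1) ∧ Below (0, t) v

/-- A dove quill: a child of a left wing node that is not itself on the wing. (All ancestors,
strictly below the crown, of a node whose block contains `a` have `a` in their blocks, so the
edges of the projection tree are edges of the canonical derivation tree.) -/
def IsDoveQuill (B : List (List ℕ)) (a : ℕ) (v : Node) : Prop :=
  a ∈ block B v ∧ OnLeftWing B a (v.1 + 1, v.2 / 2) ∧ ¬ OnLeftWing B a v

/-- A hawk quill: a child of a right wing node that is not itself on the wing. -/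
def IsHawkQuill (B : List (List ℕ)) (a : ℕ) (v : Node) : Prop :=
  a ∈ block B v ∧ OnRightWing B a (v.1 + 1, v.2 / 2) ∧ ¬ OnRightWing B a v

/-- The leaf at position `p` is the rightmost descendant of a dove quill for `a`. -/
def IsDoveFeather (B : List (List ℕ)) (a p : ℕ) : Prop :=
  ∃ v, IsDoveQuill B a v ∧ IsGreatest {p' | p' ∈ leafSet B a ∧ Below (0, p') v} p

/-- The leaf at position `p` is the leftmost descendant of a hawk quill for `a`. -/
def IsHawkFeather (B : List (List ℕ)) (a p : ℕ) : Prop :=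
  ∃ v, IsHawkQuill B a v ∧ IsLeast {p' | p' ∈ leafSet B a ∧ Below (0, p') v} p

open scoped Classical in
/-- Number of occurrences (symbol, block) in `B` that are dove feathers. -/
noncomputable def doveFeathers (B : List (List ℕ)) : ℕ :=
  (Finset.filter (fun x : ℕ × ℕ => IsDoveFeather B x.1 x.2)
    (B.flatten.toFinset ×ˢ Finset.range B.length)).card

open scoped Classical in
/-- Number of occurrences (symbol, block) in `B` that are hawk feathers. -/
noncomputable def hawkFeathers (B : List (List ℕ)) : ℕ :=
  (Finset.filter (fun x : ℕ × ℕ => IsHawkFeather B x.1 x.2)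
    (B.flatten.toFinset ×ˢ Finset.range B.length)).card

/-- The numbers of feathers of one type in the `m`-block, order-`s` DS sequences with `n` letters.
-/
def featherSet (s n m : ℕ) : Set ℕ :=
  {k | ∃ B : List (List ℕ), B.length = m ∧ IsBlocked B ∧ ¬ Contained (alt (s + 2)) B.flatten ∧
    B.flatten.toFinset.card = n ∧ (k = doveFeathers B ∨ k = hawkFeathers B)}

/-- The maximum number of feathers of one type (dove or hawk), with respect to the canonical
derivation tree, in an `m`-block, order-`s` DS sequence with `n` letters. The set is bounded, see
`featherSet_bddAbove`. -/
noncomputable def Feather (s n m : ℕ) : ℕ := sSup (featherSet s n m)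

theorem featherSet_bddAbove (s n m : ℕ) : BddAbove (featherSet s n m) := by
  classical
  refine ⟨n * m, ?_⟩
  rintro k ⟨B, rfl, -, -, rfl, rfl | rfl⟩
  · exact (Finset.card_le_card (Finset.filter_subset _ _)).trans (by simp)
  · exact (Finset.card_le_card (Finset.filter_subset _ _)).trans (by simp)

/-! ### Ackermann's function and its inverse -/

/-- Ackermann's function `a_{i,j}` for `i, j ≥ 1`: `a_{1,j} = 2 ^ j`, `a_{i,1} = 2`, and
`a_{i,j} = w * a_{i-1,w}` with `w = a_{i,j-1}`. (The value for `i = 0` or `j = 0` is never used.)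
-/
def acker : ℕ → ℕ → ℕ
  | 0, _ => 0
  | 1, j => 2 ^ j
  | _ + 2, 0 => 0
  | _ + 2, 1 => 2
  | i + 2, j + 2 => acker (i + 2) (j + 1) * acker (i + 1) (acker (i + 2) (j + 1))
termination_by i j => (i, j)

/-- `α(n,m)`, for `n, m ≥ 1`. -/
noncomputable def alpha (n m : ℕ) : ℕ :=
  sInf {i | 1 ≤ i ∧ m ≤ acker i (max ⌈(n : ℚ) / (m : ℚ)⌉₊ 3)}

/-! ### The coefficients

Only the values with `i ≥ 1`, and `s ≥ 2` for `fea`, `s ≥ 1` for `ds` and `dblds`, are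
meaningful. -/

/-- The coefficients `fea_{s,i}`. -/
def fea : ℕ → ℕ → ℤ
  | 0, _ => 0
  | 1, _ => 0
  | 2, _ => 0
  | _ + 3, 0 => 0
  | s + 3, 1 => fea (s + 2) 1 + 1
  | s + 3, i + 2 => fea (s + 3) (i + 1) + fea (s + 2) (i + 2) + 1
termination_by s i => (s, i)

/-- The coefficients `ds_{s,i}`. -/
def ds : ℕ → ℕ → ℤ
  | 0, _ => 0
  | 1, _ => 1
  | 2, _ => 2
  | _ + 3, 0 => 0
  | s + 3, 1 => 2 * ds (s + 2) 1
  | s + 3, i + 2 =>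
    if s = 0 ∨ Even (s + 3) then
      2 * ds (s + 2) (i + 2) + ds (s + 1) (i + 2) * (ds (s + 3) (i + 1) - 2)
    else
      2 * ds (s + 2) (i + 2) + 2 * ds (s + 1) (i + 2) * fea (s + 3) (i + 1)
        + ds s (i + 2) * ds (s + 3) (i + 1)
termination_by s i => (s, i)

/-- The coefficients `dblds_{s,i}`. -/
def dblds : ℕ → ℕ → ℤ
  | 0, _ => 0
  | 1, _ => 2
  | 2, _ => 5
  | _ + 3, 0 => 0
  | s + 3, 1 => 2 * (dblds (s + 2) 1 + 1)
  | s + 3, i + 2 =>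
    if s = 0 ∨ Even (s + 3) then
      dblds (s + 3) (i + 1) + 2 * dblds (s + 2) (i + 2)
        + (dblds (s + 1) (i + 2) + 2) * ds (s + 3) (i + 1)
    else
      dblds (s + 3) (i + 1) + 2 * dblds (s + 2) (i + 2)
        + 2 * (dblds (s + 1) (i + 2) + 2) * fea (s + 3) (i + 1)
        + (dblds s (i + 2) + 2) * ds (s + 3) (i + 1)
termination_by s i => (s, i)

end DoubleDS

open DoubleDS

/-!
Sequences are encoded by sets of positions: a finite set `P` of integers, a letter `ℓ x` and a block
`β x` for every position `x`, where `β` is monotone on `P`. The node of level `k` above the block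
`v` is `v / 2 ^ k`, so that the `h`-fold contraction merely replaces `β` by `β / 2 ^ h`, and
subsequences are subsets. What is counted are the *incidences* `(ℓ x, β x)` and, for feathers, the
incidences that satisfy `IsDove`, in a tree with `2 ^ H` leaves (`DSBound`, `DblBound`,
`FeatherBound`).

*Recursion.* Cut the derivation tree at height `h`. A letter confined to one group of `2 ^ h` blocks
is local, and the local letters are handled group by group with the same order. For a global
letter, the occurrences in its first group are followed by a later occurrence, so that any
alternation among them extends by one letter: they form a sequence of order one less, and so do
those in the last group. The middle ones extend on both sides and lose two orders
(`altFree_mids`). How often a letter has a middle group is bounded by the sequence contracted to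
its groups. For odd orders, two letters with middle occurrences in one group that are not feathers
and lie below the left heads occur once more, in a prescribed order, outside that group and on the
same side of it (`exists_pair_of_not_dove`), so that such occurrences lose three orders; likewise
below the right heads, and there are no other middle occurrences (`exists_mids_split`). Feathers
obey a recursion of their own (`featherBound_step`): a feather branches off at or above the level of
the groups, and is then a feather of the contracted sequence (`card_high_doves_le`), or it lies in
the first group of its letter.

*Double sequences.* The same cut works if the first and the last occurrence of every letter in a
group are removed, since the removed ones double the letters at the ends of an alternation; this
costs one or two occurrences for every incidence. To bound the number of incidences of the
contracted sequence, a double DS sequence is first divided into two sets, in each of which any two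
occurrences of a letter have another occurrence of it in between. Letters that occur twice in a
group then have a third, hidden, occurrence there, and the hidden occurrences form a sequence
without `abab⋯` (`exists_hidden`); letters alone in their group are counted by the induction
hypothesis on the contracted sequence. Order two, that is `abbaab`, is settled by a charging
argument (`card_spanning_le`).

*Ackermann.* With `w = acker (i + 1) j` and groups of `2 ^ h = w ^ c` blocks the contracted
sequence has at most `acker i w ^ c` blocks, and the factor `w ^ (s - 2)` of the induction
hypothesis is cancelled by the size of the groups (`acker_induction`, `tail_div_le`). Rounding `c`
up to an integer costs an absolute constant factor, because `(1 + 4 / c) ^ (s - 2) ≤ e ^ 4`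
(`pow_ceil_le`). In terms of the inverse function `α`, the factor `j ^ (s - 2)` disappears if the
index is raised by `s - 2` (`acker_pow_le`, `dblDS_le_alpha`).

*Coefficients.* The closed forms and the orders of magnitude follow by induction from the
recursions. For higher orders the recursion multiplies the coefficient by at most
`2 ^ choose (i + D) t` when `i` increases by one, and Pascal's rule raises `t` by one
(`expBounded_of_recursion`).
-/

namespace DoubleDS

/-! ### Alternations, letters and blocks of a set of positions -/

/-- `Chain r ℓ P k a b x z`: the set of positions `P` of the word `ℓ` contains `k` consecutive
steps strictly between `x` and `z`, alternately for the letters `a, b, a, …`. A step for `a` is a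
pair of `a`-positions `y ≤ y'` with `r y y'`; so `r = (· = ·)` describes the alternation
`abab⋯` of length `k`, and `r = (· < ·)` the alternation with every letter doubled. -/
def Chain (r : ℤ → ℤ → Prop) (ℓ : ℤ → ℕ) (P : Finset ℤ) : ℕ → ℕ → ℕ → ℤ → ℤ → Prop
  | 0, _, _, x, z => x < z
  | k + 1, a, b, x, z => ∃ y y', y ∈ P ∧ y' ∈ P ∧ ℓ y = a ∧ ℓ y' = a ∧ x < y ∧ y ≤ y' ∧ r y y' ∧
      Chain r ℓ P k b a y' z

section Chain
variable {r : ℤ → ℤ → Prop} {ℓ : ℤ → ℕ} {P P' : Finset ℤ} {k : ℕ} {a b : ℕ} {x z : ℤ}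

theorem Chain.mono (hP : P ⊆ P') (h : Chain r ℓ P k a b x z) : Chain r ℓ P' k a b x z := by
  induction k generalizing a b x with
  | zero => exact h
  | succ k ih =>
    obtain ⟨y, y', m1, m2, e1, e2, h1, h2, h3, h4⟩ := h
    exact ⟨y, y', hP m1, hP m2, e1, e2, h1, h2, h3, ih h4⟩

/-- All steps of a chain in `P` lie in any interval that contains `P`. -/
theorem Chain.restrict {x' z' : ℤ} (hxz : x' < z') (hP : ∀ y ∈ P, x' < y ∧ y < z')
    (h : Chain r ℓ P k a b x z) : Chain r ℓ P k a b x' z' := by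
  have key : ∀ (k a b : ℕ) (x x' : ℤ), x' ≤ x → x' < z' → Chain r ℓ P k a b x z →
      Chain r ℓ P k a b x' z' := by
    intro k
    induction k with
    | zero => intro a b x x' _ h _; exact h
    | succ k ih =>
      rintro a b x x' hx hz ⟨y, y', m1, m2, e1, e2, h1, h2, h3, h4⟩
      exact ⟨y, y', m1, m2, e1, e2, by omega, h2, h3, ih _ _ _ _ le_rfl (hP y' m2).2 h4⟩
  cases k with
  | zero => exact hxz
  | succ k =>
    obtain ⟨y, y', m1, m2, e1, e2, h1, h2, h3, h4⟩ := h
    exact ⟨y, y', m1, m2, e1, e2, (hP y m1).1, h2, h3,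
      key _ _ _ _ _ le_rfl (hP y' m2).2 h4⟩

/-- Append a step. -/
theorem Chain.snoc {y y' z' : ℤ} (h : Chain r ℓ P k a b x z) (hz : z ≤ y) (hy : y ∈ P)
    (hy' : y' ∈ P) (e : ℓ y = if Even k then a else b) (e' : ℓ y' = if Even k then a else b)
    (hyy : y ≤ y') (hr : r y y') (hz' : y' < z') : Chain r ℓ P (k + 1) a b x z' := by
  induction k generalizing a b x with
  | zero =>
    have h : x < z := h
    exact ⟨y, y', hy, hy', by simpa using e, by simpa using e', by omega, hyy, hr, hz'⟩
  | succ k ih =>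
    obtain ⟨u, u', m1, m2, e1, e2, h1, h2, h3, h4⟩ := h
    refine ⟨u, u', m1, m2, e1, e2, h1, h2, h3, ih h4 ?_ ?_⟩
    · rw [e]; by_cases hk : Even k <;> simp [Nat.even_add_one, hk]
    · rw [e']; by_cases hk : Even k <;> simp [Nat.even_add_one, hk]

/-- Every letter of a chain occurs in `P`. -/
theorem Chain.exists_mem (h : Chain r ℓ P k a b x z) (hk : 1 ≤ k) : ∃ y ∈ P, ℓ y = a := by
  cases k with
  | zero => omega
  | succ k =>
    obtain ⟨y, y', m1, m2, e1, e2, h1, h2, h3, h4⟩ := h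
    exact ⟨y, m1, e1⟩

theorem Chain.exists_mem' (h : Chain r ℓ P k a b x z) (hk : 2 ≤ k) : ∃ y ∈ P, ℓ y = b := by
  cases k with
  | zero => omega
  | succ k =>
    obtain ⟨y, y', m1, m2, e1, e2, h1, h2, h3, h4⟩ := h
    exact h4.exists_mem (by omega)

end Chain

/-- `P` contains no alternation of length `k`. -/
def AltFree (ℓ : ℤ → ℕ) (P : Finset ℤ) (k : ℕ) : Prop :=
  ∀ a b x z, a ≠ b → ¬ Chain Eq ℓ P k a b x z

/-- `Q` contains no alternation of length `k + 2` with all letters doubled, except the first and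
the last one. -/
def DblFree (ℓ : ℤ → ℕ) (Q : Finset ℤ) (k : ℕ) : Prop :=
  ∀ a b x z, a ≠ b → x ∈ Q → z ∈ Q → ℓ x = a → ℓ z = (if Even k then b else a) →
    ¬ Chain (· < ·) ℓ Q k b a x z

theorem AltFree.mono {ℓ : ℤ → ℕ} {P P' : Finset ℤ} {k : ℕ} (h : AltFree ℓ P k) (hP : P' ⊆ P) :
    AltFree ℓ P' k := fun a b x z hab hc => h a b x z hab (hc.mono hP)

theorem DblFree.mono {ℓ : ℤ → ℕ} {P P' : Finset ℤ} {k : ℕ} (h : DblFree ℓ P k) (hP : P' ⊆ P) :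
    DblFree ℓ P' k := fun a b x z hab hx hz ex ez hc =>
  h a b x z hab (hP hx) (hP hz) ex ez (hc.mono hP)

/-- The number of letters of `P`. -/
def letters (ℓ : ℤ → ℕ) (P : Finset ℤ) : ℕ := (P.image ℓ).card

/-- The letter-block incidences of `P`, with respect to the block function `β`. -/
def inc (ℓ : ℤ → ℕ) (β : ℤ → ℤ) (P : Finset ℤ) : Finset (ℕ × ℤ) := P.image fun x => (ℓ x, β x)

theorem mem_inc {ℓ : ℤ → ℕ} {β : ℤ → ℤ} {P : Finset ℤ} {c : ℕ × ℤ} :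
    c ∈ inc ℓ β P ↔ ∃ x ∈ P, ℓ x = c.1 ∧ β x = c.2 := by
  simp [inc, Prod.ext_iff]

theorem inc_mono {ℓ : ℤ → ℕ} {β : ℤ → ℤ} {P P' : Finset ℤ} (h : P ⊆ P') :
    inc ℓ β P ⊆ inc ℓ β P' := Finset.image_subset_image h

theorem letters_mono {ℓ : ℤ → ℕ} {P P' : Finset ℤ} (h : P ⊆ P') : letters ℓ P ≤ letters ℓ P' :=
  Finset.card_le_card (Finset.image_subset_image h)

/-- If any two positions of `X` for the same letter lie in the same block then the incidences of
`X` correspond to its letters. -/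
theorem inc_card_le_letters {ℓ : ℤ → ℕ} {β : ℤ → ℤ} {X : Finset ℤ}
    (h : ∀ x ∈ X, ∀ y ∈ X, ℓ x = ℓ y → β x = β y) : (inc ℓ β X).card ≤ letters ℓ X := by
  have : (inc ℓ β X).image Prod.fst = X.image ℓ := by
    ext a; simp [inc]
  rw [letters, ← this, Finset.card_image_of_injOn]
  rintro ⟨a, u⟩ hc ⟨b, v⟩ hd (rfl : a = b)
  obtain ⟨x, hx, e1, e2⟩ := mem_inc.1 hc
  obtain ⟨y, hy, e3, e4⟩ := mem_inc.1 hd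
  simp only at e1 e2 e3 e4
  rw [← e2, ← e4, h x hx y hy (e1.trans e3.symm)]

/-- All blocks of `P` lie below one node of level `H` of the binary tree. -/
def Fits (β : ℤ → ℤ) (P : Finset ℤ) (H : ℕ) : Prop :=
  ∀ x ∈ P, ∀ y ∈ P, β x / 2 ^ H = β y / 2 ^ H

theorem ediv_pow_add (b : ℤ) (h k : ℕ) : b / 2 ^ h / 2 ^ k = b / 2 ^ (h + k) := by
  rw [Int.ediv_ediv_of_nonneg (by positivity), pow_add]

theorem ediv_mono {a b : ℤ} (h : a ≤ b) (k : ℕ) : a / 2 ^ k ≤ b / 2 ^ k :=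
  Int.ediv_le_ediv (by positivity) h

theorem ediv_eq_of_le {a b : ℤ} {h k : ℕ} (hk : h ≤ k) (e : a / 2 ^ h = b / 2 ^ h) :
    a / 2 ^ k = b / 2 ^ k := by
  obtain ⟨d, rfl⟩ := Nat.exists_eq_add_of_le hk
  rw [← ediv_pow_add, ← ediv_pow_add, e]

theorem Fits.mono {β : ℤ → ℤ} {P P' : Finset ℤ} {H : ℕ} (h : Fits β P H) (hP : P' ⊆ P) :
    Fits β P' H := fun x hx y hy => h x (hP hx) y (hP hy)

/-- Below a node of level `d` there are at most `2 ^ d` blocks. -/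
theorem Fits.card_image_le {β : ℤ → ℤ} {P : Finset ℤ} {d : ℕ} (h : Fits β P d) :
    (P.image β).card ≤ 2 ^ d := by
  rcases P.eq_empty_or_nonempty with rfl | ⟨x, hx⟩
  · simp
  · have : P.image β ⊆ Finset.Ico (2 ^ d * (β x / 2 ^ d)) (2 ^ d * (β x / 2 ^ d) + 2 ^ d) := by
      intro u hu
      obtain ⟨y, hy, rfl⟩ := Finset.mem_image.1 hu
      rw [h x hx y hy, Finset.mem_Ico]
      have h1 := Int.mul_ediv_add_emod (β y) (2 ^ d)
      have h2 := Int.emod_nonneg (β y) (b := 2 ^ d) (by positivity)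
      have h3 := Int.emod_lt_of_pos (β y) (b := 2 ^ d) (by positivity)
      constructor <;> linarith
    refine (Finset.card_le_card this).trans ?_
    rw [Int.card_Ico]
    have : (2 ^ d * (β x / 2 ^ d) + 2 ^ d - 2 ^ d * (β x / 2 ^ d) : ℤ) = ((2 ^ d : ℕ) : ℤ) := by
      push_cast; ring
    rw [this, Int.toNat_natCast]

theorem Fits.div {β : ℤ → ℤ} {P : Finset ℤ} {h H : ℕ} (hf : Fits β P H) (hh : h ≤ H) :
    Fits (fun x => β x / 2 ^ h) P (H - h) := by
  intro x hx y hy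
  simp only [ediv_pow_add, Nat.add_sub_cancel' hh]
  exact hf x hx y hy

/-- Summation over the groups of `2 ^ h` blocks: a linear bound within every group gives a linear
bound for the whole, in which a letter is counted once for every group it occurs in. -/
theorem card_le_of_groups {τ : Type} (Y : Finset τ) (grp : τ → ℤ) {ℓ : ℤ → ℕ} {β : ℤ → ℤ}
    {X : Finset ℤ} {h H : ℕ} {A B : ℝ} (hh : h ≤ H) (hX : Fits β X H) (hB : 0 ≤ B)
    (hgrp : ∀ c ∈ Y, ∃ x ∈ X, β x / 2 ^ h = grp c)
    (hg : ∀ g, ((Y.filter fun c => grp c = g).card : ℝ) ≤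
      A * letters ℓ (X.filter fun x => β x / 2 ^ h = g) + B * 2 ^ h) :
    (Y.card : ℝ) ≤ A * (inc ℓ (fun x => β x / 2 ^ h) X).card + B * 2 ^ H := by
  set T := X.image fun x => β x / 2 ^ h with hT
  have h1 : Y.card = ∑ g ∈ T, (Y.filter fun c => grp c = g).card := by
    apply Finset.card_eq_sum_card_fiberwise
    intro c hc
    obtain ⟨x, hx, e⟩ := hgrp c hc
    exact Finset.mem_coe.2 (Finset.mem_image.2 ⟨x, hx, e⟩)
  have h2 : (inc ℓ (fun x => β x / 2 ^ h) X).card =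
      ∑ g ∈ T, letters ℓ (X.filter fun x => β x / 2 ^ h = g) := by
    rw [Finset.card_eq_sum_card_fiberwise (f := Prod.snd) (t := T)]
    · refine Finset.sum_congr rfl fun g _ => ?_
      rw [letters, ← Finset.card_image_of_injOn (f := Prod.fst)]
      · congr 1
        ext a
        simp only [Finset.mem_image, Finset.mem_filter, mem_inc]
        constructor
        · rintro ⟨⟨a', g'⟩, ⟨⟨x, hx, e1, e2⟩, rfl⟩, rfl⟩
          exact ⟨x, ⟨hx, e2⟩, e1⟩
        · rintro ⟨x, ⟨hx, e⟩, rfl⟩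
          exact ⟨(ℓ x, g), ⟨⟨x, hx, rfl, e⟩, rfl⟩, rfl⟩
      · rintro ⟨a, u⟩ hc ⟨b, v⟩ hd (rfl : a = b)
        have e1 := (Finset.mem_filter.1 (Finset.mem_coe.1 hc)).2
        have e2 := (Finset.mem_filter.1 (Finset.mem_coe.1 hd)).2
        simp only at e1 e2
        rw [e1, e2]
    · intro c hc
      obtain ⟨x, hx, -, e⟩ := mem_inc.1 (Finset.mem_coe.1 hc)
      exact Finset.mem_coe.2 (Finset.mem_image.2 ⟨x, hx, e⟩)
  have h3 : (T.card : ℝ) * 2 ^ h ≤ 2 ^ H := by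
    have : T.card ≤ 2 ^ (H - h) := (hX.div hh).card_image_le
    calc (T.card : ℝ) * 2 ^ h ≤ 2 ^ (H - h) * 2 ^ h := by
          gcongr; exact_mod_cast this
      _ = 2 ^ H := by rw [← pow_add, Nat.sub_add_cancel hh]
  rw [h1, h2]
  push_cast
  calc (∑ g ∈ T, ((Y.filter fun c => grp c = g).card : ℝ))
      ≤ ∑ g ∈ T, (A * letters ℓ (X.filter fun x => β x / 2 ^ h = g) + B * 2 ^ h) :=
        Finset.sum_le_sum fun g _ => hg g
    _ = A * ∑ g ∈ T, (letters ℓ (X.filter fun x => β x / 2 ^ h = g) : ℝ)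
        + B * ((T.card : ℝ) * 2 ^ h) := by
        rw [Finset.sum_add_distrib, Finset.mul_sum, Finset.sum_const, nsmul_eq_mul]; ring
    _ ≤ _ := by gcongr

/-- `β` is monotone on `P`: the blocks of `P` are consecutive segments. -/
def Mono (β : ℤ → ℤ) (P : Finset ℤ) : Prop := ∀ x ∈ P, ∀ y ∈ P, x ≤ y → β x ≤ β y

theorem Mono.mono {β : ℤ → ℤ} {P P' : Finset ℤ} (h : Mono β P) (hP : P' ⊆ P) : Mono β P' :=
  fun x hx y hy => h x (hP hx) y (hP hy)

theorem Mono.div {β : ℤ → ℤ} {P : Finset ℤ} (h : Mono β P) (k : ℕ) :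
    Mono (fun x => β x / 2 ^ k) P := fun x hx y hy hxy => ediv_mono (h x hx y hy hxy) k

theorem Mono.lt {β : ℤ → ℤ} {P : Finset ℤ} (h : Mono β P) {x y : ℤ} (hx : x ∈ P) (hy : y ∈ P)
    (hxy : β x < β y) : x < y := by
  by_contra hc
  have := h y hy x hx (by omega)
  omega

/-! ### Extending alternations beyond a group -/

section Extend
variable {ℓ : ℤ → ℕ} {P X : Finset ℤ} {k : ℕ}

theorem exists_lt_all (X : Finset ℤ) : ∃ x₀, ∀ u ∈ X, x₀ < u := by
  obtain ⟨m, hm⟩ := X.bddBelow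
  exact ⟨m - 1, fun u hu => by have : m ≤ u := hm hu; omega⟩

theorem exists_gt_all (X : Finset ℤ) : ∃ x₀, ∀ u ∈ X, u < x₀ := by
  obtain ⟨m, hm⟩ := X.bddAbove
  exact ⟨m + 1, fun u hu => by have : u ≤ m := hm hu; omega⟩

/-- The letter `a` occurs in `P` to the left of `X`. -/
def Before (ℓ : ℤ → ℕ) (P X : Finset ℤ) (a : ℕ) : Prop := ∃ y ∈ P, ℓ y = a ∧ ∀ u ∈ X, y < u

/-- The letter `a` occurs in `P` to the right of `X`. -/
def After (ℓ : ℤ → ℕ) (P X : Finset ℤ) (a : ℕ) : Prop := ∃ y ∈ P, ℓ y = a ∧ ∀ u ∈ X, u < y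

/-- An alternation of `X` extends by one letter to the right. -/
theorem AltFree.of_after (h : AltFree ℓ P (k + 1)) (hk : 2 ≤ k) (hXP : X ⊆ P)
    (hX : ∀ x ∈ X, After ℓ P X (ℓ x)) : AltFree ℓ X k := by
  intro a b x z hab hc
  obtain ⟨x₀, hx₀⟩ := exists_lt_all X
  obtain ⟨ya, hya, ea⟩ := hc.exists_mem (by omega)
  obtain ⟨yb, hyb, eb⟩ := hc.exists_mem' hk
  have : ∃ y ∈ P, ℓ y = (if Even k then a else b) ∧ ∀ u ∈ X, u < y := by
    split_ifs
    · exact ea ▸ hX ya hya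
    · exact eb ▸ hX yb hyb
  obtain ⟨y, hy, e, hlt⟩ := this
  have h1 : Chain Eq ℓ X k a b x₀ y := hc.restrict ((hx₀ ya hya).trans (hlt ya hya))
    fun u hu => ⟨hx₀ u hu, hlt u hu⟩
  exact h a b x₀ (y + 1) hab
    ((h1.mono hXP).snoc le_rfl hy hy e e le_rfl rfl (by omega))

/-- An alternation of `X` extends by one letter to the left. -/
theorem AltFree.of_before (h : AltFree ℓ P (k + 1)) (hk : 2 ≤ k) (hXP : X ⊆ P)
    (hX : ∀ x ∈ X, Before ℓ P X (ℓ x)) : AltFree ℓ X k := by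
  intro a b x z hab hc
  obtain ⟨z₀, hz₀⟩ := exists_gt_all X
  obtain ⟨yb, hyb, eb⟩ := hc.exists_mem' hk
  obtain ⟨y, hy, e, hlt⟩ := hX yb hyb
  have h1 : Chain Eq ℓ X k a b y z₀ := hc.restrict ((hlt yb hyb).trans (hz₀ yb hyb))
    fun u hu => ⟨hlt u hu, hz₀ u hu⟩
  exact h b a (y - 1) z₀ hab.symm
    ⟨y, y, hy, hy, e.trans eb, e.trans eb, by omega, le_rfl, rfl, h1.mono hXP⟩

/-- An alternation of `X` extends by one letter on either side. -/
theorem AltFree.of_before_after (h : AltFree ℓ P (k + 2)) (hk : 2 ≤ k) (hXP : X ⊆ P)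
    (hB : ∀ x ∈ X, Before ℓ P X (ℓ x)) (hA : ∀ x ∈ X, After ℓ P X (ℓ x)) : AltFree ℓ X k := by
  intro a b x z hab hc
  obtain ⟨ya, hya, ea⟩ := hc.exists_mem (by omega)
  obtain ⟨yb, hyb, eb⟩ := hc.exists_mem' hk
  obtain ⟨y, hy, e, hlt⟩ := hB yb hyb
  have : ∃ w ∈ P, ℓ w = (if Even (k + 1) then b else a) ∧ ∀ u ∈ X, u < w := by
    split_ifs
    · exact eb ▸ hA yb hyb
    · exact ea ▸ hA ya hya
  obtain ⟨w, hw, e', hgt⟩ := this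
  have h1 : Chain Eq ℓ X k a b y w := hc.restrict ((hlt yb hyb).trans (hgt yb hyb))
    fun u hu => ⟨hlt u hu, hgt u hu⟩
  have h2 : Chain Eq ℓ P (k + 1) b a (y - 1) w :=
    ⟨y, y, hy, hy, e.trans eb, e.trans eb, by omega, le_rfl, rfl, h1.mono hXP⟩
  exact h b a (y - 1) (w + 1) hab.symm (h2.snoc le_rfl hw hw e' e' le_rfl rfl (by omega))

/-- An alternation of even length extends by three letters if `P` contains, on one side of `X`,
an occurrence of its first letter followed by one of its second letter. -/
theorem AltFree.of_pairs (h : AltFree ℓ P (k + 3)) (hk : 2 ≤ k) (hke : Even k) (hXP : X ⊆ P)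
    (hB : ∀ x ∈ X, Before ℓ P X (ℓ x)) (hA : ∀ x ∈ X, After ℓ P X (ℓ x))
    (hN : ∀ x ∈ X, ∀ x' ∈ X, ℓ x ≠ ℓ x' → ∃ u ∈ P, ∃ u' ∈ P, ℓ u = ℓ x ∧ ℓ u' = ℓ x' ∧ u < u' ∧
      ((∀ w ∈ X, w < u) ∨ ∀ w ∈ X, u' < w)) : AltFree ℓ X k := by
  intro a b x z hab hc
  obtain ⟨ya, hya, ea⟩ := hc.exists_mem (by omega)
  obtain ⟨yb, hyb, eb⟩ := hc.exists_mem' hk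
  obtain ⟨u, hu, u', hu', eu, eu', huu, hr | hl⟩ := hN ya hya yb hyb (by rw [ea, eb]; exact hab)
  · obtain ⟨y, hy, e, hlt⟩ := hB yb hyb
    have h1 : Chain Eq ℓ X k a b y u := hc.restrict ((hlt yb hyb).trans (hr yb hyb))
      fun u hu => ⟨hlt u hu, hr u hu⟩
    have h2 : Chain Eq ℓ P (k + 1) b a (y - 1) u :=
      ⟨y, y, hy, hy, e.trans eb, e.trans eb, by omega, le_rfl, rfl, h1.mono hXP⟩
    have h3 : Chain Eq ℓ P (k + 2) b a (y - 1) u' :=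
      h2.snoc le_rfl hu hu (by simp [Nat.even_add_one, hke, eu, ea])
        (by simp [Nat.even_add_one, hke, eu, ea]) le_rfl rfl huu
    exact h b a (y - 1) (u' + 1) hab.symm
      (h3.snoc le_rfl hu' hu' (by simp [Nat.even_add_one, hke, eu', eb])
        (by simp [Nat.even_add_one, hke, eu', eb]) le_rfl rfl (by omega))
  · obtain ⟨y, hy, e, hgt⟩ := hA ya hya
    have h1 : Chain Eq ℓ X k a b u' y := hc.restrict ((hl yb hyb).trans (hgt yb hyb))
      fun u hu => ⟨hl u hu, hgt u hu⟩
    have h2 : Chain Eq ℓ P (k + 2) a b (u - 1) y :=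
      ⟨u, u, hu, hu, eu.trans ea, eu.trans ea, by omega, le_rfl, rfl,
        u', u', hu', hu', eu'.trans eb, eu'.trans eb, by omega, le_rfl, rfl, h1.mono hXP⟩
    exact h a b (u - 1) (y + 1) hab
      (h2.snoc le_rfl hy hy (by simp [Nat.even_add_one, hke, e, ea])
        (by simp [Nat.even_add_one, hke, e, ea]) le_rfl rfl (by omega))

end Extend

/-! ### First, last and middle occurrences of the global letters -/

section Split
variable {ℓ : ℤ → ℕ} {γ : ℤ → ℤ} {P G X : Finset ℤ}

/-- `S` contains an occurrence of the letter of `x` in an earlier group. -/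
def Earlier (ℓ : ℤ → ℕ) (γ : ℤ → ℤ) (S : Finset ℤ) (x : ℤ) : Prop := ∃ y ∈ S, ℓ y = ℓ x ∧ γ y < γ x

/-- `S` contains an occurrence of the letter of `x` in a later group. -/
def Later (ℓ : ℤ → ℕ) (γ : ℤ → ℤ) (S : Finset ℤ) (x : ℤ) : Prop := ∃ y ∈ S, ℓ y = ℓ x ∧ γ x < γ y

theorem Earlier.congr {S : Finset ℤ} {x y : ℤ} (h : Earlier ℓ γ S x) (e : ℓ x = ℓ y)
    (e' : γ x = γ y) : Earlier ℓ γ S y := by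
  obtain ⟨u, hu, e1, h1⟩ := h
  exact ⟨u, hu, e1.trans e, e' ▸ h1⟩

theorem Later.congr {S : Finset ℤ} {x y : ℤ} (h : Later ℓ γ S x) (e : ℓ x = ℓ y)
    (e' : γ x = γ y) : Later ℓ γ S y := by
  obtain ⟨u, hu, e1, h1⟩ := h
  exact ⟨u, hu, e1.trans e, e' ▸ h1⟩

open scoped Classical in
/-- The occurrences in `G` of the letters whose first group within `G` it is, provided that `P`
has a later occurrence. -/
noncomputable def firsts (ℓ : ℤ → ℕ) (γ : ℤ → ℤ) (P G : Finset ℤ) : Finset ℤ :=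
  G.filter fun x => Later ℓ γ P x ∧ ¬ Earlier ℓ γ G x

open scoped Classical in
/-- The remaining occurrences in `G` of the letters whose last group within `G` it is, provided
that `P` has an earlier occurrence. -/
noncomputable def lasts (ℓ : ℤ → ℕ) (γ : ℤ → ℤ) (P G : Finset ℤ) : Finset ℤ :=
  G.filter fun x => ¬ (Later ℓ γ P x ∧ ¬ Earlier ℓ γ G x) ∧ Earlier ℓ γ P x ∧ ¬ Later ℓ γ G x

open scoped Classical in
/-- The occurrences in `G` of letters with both earlier and later groups within `G`. -/
noncomputable def mids (ℓ : ℤ → ℕ) (γ : ℤ → ℤ) (G : Finset ℤ) : Finset ℤ :=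
  G.filter fun x => Earlier ℓ γ G x ∧ Later ℓ γ G x

theorem inc_add_inc_card {X₁ X₂ : Finset ℤ} (hX : X₁ ∪ X₂ = X)
    (hd : ∀ x ∈ X₁, ∀ y ∈ X₂, ℓ x = ℓ y → γ x ≠ γ y) :
    (inc ℓ γ X₁).card + (inc ℓ γ X₂).card = (inc ℓ γ X).card := by
  rw [← Finset.card_union_of_disjoint]
  · rw [inc, inc, ← Finset.image_union, hX]; rfl
  · rw [Finset.disjoint_left]
    intro c hc hd'
    obtain ⟨x, hx, e1, e2⟩ := mem_inc.1 hc
    obtain ⟨y, hy, e3, e4⟩ := mem_inc.1 hd'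
    exact hd x hx y hy (e1.trans e3.symm) (e2.trans e4.symm)

theorem inc_firsts_card_le : (inc ℓ γ (firsts ℓ γ P G)).card ≤ letters ℓ G := by
  classical
  refine (inc_card_le_letters ?_).trans (letters_mono (Finset.filter_subset _ _))
  intro x hx y hy e
  simp only [firsts, Finset.mem_filter] at hx hy
  by_contra hne
  rcases lt_or_gt_of_ne hne with h | h
  · exact hy.2.2 ⟨x, hx.1, e, h⟩
  · exact hx.2.2 ⟨y, hy.1, e.symm, h⟩

theorem inc_lasts_card_le : (inc ℓ γ (lasts ℓ γ P G)).card ≤ letters ℓ G := by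
  classical
  refine (inc_card_le_letters ?_).trans (letters_mono (Finset.filter_subset _ _))
  intro x hx y hy e
  simp only [lasts, Finset.mem_filter] at hx hy
  by_contra hne
  rcases lt_or_gt_of_ne hne with h | h
  · exact hx.2.2.2 ⟨y, hy.1, e.symm, h⟩
  · exact hy.2.2.2 ⟨x, hx.1, e, h⟩

/-- If every letter of `G` occurs in two groups of `P` then `G` is the disjoint union of its first,
last and middle occurrences. -/
theorem split_global (hGP : G ⊆ P) (hgl : ∀ x ∈ G, Earlier ℓ γ P x ∨ Later ℓ γ P x) :
    G = firsts ℓ γ P G ∪ (lasts ℓ γ P G ∪ mids ℓ γ G) := by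
  classical
  ext x
  simp only [firsts, lasts, mids, Finset.mem_union, Finset.mem_filter]
  constructor
  · intro hx
    have h1 := hgl x hx
    have h2 : Earlier ℓ γ G x → Earlier ℓ γ P x := fun ⟨y, hy, h⟩ => ⟨y, hGP hy, h⟩
    have h3 : Later ℓ γ G x → Later ℓ γ P x := fun ⟨y, hy, h⟩ => ⟨y, hGP hy, h⟩
    tauto
  · tauto

theorem inc_split_card (hGP : G ⊆ P) (hgl : ∀ x ∈ G, Earlier ℓ γ P x ∨ Later ℓ γ P x) :
    (inc ℓ γ (firsts ℓ γ P G)).card + (inc ℓ γ (lasts ℓ γ P G)).card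
      + (inc ℓ γ (mids ℓ γ G)).card = (inc ℓ γ G).card := by
  have h1 := inc_add_inc_card (ℓ := ℓ) (γ := γ) (split_global hGP hgl).symm ?_
  · have h2 := inc_add_inc_card (ℓ := ℓ) (γ := γ) (X₁ := lasts ℓ γ P G) (X₂ := mids ℓ γ G) rfl ?_
    · omega
    · intro x hx y hy e e'
      simp only [lasts, mids, Finset.mem_filter] at hx hy
      exact hx.2.2.2 (hy.2.2.congr e.symm e'.symm)
  · intro x hx y hy e e'
    simp only [firsts, lasts, mids, Finset.mem_union, Finset.mem_filter] at hx hy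
    rcases hy with hy | hy
    · exact hy.2.1 ⟨hx.2.1.congr e e', fun h => hx.2.2 (h.congr e.symm e'.symm)⟩
    · exact hx.2.2 (hy.2.1.congr e.symm e'.symm)

theorem Earlier.before {x : ℤ} (hm : Mono γ P) (hx : Earlier ℓ γ P x) (hXP : X ⊆ P)
    (hX : ∀ y ∈ X, γ y = γ x) : Before ℓ P X (ℓ x) := by
  obtain ⟨y, hy, e, h⟩ := hx
  exact ⟨y, hy, e, fun u hu => hm.lt hy (hXP hu) (by rw [hX u hu]; exact h)⟩

theorem Later.after {x : ℤ} (hm : Mono γ P) (hx : Later ℓ γ P x) (hXP : X ⊆ P)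
    (hX : ∀ y ∈ X, γ y = γ x) : After ℓ P X (ℓ x) := by
  obtain ⟨y, hy, e, h⟩ := hx
  exact ⟨y, hy, e, fun u hu => hm.lt (hXP hu) hy (by rw [hX u hu]; exact h)⟩

open scoped Classical in
/-- The occurrences of the letters that occur in one group only. -/
noncomputable def locals (ℓ : ℤ → ℕ) (γ : ℤ → ℤ) (P : Finset ℤ) : Finset ℤ :=
  P.filter fun x => ¬ (Earlier ℓ γ P x ∨ Later ℓ γ P x)

open scoped Classical in
/-- The occurrences of the letters that occur in two or more groups. -/
noncomputable def globals (ℓ : ℤ → ℕ) (γ : ℤ → ℤ) (P : Finset ℤ) : Finset ℤ :=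
  P.filter fun x => Earlier ℓ γ P x ∨ Later ℓ γ P x

theorem locals_subset : locals ℓ γ P ⊆ P := by
  classical exact Finset.filter_subset _ _

theorem globals_subset : globals ℓ γ P ⊆ P := by
  classical exact Finset.filter_subset _ _

theorem mem_globals_iff_of_eq {x y : ℤ} (hx : x ∈ P) (hy : y ∈ P) (e : ℓ x = ℓ y)
    (h : x ∈ globals ℓ γ P) : y ∈ globals ℓ γ P := by
  simp only [globals, Finset.mem_filter] at h ⊢
  refine ⟨hy, ?_⟩
  by_cases hγ : γ x = γ y
  · exact h.2.imp (fun h => h.congr e hγ) (fun h => h.congr e hγ)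
  · rcases lt_or_gt_of_ne hγ with h | h
    · exact Or.inl ⟨x, hx, e, h⟩
    · exact Or.inr ⟨x, hx, e, h⟩

theorem mem_locals_or_globals {x : ℤ} (hx : x ∈ P) : x ∈ locals ℓ γ P ∨ x ∈ globals ℓ γ P := by
  simp only [locals, globals, Finset.mem_filter]; tauto

theorem not_mem_locals_of_globals {x y : ℤ} (h : x ∈ globals ℓ γ P) (e : ℓ x = ℓ y) :
    y ∉ locals ℓ γ P := by
  intro hy
  have := mem_globals_iff_of_eq (globals_subset h) (locals_subset hy) e h
  simp only [locals, globals, Finset.mem_filter] at this hy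
  exact hy.2 this.2

theorem letters_locals_add_globals :
    letters ℓ (locals ℓ γ P) + letters ℓ (globals ℓ γ P) = letters ℓ P := by
  classical
  rw [letters, letters, letters, ← Finset.card_union_of_disjoint, ← Finset.image_union]
  · congr 2
    ext x
    simp only [locals, globals, Finset.mem_union, Finset.mem_filter]; tauto
  · rw [Finset.disjoint_left]
    intro a ha hb
    obtain ⟨x, hx, rfl⟩ := Finset.mem_image.1 ha
    obtain ⟨y, hy, e⟩ := Finset.mem_image.1 hb
    exact not_mem_locals_of_globals hy e hx

theorem locals_eq {x y : ℤ} (hx : x ∈ locals ℓ γ P) (hy : y ∈ P) (e : ℓ x = ℓ y) : γ x = γ y := by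
  simp only [locals, Finset.mem_filter] at hx
  by_contra hne
  rcases lt_or_gt_of_ne hne with h | h
  · exact hx.2 (Or.inr ⟨y, hy, e.symm, h⟩)
  · exact hx.2 (Or.inl ⟨y, hy, e.symm, h⟩)

theorem inc_locals_card : (inc ℓ γ (locals ℓ γ P)).card ≤ letters ℓ (locals ℓ γ P) :=
  inc_card_le_letters fun _ hx _ hy e => locals_eq hx (locals_subset hy) e

theorem globals_global {x : ℤ} (hx : x ∈ globals ℓ γ P) :
    Earlier ℓ γ P x ∨ Later ℓ γ P x := by
  simp only [globals, Finset.mem_filter] at hx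
  exact hx.2

/-- If there are only two groups then no global letter has a middle group. -/
theorem mids_eq_empty (hG : Fits γ G 1) : mids ℓ γ G = ∅ := by
  simp only [mids, Finset.filter_eq_empty_iff]
  rintro x hx ⟨⟨y, hy, -, h1⟩, ⟨z, hz, -, h2⟩⟩
  have e1 := hG x hx y hy
  have e2 := hG x hx z hz
  norm_num at e1 e2
  omega

end Split

/-! ### Feathers of a set of letter-block incidences -/

/-- Below level `k + 1` the block `v` branches off, to the right, from the left wing of the
projection tree of `a`, whose incidences are those in `K`; the crown of `a` lies strictly above
level `k + 1`. -/
def DoveBranch (K : Finset (ℕ × ℤ)) (a : ℕ) (v : ℤ) (k : ℕ) : Prop :=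
  ∃ t T : ℤ, (a, t) ∈ K ∧ (∀ u, (a, u) ∈ K → t ≤ u) ∧ (a, T) ∈ K ∧
    T / 2 ^ (k + 1) ≠ t / 2 ^ (k + 1) ∧ v / 2 ^ (k + 1) = t / 2 ^ (k + 1) ∧
    v / 2 ^ k ≠ t / 2 ^ k

/-- The incidence `c` is a dove feather: its block is the rightmost one, for its letter, below the
node of level `k` at which it branches off from the left wing. -/
def IsDove (K : Finset (ℕ × ℤ)) (c : ℕ × ℤ) : Prop :=
  c ∈ K ∧ ∃ k, DoveBranch K c.1 c.2 k ∧ ∀ u, (c.1, u) ∈ K → c.2 < u → u / 2 ^ k ≠ c.2 / 2 ^ k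

/-- The mirror image of a set of incidences. The floor of `(-1 - v) / 2 ^ k` is
`-1 - v / 2 ^ k`, so that `v ↦ -1 - v` is a symmetry of the binary tree. -/
def refl (K : Finset (ℕ × ℤ)) : Finset (ℕ × ℤ) := K.image fun c => (c.1, -1 - c.2)

/-- Hawk feathers are the mirror images of dove feathers. -/
def IsHawk (K : Finset (ℕ × ℤ)) (c : ℕ × ℤ) : Prop := IsDove (refl K) (c.1, -1 - c.2)

open scoped Classical in
/-- The set of dove feathers. -/
noncomputable def doves (K : Finset (ℕ × ℤ)) : Finset (ℕ × ℤ) := K.filter (IsDove K)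

open scoped Classical in
/-- The set of hawk feathers. -/
noncomputable def hawks (K : Finset (ℕ × ℤ)) : Finset (ℕ × ℤ) := K.filter (IsHawk K)

theorem mem_doves {K : Finset (ℕ × ℤ)} {c : ℕ × ℤ} : c ∈ doves K ↔ IsDove K c := by
  simp only [doves, Finset.mem_filter, and_iff_right_iff_imp]
  exact fun h => h.1

theorem mem_hawks {K : Finset (ℕ × ℤ)} {c : ℕ × ℤ} : c ∈ hawks K ↔ c ∈ K ∧ IsHawk K c := by
  simp only [hawks, Finset.mem_filter]

theorem mem_refl {K : Finset (ℕ × ℤ)} {a : ℕ} {v : ℤ} : (a, v) ∈ refl K ↔ (a, -1 - v) ∈ K := by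
  simp only [refl, Finset.mem_image, Prod.mk.injEq, Prod.exists]
  constructor
  · rintro ⟨b, u, h, rfl, rfl⟩
    simpa using h
  · exact fun h => ⟨a, -1 - v, h, rfl, by ring⟩

theorem refl_ediv (v : ℤ) (k : ℕ) : (-1 - v) / 2 ^ k = -1 - v / 2 ^ k := by
  have hp : (0 : ℤ) < 2 ^ k := by positivity
  have h1 := Int.mul_ediv_add_emod v (2 ^ k)
  have h2 := Int.emod_nonneg v hp.ne'
  have h3 := Int.emod_lt_of_pos v hp
  rw [Int.ediv_eq_iff_of_pos hp]
  constructor <;> nlinarith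

theorem lt_of_ediv_lt {u v : ℤ} {k : ℕ} (h : u / 2 ^ k < v / 2 ^ k) : u < v := by
  by_contra hc
  have := ediv_mono (not_lt.1 hc) k
  omega

theorem ediv_succ (v : ℤ) (k : ℕ) : v / 2 ^ (k + 1) = v / 2 ^ k / 2 := by
  rw [← ediv_pow_add, pow_one]

/-- A node has only two children. -/
theorem not_three_children {u v w : ℤ} {k : ℕ} (h1 : u < v) (h2 : v < w)
    (e : u / 2 ^ (k + 1) = w / 2 ^ (k + 1)) : u / 2 ^ k = v / 2 ^ k ∨ v / 2 ^ k = w / 2 ^ k := by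
  rw [ediv_succ, ediv_succ] at e
  have := ediv_mono h1.le k
  have := ediv_mono h2.le k
  omega

theorem DoveBranch.lt {K : Finset (ℕ × ℤ)} {a : ℕ} {v : ℤ} {k : ℕ} (h : DoveBranch K a v k)
    (hv : (a, v) ∈ K) : (∃ t, (a, t) ∈ K ∧ t < v) ∧ ∃ T, (a, T) ∈ K ∧ v < T := by
  obtain ⟨t, T, ht, hmin, hT, h1, h2, h3⟩ := h
  refine ⟨⟨t, ht, lt_of_le_of_ne (hmin v hv) ?_⟩, ⟨T, hT, ?_⟩⟩
  · rintro rfl; exact h3 rfl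
  · refine lt_of_ediv_lt (k := k + 1) ?_
    have := ediv_mono (hmin T hT) (k + 1)
    omega

theorem exists_level {D : ℕ} {u v : ℤ} (h : u / 2 ^ D = v / 2 ^ D) (hne : u ≠ v) :
    ∃ k, k < D ∧ u / 2 ^ (k + 1) = v / 2 ^ (k + 1) ∧ u / 2 ^ k ≠ v / 2 ^ k := by
  induction D with
  | zero => simp at h; exact absurd h hne
  | succ D ih =>
    by_cases hD : u / 2 ^ D = v / 2 ^ D
    · obtain ⟨k, h1, h2⟩ := ih hD
      exact ⟨k, by omega, h2⟩
    · exact ⟨D, by omega, h, hD⟩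

/-- A middle occurrence lies below the left head or below the right head. -/
theorem exists_branch {K : Finset (ℕ × ℤ)} {a : ℕ} {v t T : ℤ} {D : ℕ} (ht : (a, t) ∈ K)
    (hmin : ∀ u, (a, u) ∈ K → t ≤ u) (hT : (a, T) ∈ K) (hmax : ∀ u, (a, u) ∈ K → u ≤ T)
    (h1 : t < v) (h2 : v < T) (hD : t / 2 ^ D = T / 2 ^ D) :
    ∃ k, DoveBranch K a v k ∨ DoveBranch (refl K) a (-1 - v) k := by
  have hvD : v / 2 ^ D = t / 2 ^ D := by
    have := ediv_mono h1.le D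
    have := ediv_mono h2.le D
    omega
  obtain ⟨k, -, e1, n1⟩ := exists_level hvD h1.ne'
  by_cases hc : T / 2 ^ (k + 1) = t / 2 ^ (k + 1)
  · obtain ⟨k', hk', e2, n2⟩ := exists_level (e1.trans hc.symm) h2.ne
    refine ⟨k', Or.inr ⟨-1 - T, -1 - t, mem_refl.2 (by simpa using hT), fun u hu => ?_,
      mem_refl.2 (by simpa using ht), ?_, ?_, ?_⟩⟩
    · have := hmax _ (mem_refl.1 hu); omega
    · rw [refl_ediv, refl_ediv]
      intro hcon
      rcases Nat.lt_succ_iff_lt_or_eq.1 hk' with hlt | rfl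
      · have e3 : v / 2 ^ (k' + 1) = t / 2 ^ (k' + 1) := by omega
        exact n1 (ediv_eq_of_le hlt e3)
      · rcases not_three_children (k := k') h1 h2 (by omega) with h | h
        · exact n1 h.symm
        · exact n2 h
    · rw [refl_ediv, refl_ediv]; omega
    · rw [refl_ediv, refl_ediv]; omega
  · exact ⟨k, Or.inl ⟨t, T, ht, hmin, hT, hc, e1, n1⟩⟩

/-- If `a` and `b` occur in the same block, both below their left heads, and the occurrence of `a`
is not a feather, then on one side of that block an occurrence of `a` precedes one of `b`. -/
theorem exists_pair_of_not_dove {K : Finset (ℕ × ℤ)} {a b : ℕ} {v : ℤ} {i j : ℕ}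
    (ha : (a, v) ∈ K) (hb : (b, v) ∈ K) (hbra : DoveBranch K a v i) (hbrb : DoveBranch K b v j)
    (hna : ¬ IsDove K (a, v)) :
    ∃ u u', (a, u) ∈ K ∧ (b, u') ∈ K ∧ u < u' ∧ (v < u ∨ u' < v) := by
  have : ∃ y, (a, y) ∈ K ∧ v < y ∧ y / 2 ^ i = v / 2 ^ i := by
    by_contra hcon
    push Not at hcon
    exact hna ⟨ha, i, hbra, hcon⟩
  obtain ⟨y, hy, hvy, ey⟩ := this
  have hbr := hbrb
  have hlt := (hbrb.lt hb).1
  obtain ⟨s, S, hs, hsmin, hS, n1, e2, n2⟩ := hbrb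
  have hSv : v / 2 ^ (j + 1) < S / 2 ^ (j + 1) := by
    have := ediv_mono (hsmin S hS) (j + 1)
    omega
  have hvS : v < S := lt_of_ediv_lt hSv
  by_cases hSi : S / 2 ^ i = v / 2 ^ i
  · -- the right head of `b` lies in the part of the tree that branches off for `a`, and so
    -- does all of `b`, whereas the leftmost `a` precedes that part
    have hji : j + 1 ≤ i := by
      by_contra hc
      have := ediv_eq_of_le (show i ≤ j + 1 by omega) hSi
      omega
    obtain ⟨t, T, ht, htmin, -, -, -, m2⟩ := hbra
    have hs' := ediv_eq_of_le hji e2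
    have := ediv_mono (htmin v ha) i
    have hts : t < s := lt_of_ediv_lt (k := i) (by omega)
    refine ⟨t, s, ht, hs, hts, Or.inr (lt_of_le_of_ne (hsmin v hb) ?_)⟩
    rintro rfl
    exact n2 rfl
  · have := ediv_mono hvS.le i
    exact ⟨y, S, hy, hS, lt_of_ediv_lt (k := i) (by omega), Or.inl hvy⟩

/-! ### The bounds for standard Davenport-Schinzel sequences -/

/-- `A * n + B * 2 ^ H` bounds the number of incidences of the order-`s` DS sequences with `n`
letters whose blocks lie below a node of level `H`. -/
def DSBound (s H : ℕ) (A B : ℝ) : Prop := ∀ (ℓ : ℤ → ℕ) (β : ℤ → ℤ) (P : Finset ℤ), Mono β P →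
  Fits β P H → AltFree ℓ P (s + 2) → ((inc ℓ β P).card : ℝ) ≤ A * letters ℓ P + B * 2 ^ H

/-- `A * n + B * 2 ^ H` bounds the number of dove feathers of the order-`s` DS sequences with `n`
letters whose blocks lie below a node of level `H`. -/
def FeatherBound (s H : ℕ) (A B : ℝ) : Prop := ∀ (ℓ : ℤ → ℕ) (β : ℤ → ℤ) (P : Finset ℤ),
  Mono β P → Fits β P H → AltFree ℓ P (s + 2) →
    ((doves (inc ℓ β P)).card : ℝ) ≤ A * letters ℓ P + B * 2 ^ H

theorem DSBound.weaken {s H : ℕ} {A B A' B' : ℝ} (h : DSBound s H A B) (hA : A ≤ A')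
    (hB : B ≤ B') : DSBound s H A' B' := fun ℓ β P h1 h2 h3 =>
  (h ℓ β P h1 h2 h3).trans (by gcongr)

theorem FeatherBound.weaken {s H : ℕ} {A B A' B' : ℝ} (h : FeatherBound s H A B) (hA : A ≤ A')
    (hB : B ≤ B') : FeatherBound s H A' B' := fun ℓ β P h1 h2 h3 =>
  (h ℓ β P h1 h2 h3).trans (by gcongr)

section Reverse
variable {ℓ : ℤ → ℕ} {P : Finset ℤ} {k : ℕ}

theorem Chain.reverse {a b : ℕ} {x z : ℤ} (h : Chain Eq ℓ P k a b x z) :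
    Chain Eq (fun x => ℓ (-x)) (P.image Neg.neg) k (if Even k then b else a)
      (if Even k then a else b) (-z) (-x) := by
  induction k generalizing a b x with
  | zero => exact neg_lt_neg h
  | succ k ih =>
    obtain ⟨y, y', m1, m2, e1, e2, h1, h2, rfl, h4⟩ := h
    have hm : -y ∈ P.image Neg.neg := Finset.mem_image_of_mem _ m1
    have := (ih h4).snoc (y := -y) (y' := -y) (z' := -x) le_rfl hm hm
      (by by_cases hk : Even k <;> simp [hk, e1]) (by by_cases hk : Even k <;> simp [hk, e1])
      le_rfl rfl (by omega)
    by_cases hk : Even k <;> simpa [hk, Nat.even_add_one] using this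

theorem AltFree.reverse (h : AltFree ℓ P k) :
    AltFree (fun x => ℓ (-x)) (P.image Neg.neg) k := by
  intro a b x z hab hc
  have := hc.reverse
  simp only [neg_neg, Finset.image_image] at this
  have e : P.image (Neg.neg ∘ Neg.neg) = P := by
    ext; simp
  rw [e] at this
  refine h _ _ _ _ ?_ this
  split_ifs
  · exact hab.symm
  · exact hab

theorem hawks_eq (β : ℤ → ℤ) : (hawks (inc ℓ β P)).card =
    (doves (inc (fun x => ℓ (-x)) (fun x => -1 - β (-x)) (P.image Neg.neg))).card := by
  have e : inc (fun x => ℓ (-x)) (fun x => -1 - β (-x)) (P.image Neg.neg) = refl (inc ℓ β P) := by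
    ext ⟨a, v⟩
    rw [mem_refl, mem_inc, mem_inc]
    constructor
    · rintro ⟨x, hx, rfl, rfl⟩
      obtain ⟨y, hy, rfl⟩ := Finset.mem_image.1 hx
      exact ⟨y, hy, by simp, by simp⟩
    · rintro ⟨x, hx, rfl, e⟩
      exact ⟨-x, Finset.mem_image_of_mem _ hx, by simp, by simp [e]⟩
  rw [e]
  refine Finset.card_bij (fun c _ => (c.1, -1 - c.2)) ?_ ?_ ?_
  · intro c hc
    exact mem_doves.2 (mem_hawks.1 hc).2
  · rintro ⟨a, u⟩ - ⟨b, v⟩ - h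
    simp only [Prod.mk.injEq] at h ⊢
    exact ⟨h.1, by omega⟩
  · rintro ⟨a, u⟩ h
    have h' := mem_doves.1 h
    refine ⟨(a, -1 - u), ?_, by simp⟩
    rw [mem_hawks, IsHawk]
    exact ⟨mem_refl.1 h'.1, by simpa using h'⟩

/-- By symmetry the bound on dove feathers holds for hawk feathers too. -/
theorem FeatherBound.hawks_le {s H : ℕ} {A B : ℝ} (h : FeatherBound s H A B) {β : ℤ → ℤ}
    (hm : Mono β P) (hf : Fits β P H) (ha : AltFree ℓ P (s + 2)) :
    ((hawks (inc ℓ β P)).card : ℝ) ≤ A * letters ℓ P + B * 2 ^ H := by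
  have := h (fun x => ℓ (-x)) (fun x => -1 - β (-x)) (P.image Neg.neg) ?_ ?_ ha.reverse
  · rw [hawks_eq]
    convert this using 4
    rw [letters, letters, Finset.image_image]
    congr 1
    ext; simp
  · intro x hx y hy hxy
    obtain ⟨x', hx', rfl⟩ := Finset.mem_image.1 hx
    obtain ⟨y', hy', rfl⟩ := Finset.mem_image.1 hy
    have := hm y' hy' x' hx' (by omega)
    simp only [neg_neg]
    omega
  · intro x hx y hy
    obtain ⟨x', hx', rfl⟩ := Finset.mem_image.1 hx
    obtain ⟨y', hy', rfl⟩ := Finset.mem_image.1 hy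
    simp only [neg_neg, refl_ediv]
    have := hf x' hx' y' hy'
    omega

end Reverse

section DS
variable {ℓ : ℤ → ℕ} {β γ : ℤ → ℤ} {P G X : Finset ℤ}

theorem inc_card_le_blocks {H : ℕ} (hf : Fits β X H)
    (h : ∀ x ∈ X, ∀ y ∈ X, β x = β y → x < y → ℓ x = ℓ y) : (inc ℓ β X).card ≤ 2 ^ H := by
  refine le_trans ?_ hf.card_image_le
  have e : (inc ℓ β X).image Prod.snd = X.image β := by
    ext a; simp [inc]
  rw [← e, Finset.card_image_of_injOn]
  rintro ⟨a, u⟩ hc ⟨b, v⟩ hd (rfl : u = v)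
  obtain ⟨x, hx, rfl, e2⟩ := mem_inc.1 hc
  obtain ⟨y, hy, rfl, e4⟩ := mem_inc.1 hd
  simp only at e2 e4
  rcases lt_trichotomy x y with hxy | rfl | hxy
  · rw [h x hx y hy (e2.trans e4.symm) hxy]
  · rfl
  · rw [h y hy x hx (e4.trans e2.symm) hxy]

theorem inc_union_card_le {X₁ X₂ : Finset ℤ} (h : X ⊆ X₁ ∪ X₂) :
    (inc ℓ β X).card ≤ (inc ℓ β X₁).card + (inc ℓ β X₂).card := by
  refine (Finset.card_le_card (inc_mono h)).trans ?_
  rw [inc, Finset.image_union]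
  exact Finset.card_union_le _ _

open scoped Classical in
theorem inc_not_later_card_le :
    (inc ℓ β (P.filter fun x => ¬ Later ℓ β P x)).card ≤ letters ℓ P := by
  refine (inc_card_le_letters ?_).trans (letters_mono (Finset.filter_subset _ _))
  intro x hx y hy e
  rw [Finset.mem_filter] at hx hy
  by_contra hne
  rcases lt_or_gt_of_ne hne with h | h
  · exact hx.2 ⟨y, hy.1, e.symm, h⟩
  · exact hy.2 ⟨x, hx.1, e, h⟩

open scoped Classical in
theorem inc_not_earlier_card_le :
    (inc ℓ β (P.filter fun x => ¬ Earlier ℓ β P x)).card ≤ letters ℓ P := by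
  refine (inc_card_le_letters ?_).trans (letters_mono (Finset.filter_subset _ _))
  intro x hx y hy e
  rw [Finset.mem_filter] at hx hy
  by_contra hne
  rcases lt_or_gt_of_ne hne with h | h
  · exact hy.2 ⟨x, hx.1, e, h⟩
  · exact hx.2 ⟨y, hy.1, e.symm, h⟩

/-- In an `aba`-free sequence every block has at most one occurrence that is not the last one of
its letter. -/
theorem dsBound_one (H : ℕ) : DSBound 1 H 1 1 := by
  classical
  intro ℓ β P hm hf ha
  have h1 := inc_union_card_le (ℓ := ℓ) (β := β) (X := P)
    (X₁ := P.filter fun x => ¬ Later ℓ β P x) (X₂ := P.filter fun x => Later ℓ β P x)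
    (fun x hx => by simp only [Finset.mem_union, Finset.mem_filter]; tauto)
  have h2 := inc_not_later_card_le (ℓ := ℓ) (β := β) (P := P)
  have h3 : (inc ℓ β (P.filter fun x => Later ℓ β P x)).card ≤ 2 ^ H := by
    refine inc_card_le_blocks (hf.mono (Finset.filter_subset _ _)) ?_
    intro x hx y hy e hxy
    rw [Finset.mem_filter] at hx hy
    by_contra hne
    obtain ⟨z, hz, ez, hxz⟩ := hx.2
    have hyz : y < z := hm.lt hy.1 hz (by omega)
    exact ha (ℓ x) (ℓ y) (x - 1) (z + 1) hne
      ⟨x, x, hx.1, hx.1, rfl, rfl, by omega, le_rfl, rfl, y, y, hy.1, hy.1, rfl, rfl, hxy, le_rfl,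
        rfl, z, z, hz, hz, ez, ez, hyz, le_rfl, rfl, show z < z + 1 by omega⟩
  have : (inc ℓ β P).card ≤ letters ℓ P + 2 ^ H := by omega
  rw [one_mul, one_mul]
  exact_mod_cast this

/-- In an `abab`-free sequence every block has at most one middle occurrence. -/
theorem eq_of_middle (hm : Mono β P) (ha : AltFree ℓ P 4) {x y : ℤ} (hx : x ∈ P) (hy : y ∈ P)
    (e : β x = β y) (hxy : x < y) (hL : Later ℓ β P x) (hE : Earlier ℓ β P y) : ℓ x = ℓ y := by
  by_contra hne
  obtain ⟨z, hz, ez, hxz⟩ := hL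
  obtain ⟨w, hw, ew, hwy⟩ := hE
  have hyz : y < z := hm.lt hy hz (by omega)
  have hwx : w < x := hm.lt hw hx (by omega)
  exact ha (ℓ y) (ℓ x) (w - 1) (z + 1) (Ne.symm hne)
    ⟨w, w, hw, hw, ew, ew, by omega, le_rfl, rfl, x, x, hx, hx, rfl, rfl, hwx, le_rfl, rfl,
      y, y, hy, hy, rfl, rfl, hxy, le_rfl, rfl, z, z, hz, hz, ez, ez, hyz, le_rfl, rfl,
      show z < z + 1 by omega⟩

open scoped Classical in
theorem inc_middle_card_le {H : ℕ} (hm : Mono β P) (hf : Fits β P H) (ha : AltFree ℓ P 4) :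
    (inc ℓ β (P.filter fun x => Later ℓ β P x ∧ Earlier ℓ β P x)).card ≤ 2 ^ H := by
  refine inc_card_le_blocks (hf.mono (Finset.filter_subset _ _)) ?_
  intro x hx y hy e hxy
  rw [Finset.mem_filter] at hx hy
  exact eq_of_middle hm ha hx.1 hy.1 e hxy hx.2.1 hy.2.2

theorem dsBound_two (H : ℕ) : DSBound 2 H 2 1 := by
  classical
  intro ℓ β P hm hf ha
  have h1 := inc_union_card_le (ℓ := ℓ) (β := β) (X := P)
    (X₁ := P.filter fun x => ¬ Later ℓ β P x) (X₂ := P.filter fun x => Later ℓ β P x)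
    (fun x hx => by simp only [Finset.mem_union, Finset.mem_filter]; tauto)
  have h1' := inc_union_card_le (ℓ := ℓ) (β := β) (X := P.filter fun x => Later ℓ β P x)
    (X₁ := P.filter fun x => ¬ Earlier ℓ β P x)
    (X₂ := P.filter fun x => Later ℓ β P x ∧ Earlier ℓ β P x)
    (fun x hx => by simp only [Finset.mem_union, Finset.mem_filter] at hx ⊢; tauto)
  have h2 := inc_not_later_card_le (ℓ := ℓ) (β := β) (P := P)
  have h2' := inc_not_earlier_card_le (ℓ := ℓ) (β := β) (P := P)
  have h3 := inc_middle_card_le hm hf ha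
  have : (inc ℓ β P).card ≤ 2 * letters ℓ P + 2 ^ H := by omega
  rw [one_mul]
  exact_mod_cast this

theorem DSBound.sum {s h H : ℕ} {A B : ℝ} (hD : DSBound s h A B) (hB : 0 ≤ B) (hh : h ≤ H)
    (hm : Mono β X) (hf : Fits β X H)
    (ha : ∀ g, AltFree ℓ (X.filter fun x => β x / 2 ^ h = g) (s + 2)) :
    ((inc ℓ β X).card : ℝ) ≤ A * (inc ℓ (fun x => β x / 2 ^ h) X).card + B * 2 ^ H := by
  refine card_le_of_groups _ (fun c => c.2 / 2 ^ h) hh hf hB ?_ fun g => ?_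
  · intro c hc
    obtain ⟨x, hx, -, e⟩ := mem_inc.1 hc
    exact ⟨x, hx, by rw [e]⟩
  · have e : (inc ℓ β X).filter (fun c => c.2 / 2 ^ h = g) =
        inc ℓ β (X.filter fun x => β x / 2 ^ h = g) := by
      ext c
      simp only [Finset.mem_filter, mem_inc]
      constructor
      · rintro ⟨⟨x, hx, e1, e2⟩, rfl⟩
        exact ⟨x, ⟨hx, by rw [e2]⟩, e1, e2⟩
      · rintro ⟨x, ⟨hx, rfl⟩, e1, e2⟩
        exact ⟨⟨x, hx, e1, e2⟩, by rw [e2]⟩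
    rw [e]
    refine hD ℓ β _ (hm.mono (Finset.filter_subset _ _)) ?_ (ha g)
    intro x hx y hy
    rw [(Finset.mem_filter.1 hx).2, (Finset.mem_filter.1 hy).2]

theorem altFree_firsts {k : ℕ} (hm : Mono γ P) (hGP : G ⊆ P) (ha : AltFree ℓ P (k + 1))
    (hk : 2 ≤ k) (g : ℤ) : AltFree ℓ ((firsts ℓ γ P G).filter fun x => γ x = g) k := by
  have hsub : ((firsts ℓ γ P G).filter fun x => γ x = g) ⊆ P := fun x hx => by
    simp only [firsts, Finset.mem_filter] at hx
    exact hGP hx.1.1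
  refine ha.of_after hk hsub fun x hx => ?_
  have hx' := hx
  simp only [firsts, Finset.mem_filter] at hx'
  exact Later.after hm hx'.1.2.1 hsub fun y hy => by
    rw [(Finset.mem_filter.1 hy).2, hx'.2]

theorem altFree_lasts {k : ℕ} (hm : Mono γ P) (hGP : G ⊆ P) (ha : AltFree ℓ P (k + 1))
    (hk : 2 ≤ k) (g : ℤ) : AltFree ℓ ((lasts ℓ γ P G).filter fun x => γ x = g) k := by
  have hsub : ((lasts ℓ γ P G).filter fun x => γ x = g) ⊆ P := fun x hx => by
    simp only [lasts, Finset.mem_filter] at hx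
    exact hGP hx.1.1
  refine ha.of_before hk hsub fun x hx => ?_
  have hx' := hx
  simp only [lasts, Finset.mem_filter] at hx'
  exact Earlier.before hm hx'.1.2.2.1 hsub fun y hy => by
    rw [(Finset.mem_filter.1 hy).2, hx'.2]

theorem mids_subset : mids ℓ γ G ⊆ G := by
  classical exact Finset.filter_subset _ _

theorem mem_mids {x : ℤ} : x ∈ mids ℓ γ G ↔ x ∈ G ∧ Earlier ℓ γ G x ∧ Later ℓ γ G x := by
  simp only [mids, Finset.mem_filter]

/-- Middle occurrences lie between earlier and later ones, and this also holds within any set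
`X` of middle occurrences in one group. -/
theorem before_after_of_mids (hm : Mono γ G) {x : ℤ} (hx : x ∈ X) (hX : X ⊆ mids ℓ γ G)
    (hg : ∀ y ∈ X, γ y = γ x) : Before ℓ G X (ℓ x) ∧ After ℓ G X (ℓ x) := by
  obtain ⟨-, h1, h2⟩ := mem_mids.1 (hX hx)
  exact ⟨h1.before hm (hX.trans mids_subset) hg, h2.after hm (hX.trans mids_subset) hg⟩

theorem altFree_mids {k : ℕ} (hm : Mono γ G) (ha : AltFree ℓ G (k + 2)) (hk : 2 ≤ k)
    (hX : X ⊆ mids ℓ γ G) (g : ℤ) : AltFree ℓ (X.filter fun x => γ x = g) k := by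
  have hsub := (Finset.filter_subset (fun x => γ x = g) X).trans hX
  have key := fun x (hx : x ∈ X.filter fun x => γ x = g) =>
    before_after_of_mids hm hx hsub fun y hy => by
      rw [(Finset.mem_filter.1 hy).2, (Finset.mem_filter.1 hx).2]
  exact ha.of_before_after hk (hsub.trans mids_subset) (fun x hx => (key x hx).1)
    fun x hx => (key x hx).2

/-- For any two letters with middle occurrences of `X` in the same group, `G` has, before or after
that group, an occurrence of the first letter followed by one of the second, in another group. -/
def HasPairs (ℓ : ℤ → ℕ) (γ : ℤ → ℤ) (G X : Finset ℤ) : Prop :=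
  ∀ x ∈ X, ∀ x' ∈ X, γ x = γ x' → ℓ x ≠ ℓ x' → ∃ u ∈ G, ∃ u' ∈ G, ℓ u = ℓ x ∧ ℓ u' = ℓ x' ∧
    γ u < γ u' ∧ (γ x < γ u ∨ γ u' < γ x)

theorem altFree_of_hasPairs {k : ℕ} (hm : Mono γ G) (ha : AltFree ℓ G (k + 3)) (hk : 2 ≤ k)
    (hke : Even k) (hX : X ⊆ mids ℓ γ G) (hN : HasPairs ℓ γ G X) (g : ℤ) :
    AltFree ℓ (X.filter fun x => γ x = g) k := by
  have hsub := (Finset.filter_subset (fun x => γ x = g) X).trans hX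
  have key := fun x (hx : x ∈ X.filter fun x => γ x = g) =>
    before_after_of_mids hm hx hsub fun y hy => by
      rw [(Finset.mem_filter.1 hy).2, (Finset.mem_filter.1 hx).2]
  refine ha.of_pairs hk hke (hsub.trans mids_subset) (fun x hx => (key x hx).1)
    (fun x hx => (key x hx).2) fun x hx x' hx' hne => ?_
  have hx1 := Finset.mem_filter.1 hx
  have hx2 := Finset.mem_filter.1 hx'
  obtain ⟨u, hu, u', hu', e, e', hlt, h⟩ :=
    hN x hx1.1 x' hx2.1 (hx1.2.trans hx2.2.symm) hne
  refine ⟨u, hu, u', hu', e, e', hm.lt hu hu' hlt, h.imp ?_ ?_⟩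
  · exact fun h w hw => hm.lt (mids_subset (hsub hw)) hu (by
      rw [(Finset.mem_filter.1 hw).2, ← hx1.2]; exact h)
  · exact fun h w hw => hm.lt hu' (mids_subset (hsub hw)) (by
      rw [(Finset.mem_filter.1 hw).2, ← hx1.2]; exact h)

/-- The middle occurrences are split into those in feathers and the others, below left and right
heads, respectively. -/
theorem exists_mids_split {D : ℕ} (hf : Fits γ G D) : ∃ M₁ M₂ M₃ : Finset ℤ,
    mids ℓ γ G = M₁ ∪ (M₂ ∪ M₃) ∧
    (inc ℓ γ M₁).card ≤ (doves (inc ℓ γ G)).card + (hawks (inc ℓ γ G)).card ∧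
    (inc ℓ γ M₂).card + (inc ℓ γ M₃).card ≤ (inc ℓ γ (mids ℓ γ G)).card ∧
    HasPairs ℓ γ G M₂ ∧ HasPairs ℓ γ G M₃ := by
  classical
  set K := inc ℓ γ G with hK
  set f : ℤ → Prop := fun x => IsDove K (ℓ x, γ x) ∨ IsHawk K (ℓ x, γ x) with hfe
  set d : ℤ → Prop := fun x => ∃ k, DoveBranch K (ℓ x) (γ x) k with hd
  have hmem : ∀ x ∈ mids ℓ γ G, (ℓ x, γ x) ∈ K := fun x hx =>
    mem_inc.2 ⟨x, mids_subset hx, rfl, rfl⟩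
  have hback : ∀ a u, (a, u) ∈ K → ∃ x ∈ G, ℓ x = a ∧ γ x = u := fun a u h => mem_inc.1 h
  refine ⟨(mids ℓ γ G).filter f, (mids ℓ γ G).filter fun x => ¬ f x ∧ d x,
    (mids ℓ γ G).filter fun x => ¬ f x ∧ ¬ d x, ?_, ?_, ?_, ?_, ?_⟩
  · ext x; simp only [Finset.mem_union, Finset.mem_filter]; tauto
  · refine (Finset.card_le_card ?_).trans (Finset.card_union_le _ _)
    rintro ⟨a, v⟩ hc
    obtain ⟨x, hx, rfl, rfl⟩ := mem_inc.1 hc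
    rw [Finset.mem_filter] at hx
    rw [Finset.mem_union, mem_doves, mem_hawks]
    exact hx.2.imp id fun h => ⟨hmem x hx.1, h⟩
  · rw [inc_add_inc_card (ℓ := ℓ) (γ := γ) rfl]
    · refine Finset.card_le_card (inc_mono fun x hx => ?_)
      simp only [Finset.mem_union, Finset.mem_filter] at hx
      tauto
    · intro x hx y hy e e'
      simp only [hd, Finset.mem_filter] at hx hy
      rw [e, e'] at hx
      exact hy.2.2 hx.2.2
  · intro x hx y hy e hne
    simp only [hfe, hd, Finset.mem_filter, not_or] at hx hy
    obtain ⟨hxm, ⟨hx1, -⟩, i, hi⟩ := hx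
    obtain ⟨hym, -, j, hj⟩ := hy
    rw [← e] at hj
    have hy' := hmem y hym
    rw [← e] at hy'
    obtain ⟨u, u', h1, h2, h3, h4⟩ := exists_pair_of_not_dove (hmem x hxm) hy' hi hj hx1
    obtain ⟨w, hw, ew, rfl⟩ := hback _ _ h1
    obtain ⟨w', hw', ew', rfl⟩ := hback _ _ h2
    exact ⟨w, hw, w', hw', ew, ew', h3, h4⟩
  -- every middle occurrence lies below one of the two heads; those not below the left head are
  -- treated like the others after a reflection, which exchanges doves and hawks
  · have hbr : ∀ x ∈ mids ℓ γ G, ¬ d x → ∃ k, DoveBranch (refl K) (ℓ x) (-1 - γ x) k := by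
      intro x hx hnd
      obtain ⟨hxG, ⟨y, hy, ey, hyx⟩, ⟨z, hz, ez, hxz⟩⟩ := mem_mids.1 hx
      have hne : ((K.filter fun c => c.1 = ℓ x).image Prod.snd).Nonempty :=
        ⟨γ x, Finset.mem_image.2 ⟨(ℓ x, γ x), by simp [hmem x hx], rfl⟩⟩
      obtain ⟨t, ht, htmin⟩ := Finset.exists_min_image _ id hne
      obtain ⟨T, hT, hTmax⟩ := Finset.exists_max_image _ id hne
      have hin : ∀ u, u ∈ (K.filter fun c => c.1 = ℓ x).image Prod.snd ↔ (ℓ x, u) ∈ K := by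
        intro u
        simp only [Finset.mem_image, Finset.mem_filter]
        constructor
        · rintro ⟨⟨a, v⟩, ⟨h, rfl⟩, rfl⟩; exact h
        · exact fun h => ⟨(ℓ x, u), ⟨h, rfl⟩, rfl⟩
      have hmin : ∀ u, (ℓ x, u) ∈ K → t ≤ u := fun u hu => htmin u ((hin u).2 hu)
      have hmax : ∀ u, (ℓ x, u) ∈ K → u ≤ T := fun u hu => hTmax u ((hin u).2 hu)
      have h1 := hmin (γ y) (mem_inc.2 ⟨y, hy, ey, rfl⟩)
      have h2 := hmax (γ z) (mem_inc.2 ⟨z, hz, ez, rfl⟩)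
      have ht' := (hin t).1 ht
      have hT' := (hin T).1 hT
      obtain ⟨wt, hwt, -, ewt⟩ := mem_inc.1 ht'
      obtain ⟨wT, hwT, -, ewT⟩ := mem_inc.1 hT'
      have hD := hf wt hwt wT hwT
      simp only at ewt ewT
      rw [ewt, ewT] at hD
      obtain ⟨k, hk | hk⟩ := exists_branch ht' hmin hT' hmax (h1.trans_lt hyx)
        (hxz.trans_le h2) hD
      · exact absurd ⟨k, hk⟩ hnd
      · exact ⟨k, hk⟩
    intro x hx y hy e hne
    simp only [hfe, Finset.mem_filter, not_or] at hx hy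
    obtain ⟨hxm, -, hxd⟩ := hx
    obtain ⟨hym, ⟨-, hy1⟩, hyd⟩ := hy
    obtain ⟨i, hi⟩ := hbr x hxm hxd
    obtain ⟨j, hj⟩ := hbr y hym hyd
    rw [e] at hi
    have hx' : (ℓ x, -1 - γ y) ∈ refl K := mem_refl.2 (by simpa [← e] using hmem x hxm)
    have hy' : (ℓ y, -1 - γ y) ∈ refl K := mem_refl.2 (by simpa using hmem y hym)
    obtain ⟨u, u', h1, h2, h3, h4⟩ := exists_pair_of_not_dove hy' hx' hj hi hy1
    obtain ⟨w, hw, ew, e3⟩ := hback _ _ (mem_refl.1 h1)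
    obtain ⟨w', hw', ew', e4⟩ := hback _ _ (mem_refl.1 h2)
    exact ⟨w', hw', w, hw, ew', ew, by omega, by omega⟩

/-- The contribution of all but the middle occurrences of the global letters. -/
theorem ds_split {s h H : ℕ} {A B A₁ B₁ : ℝ} (hh : h ≤ H) (hD : DSBound (s + 2) h A B)
    (hD₁ : DSBound (s + 1) h A₁ B₁) (hB : 0 ≤ B) (hB₁ : 0 ≤ B₁) (hA : 0 ≤ A) (hm : Mono β P)
    (hf : Fits β P H) (ha : AltFree ℓ P (s + 2 + 2)) (γ : ℤ → ℤ) (hγ : γ = fun x => β x / 2 ^ h)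
    (G : Finset ℤ) (hG : G = globals ℓ γ P) :
    ∃ f : ℝ, 0 ≤ f ∧ f ≤ 2 * letters ℓ G ∧ f + (inc ℓ γ (mids ℓ γ G)).card = (inc ℓ γ G).card ∧
      ((inc ℓ β P).card : ℝ) ≤ A * (letters ℓ P - letters ℓ G) + A₁ * f
        + (inc ℓ β (mids ℓ γ G)).card + (B + 2 * B₁) * 2 ^ H := by
  have hGP : G ⊆ P := hG ▸ globals_subset
  have hgl : ∀ x ∈ G, Earlier ℓ γ P x ∨ Later ℓ γ P x := fun x hx =>
    globals_global (hG ▸ hx)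
  have hmγ : Mono γ P := hγ ▸ hm.div h
  have hs := inc_split_card hGP hgl
  have hFP : firsts ℓ γ P G ⊆ P := fun x hx => by
    simp only [firsts, Finset.mem_filter] at hx
    exact hGP hx.1
  have hLP : lasts ℓ γ P G ⊆ P := fun x hx => by
    simp only [lasts, Finset.mem_filter] at hx
    exact hGP hx.1
  have b1 := hD.sum hB hh (hm.mono locals_subset) (hf.mono locals_subset) (X := locals ℓ γ P)
    (ℓ := ℓ) fun g => ha.mono ((Finset.filter_subset _ _).trans locals_subset)
  have b2 := hD₁.sum hB₁ hh (hm.mono hFP) (hf.mono hFP) (X := firsts ℓ γ P G)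
    (ℓ := ℓ) fun g => by
      have := altFree_firsts (k := s + 1 + 2) hmγ hGP ha (by omega) g
      rwa [hγ] at this ⊢
  have b3 := hD₁.sum hB₁ hh (hm.mono hLP) (hf.mono hLP) (X := lasts ℓ γ P G)
    (ℓ := ℓ) fun g => by
      have := altFree_lasts (k := s + 1 + 2) hmγ hGP ha (by omega) g
      rwa [hγ] at this ⊢
  rw [← hγ] at b1 b2 b3
  have c1 : ((inc ℓ γ (locals ℓ γ P)).card : ℝ) ≤ letters ℓ (locals ℓ γ P) := by
    exact_mod_cast inc_locals_card
  have c2 : ((inc ℓ γ (firsts ℓ γ P G)).card : ℝ) ≤ letters ℓ G := by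
    exact_mod_cast inc_firsts_card_le
  have c3 : ((inc ℓ γ (lasts ℓ γ P G)).card : ℝ) ≤ letters ℓ G := by
    exact_mod_cast inc_lasts_card_le
  have c4 : (letters ℓ (locals ℓ γ P) : ℝ) = letters ℓ P - letters ℓ G := by
    rw [← letters_locals_add_globals (ℓ := ℓ) (γ := γ) (P := P), hG]
    push_cast; ring
  have d1 : P ⊆ locals ℓ γ P ∪ G := fun x hx => by
    rw [Finset.mem_union, hG]
    exact mem_locals_or_globals hx
  have d2 := inc_union_card_le (ℓ := ℓ) (β := β) d1
  have d3 := inc_union_card_le (ℓ := ℓ) (β := β) (split_global hGP hgl).subset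
  have d4 := inc_union_card_le (ℓ := ℓ) (β := β) (X := lasts ℓ γ P G ∪ mids ℓ γ G) subset_rfl
  have d5 : ((inc ℓ β P).card : ℝ) ≤ (inc ℓ β (locals ℓ γ P)).card +
      ((inc ℓ β (firsts ℓ γ P G)).card + ((inc ℓ β (lasts ℓ γ P G)).card
        + (inc ℓ β (mids ℓ γ G)).card)) := by
    exact_mod_cast d2.trans (by omega)
  refine ⟨(inc ℓ γ (firsts ℓ γ P G)).card + (inc ℓ γ (lasts ℓ γ P G)).card, by positivity,
    by linarith, by exact_mod_cast hs, ?_⟩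
  have := mul_le_mul_of_nonneg_left c1 hA
  rw [c4] at this
  linarith

/-- The recursion for two groups, in which every global letter occurs in both groups and there are
no middle occurrences. -/
theorem dsBound_step_two_groups {s h : ℕ} {A B A₁ B₁ : ℝ} (hD : DSBound (s + 2) h A B)
    (hD₁ : DSBound (s + 1) h A₁ B₁) (hB : 0 ≤ B) (hB₁ : 0 ≤ B₁) (hA₁ : 0 ≤ A₁) (hA0 : 0 ≤ A)
    (hA : 2 * A₁ ≤ A) : DSBound (s + 2) (h + 1) A (B + 2 * B₁) := by
  intro ℓ β P hm hf ha
  have hh : h ≤ h + 1 := by omega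
  obtain ⟨f, hf0, hf1, hf2, hle⟩ := ds_split hh hD hD₁ hB hB₁ hA0 hm hf ha _ rfl _ rfl
  have hGP : globals ℓ (fun x => β x / 2 ^ h) P ⊆ P := globals_subset
  have hM := mids_eq_empty (ℓ := ℓ) (γ := fun x => β x / 2 ^ h) (by
    have := (hf.mono hGP).div hh
    rwa [Nat.add_sub_cancel_left] at this)
  rw [hM] at hle
  have h0 : ((inc ℓ β ∅).card : ℝ) = 0 := by simp [inc]
  rw [h0] at hle
  have b4 := mul_le_mul_of_nonneg_left hf1 hA₁
  have b5 := mul_le_mul_of_nonneg_right hA (Nat.cast_nonneg (α := ℝ)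
    (letters ℓ (globals ℓ (fun x => β x / 2 ^ h) P)))
  linarith

/-- The recursion in which all middle occurrences are treated alike. -/
theorem dsBound_step {s h H : ℕ} {A B A₁ B₁ A₂ B₂ A' B' : ℝ} (hh : h ≤ H)
    (hD : DSBound (s + 2) h A B) (hD₁ : DSBound (s + 1) h A₁ B₁) (hD₂ : DSBound s h A₂ B₂)
    (hD' : DSBound (s + 2) (H - h) A' B') (hB : 0 ≤ B) (hB₁ : 0 ≤ B₁) (hB₂ : 0 ≤ B₂)
    (hA₂ : 0 ≤ A₂) (hA₁₂ : A₂ ≤ A₁) (hA0 : 0 ≤ A) (hA : 2 * A₁ + A₂ * (A' - 2) ≤ A) :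
    DSBound (s + 2) H A (B + 2 * B₁ + B₂ + A₂ * (B' / 2 ^ h)) := by
  intro ℓ β P hm hf ha
  obtain ⟨f, hf0, hf1, hf2, hle⟩ := ds_split hh hD hD₁ hB hB₁ hA0 hm hf ha _ rfl _ rfl
  set γ : ℤ → ℤ := fun x => β x / 2 ^ h with hγ
  set G := globals ℓ γ P
  have hGP : G ⊆ P := globals_subset
  have hMP : mids ℓ γ G ⊆ P := mids_subset.trans hGP
  have b1 := hD₂.sum hB₂ hh (hm.mono hMP) (hf.mono hMP) (ℓ := ℓ)
    fun g => altFree_mids ((hm.div h).mono hGP) (ha.mono hGP) (by omega) subset_rfl g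
  have b2 := hD' ℓ γ G ((hm.div h).mono hGP) ((hf.mono hGP).div hh) (ha.mono hGP)
  have e : (2 : ℝ) ^ (H - h) = 2 ^ H / 2 ^ h := by
    rw [eq_div_iff (by positivity), ← pow_add, Nat.sub_add_cancel hh]
  rw [e] at b2
  rw [← hγ] at b1
  have b3 := mul_le_mul_of_nonneg_left b2 hA₂
  have b4 := mul_le_mul_of_nonneg_left hf1 (sub_nonneg.2 hA₁₂)
  have b5 := mul_le_mul_of_nonneg_right hA (Nat.cast_nonneg (α := ℝ) (letters ℓ G))
  have b6 : ((inc ℓ γ (mids ℓ γ G)).card : ℝ) = (inc ℓ γ G).card - f := by linarith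
  rw [b6] at b1
  have e2 : A₂ * (B' * (2 ^ H / 2 ^ h)) = A₂ * (B' / 2 ^ h) * 2 ^ H := by ring
  linarith

/-- The recursion for odd orders, in which middle occurrences in feathers are separated from the
others; the latter have their order reduced by three. -/
theorem dsBound_step_odd {s h H : ℕ} {A B A₁ B₁ A₂ B₂ A₃ B₃ A' B' F F' : ℝ} (hh : h ≤ H)
    (hs : Even s) (hD : DSBound (s + 3) h A B) (hD₁ : DSBound (s + 2) h A₁ B₁)
    (hD₂ : DSBound (s + 1) h A₂ B₂) (hD₃ : DSBound s h A₃ B₃)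
    (hF : FeatherBound (s + 3) (H - h) F F')
    (hD' : DSBound (s + 3) (H - h) A' B') (hB : 0 ≤ B) (hB₁ : 0 ≤ B₁) (hB₂ : 0 ≤ B₂)
    (hB₃ : 0 ≤ B₃) (hA₁ : 0 ≤ A₁) (hA₂ : 0 ≤ A₂) (hA₃ : 0 ≤ A₃) (hA0 : 0 ≤ A)
    (hA : 2 * A₁ + 2 * A₂ * F + A₃ * A' ≤ A) :
    DSBound (s + 3) H A
      (B + 2 * B₁ + B₂ + 2 * B₃ + 2 * A₂ * (F' / 2 ^ h) + A₃ * (B' / 2 ^ h)) := by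
  intro ℓ β P hm hf ha
  obtain ⟨f, hf0, hf1, hf2, hle⟩ :=
    ds_split (s := s + 1) hh hD hD₁ hB hB₁ hA0 hm hf ha _ rfl _ rfl
  set γ : ℤ → ℤ := fun x => β x / 2 ^ h with hγ
  set G := globals ℓ γ P
  have hGP : G ⊆ P := globals_subset
  have hmG : Mono γ G := (hm.div h).mono hGP
  have hfG : Fits γ G (H - h) := (hf.mono hGP).div hh
  obtain ⟨M₁, M₂, M₃, hM, hc1, hc2, hp2, hp3⟩ := exists_mids_split (ℓ := ℓ) hfG
  have hM₁ : M₁ ⊆ mids ℓ γ G := by rw [hM]; exact Finset.subset_union_left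
  have hM₂ : M₂ ⊆ mids ℓ γ G := by
    rw [hM]; exact Finset.subset_union_left.trans Finset.subset_union_right
  have hM₃ : M₃ ⊆ mids ℓ γ G := by
    rw [hM]; exact Finset.subset_union_right.trans Finset.subset_union_right
  have hMP : mids ℓ γ G ⊆ P := mids_subset.trans hGP
  have b1 := hD₂.sum hB₂ hh (hm.mono (hM₁.trans hMP)) (hf.mono (hM₁.trans hMP)) (ℓ := ℓ)
    fun g => altFree_mids hmG (ha.mono hGP) (by omega) hM₁ g
  have b2 := hD₃.sum hB₃ hh (hm.mono (hM₂.trans hMP)) (hf.mono (hM₂.trans hMP)) (ℓ := ℓ)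
    fun g => altFree_of_hasPairs hmG (ha.mono hGP) (by omega) (by simpa [Nat.even_add] using hs)
      hM₂ hp2 g
  have b3 := hD₃.sum hB₃ hh (hm.mono (hM₃.trans hMP)) (hf.mono (hM₃.trans hMP)) (ℓ := ℓ)
    fun g => altFree_of_hasPairs hmG (ha.mono hGP) (by omega) (by simpa [Nat.even_add] using hs)
      hM₃ hp3 g
  rw [← hγ] at b1 b2 b3
  have b4 := hD' ℓ γ G hmG hfG (ha.mono hGP)
  have b5 := hF ℓ γ G hmG hfG (ha.mono hGP)
  have b6 := hF.hawks_le hmG hfG (ha.mono hGP)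
  have e : (2 : ℝ) ^ (H - h) = 2 ^ H / 2 ^ h := by
    rw [eq_div_iff (by positivity), ← pow_add, Nat.sub_add_cancel hh]
  rw [e] at b4 b5 b6
  have d1 := inc_union_card_le (ℓ := ℓ) (β := β) hM.subset
  have d2 := inc_union_card_le (ℓ := ℓ) (β := β) (X := M₂ ∪ M₃) subset_rfl
  have d3 : ((inc ℓ β (mids ℓ γ G)).card : ℝ) ≤
      (inc ℓ β M₁).card + ((inc ℓ β M₂).card + (inc ℓ β M₃).card) := by
    exact_mod_cast d1.trans (by omega)
  have c1 : ((inc ℓ γ M₁).card : ℝ) ≤ (doves (inc ℓ γ G)).card + (hawks (inc ℓ γ G)).card := by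
    exact_mod_cast hc1
  have c2 : ((inc ℓ γ M₂).card : ℝ) + (inc ℓ γ M₃).card ≤ (inc ℓ γ (mids ℓ γ G)).card := by
    exact_mod_cast hc2
  have m1 := mul_le_mul_of_nonneg_left
    (show ((inc ℓ γ M₁).card : ℝ) ≤ 2 * (F * letters ℓ G + F' * (2 ^ H / 2 ^ h)) by linarith) hA₂
  have m2 := mul_le_mul_of_nonneg_left (show ((inc ℓ γ M₂).card : ℝ) + (inc ℓ γ M₃).card ≤
    A' * letters ℓ G + B' * (2 ^ H / 2 ^ h) by linarith) hA₃
  have m3 := mul_le_mul_of_nonneg_left hf1 hA₁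
  have m4 := mul_le_mul_of_nonneg_right hA (Nat.cast_nonneg (α := ℝ) (letters ℓ G))
  have e2 : A₃ * (B' * (2 ^ H / 2 ^ h)) = A₃ * (B' / 2 ^ h) * 2 ^ H := by ring
  have e3 : A₂ * (F' * (2 ^ H / 2 ^ h)) = A₂ * (F' / 2 ^ h) * 2 ^ H := by ring
  linarith

end DS

/-! ### The bounds for feathers -/

section Feathers
variable {ℓ : ℤ → ℕ} {β γ : ℤ → ℤ} {P G X : Finset ℤ}

theorem featherBound_two (H : ℕ) : FeatherBound 2 H 0 1 := by
  classical
  intro ℓ β P hm hf ha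
  have h : (doves (inc ℓ β P)).card ≤ 2 ^ H := by
    refine (Finset.card_le_card ?_).trans (inc_middle_card_le hm hf ha)
    rintro ⟨a, v⟩ hc
    obtain ⟨hv, k, hk, -⟩ := mem_doves.1 hc
    obtain ⟨⟨t, ht, htv⟩, ⟨T, hT, hvT⟩⟩ := hk.lt hv
    obtain ⟨x, hx, e1, rfl⟩ := mem_inc.1 hv
    obtain ⟨y, hy, e3, rfl⟩ := mem_inc.1 ht
    obtain ⟨z, hz, e5, rfl⟩ := mem_inc.1 hT
    refine mem_inc.2 ⟨x, Finset.mem_filter.2 ⟨hx, ⟨z, hz, e5.trans e1.symm, hvT⟩,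
      ⟨y, hy, e3.trans e1.symm, htv⟩⟩, e1, rfl⟩
  rw [zero_mul, one_mul, zero_add]
  exact_mod_cast h

/-- No feather occurs if the tree has only two leaves. -/
theorem featherBound_of_level_one (s : ℕ) : FeatherBound s 1 0 0 := by
  intro ℓ β P hm hf ha
  have : doves (inc ℓ β P) = ∅ := by
    rw [Finset.eq_empty_iff_forall_notMem]
    intro c hc
    obtain ⟨-, k, ⟨t, T, ht, -, hT, hne, -⟩, -⟩ := mem_doves.1 hc
    obtain ⟨y, hy, -, rfl⟩ := mem_inc.1 ht
    obtain ⟨z, hz, -, rfl⟩ := mem_inc.1 hT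
    exact hne (ediv_eq_of_le (Nat.le_add_left 1 k) (hf z hz y hy))
  simp [this]

theorem IsDove.congr {K K' : Finset (ℕ × ℤ)} {a : ℕ} {v : ℤ}
    (h : ∀ u, (a, u) ∈ K ↔ (a, u) ∈ K') (hd : IsDove K (a, v)) : IsDove K' (a, v) := by
  obtain ⟨hv, k, ⟨t, T, h1, h2, h3, h4⟩, h5⟩ := hd
  exact ⟨(h v).1 hv, k, ⟨t, T, (h t).1 h1, fun u hu => h2 u ((h u).2 hu), (h T).1 h3, h4⟩,
    fun u hu => h5 u ((h u).2 hu)⟩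

open scoped Classical in
/-- The incidences that are dove feathers within their group of `2 ^ h` blocks. -/
noncomputable def groupDoves (ℓ : ℤ → ℕ) (β : ℤ → ℤ) (h : ℕ) (X : Finset ℤ) : Finset (ℕ × ℤ) :=
  (inc ℓ β X).filter fun c =>
    c ∈ doves (inc ℓ β (X.filter fun x => β x / 2 ^ h = c.2 / 2 ^ h))

theorem FeatherBound.sum {s h H : ℕ} {A B : ℝ} (hD : FeatherBound s h A B) (hB : 0 ≤ B)
    (hh : h ≤ H) (hm : Mono β X) (hf : Fits β X H)
    (ha : ∀ g, AltFree ℓ (X.filter fun x => β x / 2 ^ h = g) (s + 2)) :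
    ((groupDoves ℓ β h X).card : ℝ) ≤
      A * (inc ℓ (fun x => β x / 2 ^ h) X).card + B * 2 ^ H := by
  classical
  refine card_le_of_groups _ (fun c => c.2 / 2 ^ h) hh hf hB ?_ fun g => ?_
  · intro c hc
    obtain ⟨x, hx, -, e⟩ := mem_inc.1 (Finset.mem_filter.1 hc).1
    exact ⟨x, hx, by rw [e]⟩
  · have := hD ℓ β (X.filter fun x => β x / 2 ^ h = g)
      (hm.mono (Finset.filter_subset _ _)) ?_ (ha g)
    · refine le_trans ?_ this
      exact_mod_cast Finset.card_le_card fun c hc => by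
        simp only [groupDoves, Finset.mem_filter] at hc
        rw [← hc.2]
        exact hc.1.2
    · intro x hx y hy
      rw [(Finset.mem_filter.1 hx).2, (Finset.mem_filter.1 hy).2]

open scoped Classical in
/-- The feathers of global letters that branch off at or above the level of the groups correspond
to feathers of the contracted sequence. -/
theorem card_high_doves_le {h : ℕ} (hγ : γ = fun x => β x / 2 ^ h) (hG : G = globals ℓ γ P) :
    ((inc ℓ β P).filter fun c => (∃ x ∈ G, ℓ x = c.1) ∧ ∃ k, h ≤ k ∧
      DoveBranch (inc ℓ β P) c.1 c.2 k ∧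
      ∀ u, (c.1, u) ∈ inc ℓ β P → c.2 < u → u / 2 ^ k ≠ c.2 / 2 ^ k).card ≤
    (doves (inc ℓ γ G)).card := by
  refine Finset.card_le_card_of_injOn (fun c => (c.1, c.2 / 2 ^ h)) ?_ ?_
  · rintro ⟨a, v⟩ hc
    simp only [Finset.coe_filter, Set.mem_ofPred_eq] at hc
    obtain ⟨hv, ⟨x, hx, rfl⟩, k, hhk, ⟨t, T, h1, h2, h3, h4, h5, h6⟩, h7⟩ := hc
    obtain ⟨d, rfl⟩ := Nat.exists_eq_add_of_le hhk
    have up : ∀ u, (ℓ x, u) ∈ inc ℓ β P → (ℓ x, u / 2 ^ h) ∈ inc ℓ γ G := by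
      intro u hu
      obtain ⟨y, hy, e1, rfl⟩ := mem_inc.1 hu
      refine mem_inc.2 ⟨y, ?_, e1, by rw [hγ]⟩
      rw [hG] at hx ⊢
      exact mem_globals_iff_of_eq (globals_subset hx) hy e1.symm hx
    have down : ∀ u, (ℓ x, u) ∈ inc ℓ γ G → ∃ w, (ℓ x, w) ∈ inc ℓ β P ∧ w / 2 ^ h = u := by
      intro u hu
      obtain ⟨y, hy, e1, rfl⟩ := mem_inc.1 hu
      exact ⟨β y, mem_inc.2 ⟨y, globals_subset (hG ▸ hy), e1, rfl⟩, by rw [hγ]⟩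
    refine Finset.mem_coe.2 (mem_doves.2
      ⟨up v hv, d, ⟨t / 2 ^ h, T / 2 ^ h, up t h1, ?_, up T h3, ?_, ?_, ?_⟩, ?_⟩)
    · intro u hu
      obtain ⟨w, hw, rfl⟩ := down u hu
      exact ediv_mono (h2 w hw) h
    · rwa [ediv_pow_add, ediv_pow_add]
    · rwa [ediv_pow_add, ediv_pow_add]
    · rwa [ediv_pow_add, ediv_pow_add]
    · intro u hu hlt
      obtain ⟨w, hw, rfl⟩ := down u hu
      simp only [ediv_pow_add]
      exact h7 w hw (lt_of_ediv_lt hlt)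
  -- two such feathers of a letter in the same group are equal, each being the rightmost
  -- occurrence of the letter below a node of level at least `h`
  · rintro ⟨a, u⟩ hc ⟨b, v⟩ hd he
    simp only [Finset.coe_filter, Set.mem_ofPred_eq] at hc hd
    simp only [Prod.mk.injEq] at he ⊢
    obtain ⟨rfl, e⟩ := he
    refine ⟨rfl, ?_⟩
    obtain ⟨hu, -, k, hk, -, hk2⟩ := hc
    obtain ⟨hv, -, j, hj, -, hj2⟩ := hd
    rcases lt_trichotomy u v with hlt | rfl | hlt
    · exact absurd (ediv_eq_of_le hk e.symm) (hk2 v hv hlt)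
    · rfl
    · exact absurd (ediv_eq_of_le hj e) (hj2 u hu hlt)

open scoped Classical in
theorem card_last_le (X : Finset ℤ) : ((inc ℓ β X).filter fun c =>
    ∀ u, (c.1, u) ∈ inc ℓ β X → u ≤ c.2).card ≤ letters ℓ X := by
  refine Finset.card_le_card_of_injOn Prod.fst ?_ ?_
  · intro c hc
    obtain ⟨x, hx, e, -⟩ := mem_inc.1 (Finset.mem_filter.1 (Finset.mem_coe.1 hc)).1
    exact Finset.mem_coe.2 (Finset.mem_image.2 ⟨x, hx, e⟩)
  · rintro ⟨a, u⟩ hc ⟨b, v⟩ hd (rfl : a = b)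
    simp only [Finset.coe_filter, Set.mem_ofPred_eq] at hc hd
    rw [Prod.mk.injEq]
    exact ⟨rfl, le_antisymm (hd.2 u hc.1) (hc.2 v hd.1)⟩

/-- A feather branching off below the level of the groups lies in the first group of its letter,
and it is a feather of that group unless it is the last occurrence in the group. -/
theorem featherBound_step {s h H : ℕ} {A B A₁ B₁ A' B' : ℝ} (hh : h ≤ H)
    (hD : FeatherBound (s + 1) h A B) (hD₁ : FeatherBound s h A₁ B₁)
    (hD' : FeatherBound (s + 1) (H - h) A' B') (hB : 0 ≤ B) (hB₁ : 0 ≤ B₁) (hA₁ : 0 ≤ A₁)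
    (hA0 : 0 ≤ A) (hA : A' + A₁ + 1 ≤ A) :
    FeatherBound (s + 1) H A (B + B₁ + B' / 2 ^ h) := by
  classical
  intro ℓ β P hm hf ha
  obtain ⟨γ, hγ⟩ : ∃ γ : ℤ → ℤ, γ = fun x => β x / 2 ^ h := ⟨_, rfl⟩
  obtain ⟨G, hG⟩ : ∃ G, G = globals ℓ γ P := ⟨_, rfl⟩
  have hGP : G ⊆ P := hG ▸ globals_subset
  have hmγ : Mono γ P := hγ ▸ hm.div h
  -- `X` consists of the occurrences in the first group of their letter, `Y` of the feathers that
  -- branch off at or above the level of the groups, `Z` of the last incidences in the first group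
  set X := G.filter fun x => ¬ Earlier ℓ γ G x with hX
  have hXP : X ⊆ P := (Finset.filter_subset _ _).trans hGP
  have hXeq : ∀ x ∈ X, ∀ y ∈ X, ℓ x = ℓ y → γ x = γ y := by
    intro x hx y hy e
    rw [hX, Finset.mem_filter] at hx hy
    by_contra hne
    rcases lt_or_gt_of_ne hne with hlt | hlt
    · exact hy.2 ⟨x, hx.1, e, hlt⟩
    · exact hx.2 ⟨y, hy.1, e.symm, hlt⟩
  set Y := (inc ℓ β P).filter fun c => (∃ x ∈ G, ℓ x = c.1) ∧ ∃ k, h ≤ k ∧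
      DoveBranch (inc ℓ β P) c.1 c.2 k ∧
      ∀ u, (c.1, u) ∈ inc ℓ β P → c.2 < u → u / 2 ^ k ≠ c.2 / 2 ^ k with hY
  set Z := (inc ℓ β X).filter fun c => ∀ u, (c.1, u) ∈ inc ℓ β X → u ≤ c.2 with hZ
  have hsub : doves (inc ℓ β P) ⊆
      (groupDoves ℓ β h (locals ℓ γ P) ∪ Y) ∪ (groupDoves ℓ β h X ∪ Z) := by
    rintro ⟨a, v⟩ hc
    have hd := mem_doves.1 hc
    obtain ⟨hv, k, hbr, hlast⟩ := mem_doves.1 hc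
    obtain ⟨x, hx, rfl, rfl⟩ := mem_inc.1 hv
    simp only [Finset.mem_union]
    rcases mem_locals_or_globals (ℓ := ℓ) (γ := γ) hx with hl | hg
    · left; left
      rw [groupDoves, Finset.mem_filter, mem_doves]
      refine ⟨mem_inc.2 ⟨x, hl, rfl, rfl⟩, hd.congr fun u => ?_⟩
      rw [mem_inc, mem_inc]
      constructor
      · rintro ⟨y, hy, e, rfl⟩
        have hyl : y ∈ locals ℓ γ P := by
          rcases mem_locals_or_globals (ℓ := ℓ) (γ := γ) hy with h | h
          · exact h
          · exact absurd hl (not_mem_locals_of_globals h e)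
        refine ⟨y, Finset.mem_filter.2 ⟨hyl, ?_⟩, e, rfl⟩
        have := locals_eq hl hy e.symm
        rw [hγ] at this
        exact this.symm
      · rintro ⟨y, hy, e, rfl⟩
        exact ⟨y, locals_subset (Finset.mem_filter.1 hy).1, e, rfl⟩
    · rw [← hG] at hg
      by_cases hk : h ≤ k
      · left; right
        rw [hY, Finset.mem_filter]
        exact ⟨hv, ⟨x, hg, rfl⟩, k, hk, hbr, hlast⟩
      · right
        obtain ⟨t, T, h1, h2, h3, h4, h5, h6⟩ := hbr
        obtain ⟨y, hy, ey, rfl⟩ := mem_inc.1 h1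
        simp only at h2 h4 h5 h6 hlast ey
        have hmemG : ∀ w ∈ P, ℓ w = ℓ x → w ∈ G := fun w hw e => by
          rw [hG] at hg ⊢
          exact mem_globals_iff_of_eq (globals_subset hg) hw e.symm hg
        have hγxy : γ x = γ y := by
          rw [hγ]
          exact ediv_eq_of_le (show k + 1 ≤ h by omega) h5
        have hfirst : ∀ w ∈ P, ℓ w = ℓ x → γ w = γ x → w ∈ X := by
          intro w hw e e'
          rw [hX, Finset.mem_filter]
          refine ⟨hmemG w hw e, ?_⟩
          rintro ⟨z, hz, ez, hzw⟩
          have := h2 (β z) (mem_inc.2 ⟨z, hGP hz, ez.trans e, rfl⟩)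
          have := ediv_mono this h
          rw [e', hγxy, hγ] at hzw
          simp only at hzw
          omega
        have hxX := hfirst x hx rfl rfl
        have hyX := hfirst y hy ey hγxy.symm
        set K' := inc ℓ β (X.filter fun w => β w / 2 ^ h = β x / 2 ^ h) with hK'
        have hK'K : ∀ u, (ℓ x, u) ∈ K' → (ℓ x, u) ∈ inc ℓ β P := fun u hu =>
          inc_mono ((Finset.filter_subset _ _).trans hXP) hu
        have hxK' : (ℓ x, β x) ∈ K' := mem_inc.2 ⟨x, Finset.mem_filter.2 ⟨hxX, rfl⟩, rfl, rfl⟩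
        -- the branching node stays on the left wing if the crown within the first group is above it
        by_cases hT : ∃ T', (ℓ x, T') ∈ K' ∧ T' / 2 ^ (k + 1) ≠ β y / 2 ^ (k + 1)
        · left
          obtain ⟨T', hT', hne⟩ := hT
          rw [groupDoves, Finset.mem_filter, mem_doves]
          refine ⟨mem_inc.2 ⟨x, hxX, rfl, rfl⟩, hxK', k,
            ⟨β y, T', ?_, fun u hu => h2 u (hK'K u hu), hT', hne, h5, h6⟩,
            fun u hu => hlast u (hK'K u hu)⟩
          refine mem_inc.2 ⟨y, Finset.mem_filter.2 ⟨hyX, ?_⟩, ey, rfl⟩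
          rw [hγ] at hγxy
          exact hγxy.symm
        · right
          push Not at hT
          rw [hZ, Finset.mem_filter]
          refine ⟨mem_inc.2 ⟨x, hxX, rfl, rfl⟩, fun u hu => ?_⟩
          -- otherwise `y`, `x` and a later occurrence lie below the node of level `k + 1`, hence
          -- two of them below the same child
          by_contra hcon
          have hxu : β x < u := not_le.1 hcon
          obtain ⟨w, hw, ew, rfl⟩ := mem_inc.1 hu
          simp only at ew hxu
          have e1 := hXeq w hw x hxX ew
          rw [hγ] at e1
          have e2 := hT (β w) (mem_inc.2 ⟨w, Finset.mem_filter.2 ⟨hw, e1⟩, ew, rfl⟩)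
          have hyx : β y < β x := lt_of_le_of_ne (h2 (β x) hv) (by
            intro e; rw [e] at h6; exact h6 rfl)
          rcases not_three_children hyx hxu e2.symm with e3 | e3
          · exact h6 e3.symm
          · exact hlast (β w) (mem_inc.2 ⟨w, hXP hw, ew, rfl⟩) hxu e3.symm
  have b1 := hD.sum hB hh (hm.mono (locals_subset (ℓ := ℓ) (γ := γ)))
    (hf.mono (locals_subset (ℓ := ℓ) (γ := γ))) (ℓ := ℓ)
    fun g => ha.mono ((Finset.filter_subset _ _).trans locals_subset)
  have b2 := hD₁.sum hB₁ hh (hm.mono hXP) (hf.mono hXP) (ℓ := ℓ) fun g => by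
    have hsub : (X.filter fun x => β x / 2 ^ h = g) ⊆ P := (Finset.filter_subset _ _).trans hXP
    refine AltFree.of_after (P := P) (k := s + 2) ha (by omega) hsub fun x hx => ?_
    have hx' := hx
    simp only [hX, Finset.mem_filter] at hx'
    obtain ⟨⟨hxG, hxE⟩, hxg⟩ := hx'
    rcases globals_global (hG ▸ hxG) with hE | hL
    · obtain ⟨y, hy, e, hlt⟩ := hE
      refine absurd ⟨y, ?_, e, hlt⟩ hxE
      rw [hG] at hxG ⊢
      exact mem_globals_iff_of_eq (globals_subset hxG) hy e.symm hxG
    · refine hL.after hmγ hsub fun y hy => ?_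
      rw [hγ]
      exact (Finset.mem_filter.1 hy).2.trans hxg.symm
  rw [← hγ] at b1 b2
  have b3 := hD' ℓ γ G (hmγ.mono hGP) (hγ ▸ (hf.mono hGP).div hh) (ha.mono hGP)
  have b4 : Y.card ≤ (doves (inc ℓ γ G)).card := card_high_doves_le hγ hG
  have b5 : Z.card ≤ letters ℓ X := card_last_le X
  have b6 : letters ℓ X ≤ letters ℓ G := letters_mono (Finset.filter_subset _ _)
  have b7 : (inc ℓ γ X).card ≤ letters ℓ X := inc_card_le_letters hXeq
  have b8 := (Finset.card_le_card hsub).trans ((Finset.card_union_le _ _).trans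
    (add_le_add (Finset.card_union_le _ _) (Finset.card_union_le _ _)))
  have c1 : ((inc ℓ γ (locals ℓ γ P)).card : ℝ) ≤ letters ℓ (locals ℓ γ P) := by
    exact_mod_cast inc_locals_card
  have c2 : ((inc ℓ γ X).card : ℝ) ≤ letters ℓ G := by exact_mod_cast b7.trans b6
  have c4 : (letters ℓ (locals ℓ γ P) : ℝ) = letters ℓ P - letters ℓ G := by
    rw [← letters_locals_add_globals (ℓ := ℓ) (γ := γ) (P := P), hG]
    push_cast; ring
  have c5 : ((doves (inc ℓ β P)).card : ℝ) ≤ (groupDoves ℓ β h (locals ℓ γ P)).card + Y.card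
      + ((groupDoves ℓ β h X).card + Z.card) := by exact_mod_cast b8
  have c6 : (Y.card : ℝ) ≤ (doves (inc ℓ γ G)).card := by exact_mod_cast b4
  have c7 : (Z.card : ℝ) ≤ letters ℓ G := by exact_mod_cast b5.trans b6
  have e : (2 : ℝ) ^ (H - h) = 2 ^ H / 2 ^ h := by
    rw [eq_div_iff (by positivity), ← pow_add, Nat.sub_add_cancel hh]
  rw [e] at b3
  have m1 := mul_le_mul_of_nonneg_left c1 hA0
  rw [c4] at m1
  have m2 := mul_le_mul_of_nonneg_left c2 hA₁
  have m3 := mul_le_mul_of_nonneg_right hA (Nat.cast_nonneg (α := ℝ) (letters ℓ G))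
  have e2 : B' * (2 ^ H / 2 ^ h : ℝ) = B' / 2 ^ h * 2 ^ H := by ring
  linarith

end Feathers

/-! ### Extending doubled alternations -/

theorem Chain.drop_last {r : ℤ → ℤ → Prop} {ℓ : ℤ → ℕ} {P : Finset ℤ} {k a b : ℕ} {x z : ℤ}
    (h : Chain r ℓ P (k + 1) a b x z) :
    ∃ w ∈ P, ℓ w = (if Even k then a else b) ∧ Chain r ℓ P k a b x w := by
  induction k generalizing a b x with
  | zero =>
    obtain ⟨y, y', m1, m2, e1, e2, h1, h2, h3, h4⟩ := h
    exact ⟨y, m1, by simpa using e1, h1⟩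
  | succ k ih =>
    obtain ⟨y, y', m1, m2, e1, e2, h1, h2, h3, h4⟩ := h
    obtain ⟨w, hw, e, hc⟩ := ih h4
    refine ⟨w, hw, ?_, y, y', m1, m2, e1, e2, h1, h2, h3, hc⟩
    rw [e]; by_cases hk : Even k <;> simp [hk, Nat.even_add_one]

section Extend
variable {ℓ : ℤ → ℕ} {Q X R : Finset ℤ} {k : ℕ}

/-- `R` contains the letters of `X` only, and only to the left of some occurrence in `X`. -/
def LeftOf (ℓ : ℤ → ℕ) (X R : Finset ℤ) : Prop := ∀ z ∈ R, ∃ y ∈ X, ℓ y = ℓ z ∧ z < y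

/-- `R` contains the letters of `X` only, and only to the right of some occurrence in `X`. -/
def RightOf (ℓ : ℤ → ℕ) (X R : Finset ℤ) : Prop := ∀ z ∈ R, ∃ y ∈ X, ℓ y = ℓ z ∧ y < z

/-- A doubled alternation of `R` extends by one letter to the right. The last letter of the old one
becomes an inner letter and needs a second occurrence, which `X` supplies. -/
theorem DblFree.of_after (h : DblFree ℓ Q (k + 1)) (hk : 1 ≤ k) (hR : R ⊆ Q) (hX : X ⊆ Q)
    (hl : LeftOf ℓ X R) (hA : ∀ x ∈ X, After ℓ Q X (ℓ x)) : DblFree ℓ R k := by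
  intro a b x z hab hx hz ex ez hc
  obtain ⟨yb, hyb, eb⟩ := hc.exists_mem hk
  obtain ⟨x', hx', ex', -⟩ := hl x hx
  obtain ⟨z', hz', ez', hzz⟩ := hl z hz
  obtain ⟨b', hb', eb', -⟩ := hl yb hyb
  have : ∃ w ∈ Q, ℓ w = (if Even (k + 1) then b else a) ∧ ∀ u ∈ X, u < w := by
    split_ifs
    · rw [← eb, ← eb']; exact hA b' hb'
    · rw [← ex, ← ex']; exact hA x' hx'
  obtain ⟨w, hw, ew, hlt⟩ := this
  exact h a b x w hab (hR hx) hw ex ew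
    ((hc.mono hR).snoc le_rfl (hR hz) (hX hz') ez (ez'.trans ez) hzz.le hzz (hlt z' hz'))

/-- A doubled alternation of `R` extends by one letter to the left. -/
theorem DblFree.of_before (h : DblFree ℓ Q (k + 1)) (hk : 1 ≤ k) (hR : R ⊆ Q) (hX : X ⊆ Q)
    (hr : RightOf ℓ X R) (hB : ∀ x ∈ X, Before ℓ Q X (ℓ x)) : DblFree ℓ R k := by
  intro a b x z hab hx hz ex ez hc
  obtain ⟨yb, hyb, eb⟩ := hc.exists_mem hk
  obtain ⟨x', hx', ex', hxx⟩ := hr x hx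
  obtain ⟨b', hb', eb', -⟩ := hr yb hyb
  obtain ⟨w, hw, ew, hlt⟩ := hB b' hb'
  refine h b a w z hab.symm hw (hR hz) (by rw [ew, eb', eb]) ?_
    ⟨x', x, hX hx', hR hx, ex'.trans ex, ex, hlt x' hx', hxx.le, hxx, hc.mono hR⟩
  rw [ez]; by_cases hk : Even k <;> simp [hk, Nat.even_add_one]

/-- A doubled alternation of `R` extends by one letter on either side. -/
theorem DblFree.of_before_after (h : DblFree ℓ Q (k + 2)) (hk : 1 ≤ k) (hR : R ⊆ Q) (hX : X ⊆ Q)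
    (hl : LeftOf ℓ X R) (hr : RightOf ℓ X R) (hB : ∀ x ∈ X, Before ℓ Q X (ℓ x))
    (hA : ∀ x ∈ X, After ℓ Q X (ℓ x)) : DblFree ℓ R k := by
  intro a b x z hab hx hz ex ez hc
  obtain ⟨yb, hyb, eb⟩ := hc.exists_mem hk
  obtain ⟨x', hx', ex', hxx⟩ := hr x hx
  obtain ⟨z', hz', ez', hzz⟩ := hl z hz
  obtain ⟨b', hb', eb', -⟩ := hr yb hyb
  obtain ⟨v, hv, ev, hlt⟩ := hB b' hb'
  have : ∃ w ∈ Q, ℓ w = (if Even k then a else b) ∧ ∀ u ∈ X, u < w := by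
    split_ifs
    · rw [← ex, ← ex']; exact hA x' hx'
    · rw [← eb, ← eb']; exact hA b' hb'
  obtain ⟨w, hw, ew, hgt⟩ := this
  have hc' : Chain (· < ·) ℓ Q (k + 1) a b v z :=
    ⟨x', x, hX hx', hR hx, ex'.trans ex, ex, hlt x' hx', hxx.le, hxx, hc.mono hR⟩
  have ez2 : ℓ z = if Even (k + 1) then a else b := by
    rw [ez]; by_cases hk : Even k <;> simp [hk, Nat.even_add_one]
  refine h b a v w hab.symm hv hw (by rw [ev, eb', eb]) ?_
    (hc'.snoc le_rfl (hR hz) (hX hz') ez2 (ez'.trans ez2) hzz.le hzz (hgt z' hz'))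
  rw [ew]; by_cases hk : Even k <;> simp [hk, Nat.even_add_one]

/-- A doubled alternation of even length extends by three letters if, on one side of `X`, the set
`Q` contains its first letter followed by its second one, where the one next to `X` is doubled. -/
theorem DblFree.of_pairs (h : DblFree ℓ Q (k + 3)) (hk : 1 ≤ k) (hke : Even k) (hR : R ⊆ Q)
    (hX : X ⊆ Q) (hl : LeftOf ℓ X R) (hr : RightOf ℓ X R) (hB : ∀ x ∈ X, Before ℓ Q X (ℓ x))
    (hA : ∀ x ∈ X, After ℓ Q X (ℓ x))
    (hN : ∀ x ∈ X, ∀ y ∈ X, ℓ x ≠ ℓ y → ∃ u ∈ Q, ∃ u' ∈ Q, ∃ v ∈ Q, ∃ v' ∈ Q, ℓ u = ℓ x ∧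
      ℓ u' = ℓ x ∧ ℓ v = ℓ y ∧ ℓ v' = ℓ y ∧ u < u' ∧ u' < v ∧ v < v' ∧
      ((∀ w ∈ X, w < u) ∨ ∀ w ∈ X, v' < w)) : DblFree ℓ R k := by
  intro a b x z hab hx hz ex ez hc
  obtain ⟨yb, hyb, eb⟩ := hc.exists_mem hk
  obtain ⟨x', hx', ex', hxx⟩ := hr x hx
  obtain ⟨z', hz', ez', hzz⟩ := hl z hz
  obtain ⟨b', hb', eb', -⟩ := hr yb hyb
  rw [if_pos hke] at ez
  obtain ⟨u, hu, u', hu', v, hv, v', hv', eu, eu', ev, ev', h1, h2, h3, hcase⟩ :=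
    hN x' hx' b' hb' (by rw [ex', ex, eb', eb]; exact hab)
  rw [ex', ex] at eu eu'
  rw [eb', eb] at ev ev'
  have hke1 : ¬ Even (k + 1) := by simpa [Nat.even_add_one] using hke
  have hke2 : Even (k + 2) := by simpa [Nat.even_add] using hke
  have hke3 : ¬ Even (k + 3) := by rw [Nat.even_add_one]; simpa using hke2
  rcases hcase with hgt | hlt
  · obtain ⟨w, hw, ew, hwlt⟩ := hB b' hb'
    have c1 : Chain (· < ·) ℓ Q (k + 1) a b w z :=
      ⟨x', x, hX hx', hR hx, ex'.trans ex, ex, hwlt x' hx', hxx.le, hxx, hc.mono hR⟩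
    have c2 : Chain (· < ·) ℓ Q (k + 2) a b w u :=
      c1.snoc le_rfl (hR hz) (hX hz') (by rw [if_neg hke1, ez]) (by rw [if_neg hke1, ez', ez])
        hzz.le hzz (hgt z' hz')
    have c3 : Chain (· < ·) ℓ Q (k + 3) a b w v :=
      c2.snoc le_rfl hu hu' (by rw [if_pos hke2, eu]) (by rw [if_pos hke2, eu']) h1.le h1 h2
    exact h b a w v hab.symm hw hv (by rw [ew, eb', eb]) (by rw [if_neg hke3, ev]) c3
  · obtain ⟨w, hw, ew, hwgt⟩ := hA x' hx'
    have c1 : Chain (· < ·) ℓ Q (k + 1) a b v' z :=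
      ⟨x', x, hX hx', hR hx, ex'.trans ex, ex, hlt x' hx', hxx.le, hxx, hc.mono hR⟩
    have c2 : Chain (· < ·) ℓ Q (k + 2) b a u' z :=
      ⟨v, v', hv, hv', ev, ev', h2, h3.le, h3, c1⟩
    have c3 : Chain (· < ·) ℓ Q (k + 3) b a u' w :=
      c2.snoc le_rfl (hR hz) (hX hz') (by rw [if_pos hke2, ez]) (by rw [if_pos hke2, ez', ez])
        hzz.le hzz (hwgt z' hz')
    exact h a b u' w hab hu' hw eu' (by rw [if_neg hke3, ew, ex', ex]) c3

end Extend

/-! ### Double Davenport-Schinzel sequences -/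

/-- Between any two occurrences of a letter in `P` there is another one in `Q`. -/
def Separated (ℓ : ℤ → ℕ) (P Q : Finset ℤ) : Prop :=
  ∀ x ∈ P, ∀ y ∈ P, ℓ x = ℓ y → x < y → ∃ z ∈ Q, ℓ z = ℓ x ∧ x < z ∧ z < y

/-- Every block contains every letter at most once. -/
def Blocked (ℓ : ℤ → ℕ) (β : ℤ → ℤ) (P : Finset ℤ) : Prop :=
  ∀ x ∈ P, ∀ y ∈ P, ℓ x = ℓ y → β x = β y → x = y

/-- `A * n + B * 2 ^ H` bounds the size of those sets `P` of occurrences, with `n` letters, in an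
order-`s` double DS sequence `Q` that are separated by `Q`; here `P` is divided into blocks below
a node of level `H`, whereas `Q` may contain a letter repeatedly in the same block. -/
def DblBound (s H : ℕ) (A B : ℝ) : Prop := ∀ (ℓ : ℤ → ℕ) (β : ℤ → ℤ) (P Q : Finset ℤ),
  P ⊆ Q → Mono β Q → Fits β P H → Blocked ℓ β P → Separated ℓ P Q → DblFree ℓ Q s →
    (P.card : ℝ) ≤ A * letters ℓ P + B * 2 ^ H

theorem DblBound.weaken {s H : ℕ} {A B A' B' : ℝ} (h : DblBound s H A B) (hA : A ≤ A')
    (hB : B ≤ B') : DblBound s H A' B' := fun ℓ β P Q h1 h2 h3 h4 h5 h6 =>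
  (h ℓ β P Q h1 h2 h3 h4 h5 h6).trans (by gcongr)

section Dbl
variable {ℓ : ℤ → ℕ} {β γ : ℤ → ℤ} {P Q G X : Finset ℤ}

open scoped Classical in
theorem card_not_left_le (X : Finset ℤ) :
    (X.filter fun x => ¬ ∃ y ∈ X, ℓ y = ℓ x ∧ x < y).card ≤ letters ℓ X := by
  refine Finset.card_le_card_of_injOn ℓ ?_ ?_
  · exact fun x hx => Finset.mem_coe.2
      (Finset.mem_image_of_mem _ (Finset.mem_filter.1 (Finset.mem_coe.1 hx)).1)
  · intro x hx y hy e
    have hx := Finset.mem_filter.1 (Finset.mem_coe.1 hx)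
    have hy := Finset.mem_filter.1 (Finset.mem_coe.1 hy)
    rcases lt_trichotomy x y with h | h | h
    · exact absurd ⟨y, hy.1, e.symm, h⟩ hx.2
    · exact h
    · exact absurd ⟨x, hx.1, e, h⟩ hy.2

open scoped Classical in
theorem card_not_right_le (X : Finset ℤ) :
    (X.filter fun x => ¬ ∃ y ∈ X, ℓ y = ℓ x ∧ y < x).card ≤ letters ℓ X := by
  refine Finset.card_le_card_of_injOn ℓ ?_ ?_
  · exact fun x hx => Finset.mem_coe.2
      (Finset.mem_image_of_mem _ (Finset.mem_filter.1 (Finset.mem_coe.1 hx)).1)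
  · intro x hx y hy e
    have hx := Finset.mem_filter.1 (Finset.mem_coe.1 hx)
    have hy := Finset.mem_filter.1 (Finset.mem_coe.1 hy)
    rcases lt_trichotomy x y with h | h | h
    · exact absurd ⟨x, hx.1, e, h⟩ hy.2
    · exact h
    · exact absurd ⟨y, hy.1, e.symm, h⟩ hx.2

open scoped Classical in
/-- The occurrences in `Q` of letters of `X` left of the last one in `X`. -/
noncomputable def trimLast (ℓ : ℤ → ℕ) (X Q : Finset ℤ) : Finset ℤ :=
  Q.filter fun z => ∃ y ∈ X, ℓ y = ℓ z ∧ z < y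

open scoped Classical in
/-- The occurrences in `Q` of letters of `X` right of the first one in `X`. -/
noncomputable def trimFirst (ℓ : ℤ → ℕ) (X Q : Finset ℤ) : Finset ℤ :=
  Q.filter fun z => ∃ y ∈ X, ℓ y = ℓ z ∧ y < z

theorem mem_trimLast {X Q : Finset ℤ} {z : ℤ} :
    z ∈ trimLast ℓ X Q ↔ z ∈ Q ∧ ∃ y ∈ X, ℓ y = ℓ z ∧ z < y := by
  simp only [trimLast, Finset.mem_filter]

theorem mem_trimFirst {X Q : Finset ℤ} {z : ℤ} :
    z ∈ trimFirst ℓ X Q ↔ z ∈ Q ∧ ∃ y ∈ X, ℓ y = ℓ z ∧ y < z := by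
  simp only [trimFirst, Finset.mem_filter]

theorem card_le_trimLast (X : Finset ℤ) :
    X.card ≤ (trimLast ℓ X X).card + letters ℓ X := by
  classical
  rw [← Finset.card_filter_add_card_filter_not (s := X) fun x => ∃ y ∈ X, ℓ y = ℓ x ∧ x < y]
  exact add_le_add (le_of_eq (congrArg _ (by ext; simp only [mem_trimLast, Finset.mem_filter])))
    (card_not_left_le X)

theorem card_le_trimFirst (X : Finset ℤ) :
    X.card ≤ (trimFirst ℓ X X).card + letters ℓ X := by
  classical
  rw [← Finset.card_filter_add_card_filter_not (s := X) fun x => ∃ y ∈ X, ℓ y = ℓ x ∧ y < x]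
  exact add_le_add (le_of_eq (congrArg _ (by ext; simp only [mem_trimFirst, Finset.mem_filter])))
    (card_not_right_le X)

theorem card_le_trim_both (X : Finset ℤ) :
    X.card ≤ (trimFirst ℓ X X ∩ trimLast ℓ X X).card + 2 * letters ℓ X := by
  have h1 := card_le_trimLast (ℓ := ℓ) X
  have h2 := card_le_trimFirst (ℓ := ℓ) X
  have h3 := Finset.card_union_add_card_inter (trimFirst ℓ X X) (trimLast ℓ X X)
  have h4 : (trimFirst ℓ X X ∪ trimLast ℓ X X).card ≤ X.card :=
    Finset.card_le_card (Finset.union_subset (fun _ hz => (mem_trimFirst.1 hz).1)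
      fun _ hz => (mem_trimLast.1 hz).1)
  omega

/-- Summation over the groups, when up to `t` occurrences of every letter in every group have to
be removed in order to reduce the order to `s`. -/
theorem DblBound.sum {s h H t : ℕ} {A B : ℝ} (hD : DblBound s h A B) (hA : 0 ≤ A) (hB : 0 ≤ B)
    (hh : h ≤ H) (hm : Mono β Q) (hf : Fits β X H) (hb : Blocked ℓ β X)
    (ha : ∀ g, ∃ X' R : Finset ℤ, X' ⊆ (X.filter fun x => β x / 2 ^ h = g) ∧
      (X.filter fun x => β x / 2 ^ h = g).card ≤
        X'.card + t * letters ℓ (X.filter fun x => β x / 2 ^ h = g) ∧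
      R ⊆ Q ∧ X' ⊆ R ∧ Separated ℓ X' R ∧ DblFree ℓ R s) :
    (X.card : ℝ) ≤ (A + t) * (inc ℓ (fun x => β x / 2 ^ h) X).card + B * 2 ^ H := by
  refine card_le_of_groups _ (fun x => β x / 2 ^ h) hh hf hB (fun x hx => ⟨x, hx, rfl⟩) fun g => ?_
  obtain ⟨X', R, h1, h2, h3, h4, h5, h6⟩ := ha g
  have hX'X : X' ⊆ X := h1.trans (Finset.filter_subset _ _)
  have := hD ℓ β X' R h4 (hm.mono h3) (fun x hx y hy => by
    rw [(Finset.mem_filter.1 (h1 hx)).2, (Finset.mem_filter.1 (h1 hy)).2])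
    (fun x hx y hy => hb x (hX'X hx) y (hX'X hy)) h5 h6
  have h7 : (letters ℓ X' : ℝ) ≤ letters ℓ (X.filter fun x => β x / 2 ^ h = g) := by
    exact_mod_cast letters_mono h1
  have h8 : ((X.filter fun x => β x / 2 ^ h = g).card : ℝ) ≤
      X'.card + t * letters ℓ (X.filter fun x => β x / 2 ^ h = g) := by exact_mod_cast h2
  have := mul_le_mul_of_nonneg_left h7 hA
  linarith

theorem separated_trimLast (hs : Separated ℓ X Q) :
    Separated ℓ (trimLast ℓ X X) (trimLast ℓ X Q) := by
  intro x hx y hy e hxy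
  have hx' := mem_trimLast.1 hx
  have hy' := mem_trimLast.1 hy
  obtain ⟨z, hz, ez, h1, h2⟩ := hs x hx'.1 y hy'.1 e hxy
  exact ⟨z, mem_trimLast.2 ⟨hz, y, hy'.1, e.symm.trans ez.symm, h2⟩, ez, h1, h2⟩

theorem separated_trimFirst (hs : Separated ℓ X Q) :
    Separated ℓ (trimFirst ℓ X X) (trimFirst ℓ X Q) := by
  intro x hx y hy e hxy
  have hx' := mem_trimFirst.1 hx
  have hy' := mem_trimFirst.1 hy
  obtain ⟨z, hz, ez, h1, h2⟩ := hs x hx'.1 y hy'.1 e hxy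
  exact ⟨z, mem_trimFirst.2 ⟨hz, x, hx'.1, ez.symm, h1⟩, ez, h1, h2⟩

theorem separated_trim_both (hs : Separated ℓ X Q) :
    Separated ℓ (trimFirst ℓ X X ∩ trimLast ℓ X X) (trimFirst ℓ X Q ∩ trimLast ℓ X Q) := by
  intro x hx y hy e hxy
  have hx' := mem_trimLast.1 (Finset.mem_inter.1 hx).2
  have hy' := mem_trimLast.1 (Finset.mem_inter.1 hy).2
  obtain ⟨z, hz, ez, h1, h2⟩ := hs x hx'.1 y hy'.1 e hxy
  exact ⟨z, Finset.mem_inter.2 ⟨mem_trimFirst.2 ⟨hz, x, hx'.1, ez.symm, h1⟩,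
    mem_trimLast.2 ⟨hz, y, hy'.1, e.symm.trans ez.symm, h2⟩⟩, ez, h1, h2⟩

theorem Separated.mono {P' Q' : Finset ℤ} (h : Separated ℓ P Q) (hP : P' ⊆ P) (hQ : Q ⊆ Q') :
    Separated ℓ P' Q' := by
  intro x hx y hy e hxy
  obtain ⟨z, hz, h⟩ := h x (hP hx) y (hP hy) e hxy
  exact ⟨z, hQ hz, h⟩

theorem trimLast_mono {Q' : Finset ℤ} (h : Q ⊆ Q') : trimLast ℓ X Q ⊆ trimLast ℓ X Q' :=
  fun _ hz => mem_trimLast.2 ⟨h (mem_trimLast.1 hz).1, (mem_trimLast.1 hz).2⟩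

theorem trimFirst_mono {Q' : Finset ℤ} (h : Q ⊆ Q') : trimFirst ℓ X Q ⊆ trimFirst ℓ X Q' :=
  fun _ hz => mem_trimFirst.2 ⟨h (mem_trimFirst.1 hz).1, (mem_trimFirst.1 hz).2⟩

end Dbl

/-! ### Double Davenport-Schinzel sequences of orders one and two -/

section Base
variable {ℓ : ℤ → ℕ} {β γ : ℤ → ℤ} {P Q G X : Finset ℤ}

theorem Blocked.inc_card (hb : Blocked ℓ β P) : (inc ℓ β P).card = P.card := by
  refine Finset.card_image_of_injOn fun x hx y hy e => ?_
  simp only [Prod.mk.injEq] at e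
  exact hb x hx y hy e.1 e.2

theorem Blocked.mono {P' : Finset ℤ} (hb : Blocked ℓ β P) (h : P' ⊆ P) : Blocked ℓ β P' :=
  fun x hx y hy => hb x (h hx) y (h hy)

/-- In an `abba`-free sequence every block has at most one middle occurrence. -/
theorem dblBound_one (H : ℕ) : DblBound 1 H 2 1 := by
  classical
  intro ℓ β P Q hPQ hm hf hb _ ha
  have hmP := hm.mono hPQ
  have h1 := inc_union_card_le (ℓ := ℓ) (β := β) (X := P)
    (X₁ := P.filter fun x => ¬ Later ℓ β P x) (X₂ := P.filter fun x => Later ℓ β P x)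
    (fun x hx => by simp only [Finset.mem_union, Finset.mem_filter]; tauto)
  have h1' := inc_union_card_le (ℓ := ℓ) (β := β) (X := P.filter fun x => Later ℓ β P x)
    (X₁ := P.filter fun x => ¬ Earlier ℓ β P x)
    (X₂ := P.filter fun x => Later ℓ β P x ∧ Earlier ℓ β P x)
    (fun x hx => by simp only [Finset.mem_union, Finset.mem_filter] at hx ⊢; tauto)
  have h2 := inc_not_later_card_le (ℓ := ℓ) (β := β) (P := P)
  have h2' := inc_not_earlier_card_le (ℓ := ℓ) (β := β) (P := P)
  have h3 : (inc ℓ β (P.filter fun x => Later ℓ β P x ∧ Earlier ℓ β P x)).card ≤ 2 ^ H := by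
    refine inc_card_le_blocks (hf.mono (Finset.filter_subset _ _)) ?_
    intro x hx y hy e hxy
    rw [Finset.mem_filter] at hx hy
    obtain ⟨hx, ⟨xr, hxr, exr, hxxr⟩, xl, hxl, exl, hxlx⟩ := hx
    obtain ⟨hy, ⟨yr, hyr, eyr, hyyr⟩, yl, hyl, eyl, hyly⟩ := hy
    by_contra hne
    have o1 : y < xr := hmP.lt hy hxr (by omega)
    have o2 : x < yr := hmP.lt hx hyr (by omega)
    have o3 : xl < x := hmP.lt hxl hx (by omega)
    have o4 : yl < x := hmP.lt hyl hx (by omega)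
    have hlr : xl ≠ yl := fun h => hne (by rw [← exl, h, eyl])
    rcases lt_or_gt_of_ne hlr with h | h
    · exact ha (ℓ x) (ℓ y) xl xr hne (hPQ hxl) (hPQ hxr) exl (by simpa using exr)
        ⟨yl, y, hPQ hyl, hPQ hy, eyl, rfl, h, by omega, by omega, o1⟩
    · exact ha (ℓ y) (ℓ x) yl yr (Ne.symm hne) (hPQ hyl) (hPQ hyr) eyl (by simpa using eyr)
        ⟨xl, x, hPQ hxl, hPQ hx, exl, rfl, h, by omega, o3, o2⟩
  have : (inc ℓ β P).card ≤ 2 * letters ℓ P + 2 ^ H := by omega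
  rw [hb.inc_card] at this
  rw [one_mul]
  exact_mod_cast this

/-- All occurrences of `b` lie strictly between the predecessor and the successor of `x` among the
occurrences of its letter, and some of them lie on either side of `x`. -/
def Spans (ℓ : ℤ → ℕ) (P : Finset ℤ) (x : ℤ) (b : ℕ) : Prop :=
  (∀ z ∈ P, ℓ z = b → ∀ u ∈ P, ℓ u = ℓ x → (u < x → u < z) ∧ (x < u → z < u)) ∧
    (∃ z ∈ P, ℓ z = b ∧ z < x) ∧ ∃ z ∈ P, ℓ z = b ∧ x < z

theorem no_abbaab {a b : ℕ} (ha : DblFree ℓ P 2) (hab : a ≠ b) {p₀ p₁ p₂ p₃ p₄ p₅ : ℤ}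
    (h₀ : p₀ ∈ P ∧ ℓ p₀ = a) (h₁ : p₁ ∈ P ∧ ℓ p₁ = b) (h₂ : p₂ ∈ P ∧ ℓ p₂ = b)
    (h₃ : p₃ ∈ P ∧ ℓ p₃ = a) (h₄ : p₄ ∈ P ∧ ℓ p₄ = a) (h₅ : p₅ ∈ P ∧ ℓ p₅ = b)
    (o₁ : p₀ < p₁) (o₂ : p₁ < p₂) (o₃ : p₂ < p₃) (o₄ : p₃ < p₄) (o₅ : p₄ < p₅) : False :=
  ha a b p₀ p₅ hab h₀.1 h₅.1 h₀.2 (by simpa using h₅.2)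
    ⟨p₁, p₂, h₁.1, h₂.1, h₁.2, h₂.2, o₁, o₂.le, o₂, p₃, p₄, h₃.1, h₄.1, h₃.2, h₄.2, o₃, o₄.le, o₄,
      o₅⟩

/-- Let `x < y` be occurrences of `a` and `b`, with neither of these letters in between and with
two further occurrences of each letter on either side. In an `abbaab`-free sequence one of them
spans the letter of the other one. -/
theorem spans_or_spans (ha : DblFree ℓ P 2) {x y a₁ a₂ a₃ a₄ b₁ b₂ b₃ b₄ : ℤ} {a b : ℕ}
    (hab : a ≠ b) (hx : x ∈ P ∧ ℓ x = a) (hy : y ∈ P ∧ ℓ y = b) (hxy : x < y)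
    (hbet : ∀ u ∈ P, x < u → u < y → ℓ u ≠ a ∧ ℓ u ≠ b)
    (ha₁ : a₁ ∈ P ∧ ℓ a₁ = a) (ha₂ : a₂ ∈ P ∧ ℓ a₂ = a) (ha₃ : a₃ ∈ P ∧ ℓ a₃ = a)
    (ha₄ : a₄ ∈ P ∧ ℓ a₄ = a) (hb₁ : b₁ ∈ P ∧ ℓ b₁ = b) (hb₂ : b₂ ∈ P ∧ ℓ b₂ = b)
    (hb₃ : b₃ ∈ P ∧ ℓ b₃ = b) (hb₄ : b₄ ∈ P ∧ ℓ b₄ = b)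
    (oa₁ : a₁ < a₂) (oa₂ : a₂ < x) (oa₃ : y < a₃) (oa₄ : a₃ < a₄)
    (ob₁ : b₁ < b₂) (ob₂ : b₂ < x) (ob₃ : y < b₃) (ob₄ : b₃ < b₄) :
    Spans ℓ P x b ∨ Spans ℓ P y a := by
  have ne : ∀ {u v : ℤ}, u ∈ P ∧ ℓ u = a → v ∈ P ∧ ℓ v = b → u ≠ v := by
    rintro u v ⟨-, hu⟩ ⟨-, hv⟩ rfl
    exact hab (hu.symm.trans hv)
  by_contra hcon
  rw [not_or] at hcon
  obtain ⟨h1, h2⟩ := hcon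
  -- `c1` and `c2` say that `x` does not span `b` and that `y` does not span `a`; in each of the
  -- four cases some `abbaab` or `baabba` appears
  have c1 : ∃ z u, (z ∈ P ∧ ℓ z = b) ∧ (u ∈ P ∧ ℓ u = a) ∧ ((z < u ∧ u < x) ∨ (y < u ∧ u < z)) := by
    by_contra hno
    refine h1 ⟨fun z hz ez u hu eu => ⟨fun hux => ?_, fun hxu => ?_⟩,
      ⟨b₂, hb₂.1, hb₂.2, ob₂⟩, ⟨y, hy.1, hy.2, hxy⟩⟩
    · by_contra hzu
      have := ne ⟨hu, eu.trans hx.2⟩ ⟨hz, ez⟩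
      exact hno ⟨z, u, ⟨hz, ez⟩, ⟨hu, eu.trans hx.2⟩, Or.inl ⟨by omega, hux⟩⟩
    · by_contra hzu
      have h3 := ne ⟨hu, eu.trans hx.2⟩ ⟨hz, ez⟩
      have h4 := ne ⟨hu, eu.trans hx.2⟩ hy
      have h5 : ¬ u < y := fun h => (hbet u hu hxu h).1 (eu.trans hx.2)
      exact hno ⟨z, u, ⟨hz, ez⟩, ⟨hu, eu.trans hx.2⟩, Or.inr ⟨by omega, by omega⟩⟩
  have c2 : ∃ z u, (z ∈ P ∧ ℓ z = a) ∧ (u ∈ P ∧ ℓ u = b) ∧ ((z < u ∧ u < x) ∨ (y < u ∧ u < z)) := by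
    by_contra hno
    refine h2 ⟨fun z hz ez u hu eu => ⟨fun huy => ?_, fun hyu => ?_⟩,
      ⟨x, hx.1, hx.2, hxy⟩, ⟨a₃, ha₃.1, ha₃.2, oa₃⟩⟩
    · by_contra hzu
      have h3 := ne ⟨hz, ez⟩ ⟨hu, eu.trans hy.2⟩
      have h4 := ne hx ⟨hu, eu.trans hy.2⟩
      have h5 : ¬ x < u := fun h => (hbet u hu h huy).2 (eu.trans hy.2)
      exact hno ⟨z, u, ⟨hz, ez⟩, ⟨hu, eu.trans hy.2⟩, Or.inl ⟨by omega, by omega⟩⟩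
    · by_contra hzu
      have h3 := ne ⟨hz, ez⟩ ⟨hu, eu.trans hy.2⟩
      exact hno ⟨z, u, ⟨hz, ez⟩, ⟨hu, eu.trans hy.2⟩, Or.inr ⟨hyu, by omega⟩⟩
  obtain ⟨z, u, hz, hu, ⟨o1, o2⟩ | ⟨o1, o2⟩⟩ := c1 <;>
    obtain ⟨z', u', hz', hu', ⟨o3, o4⟩ | ⟨o3, o4⟩⟩ := c2
  · rcases lt_or_gt_of_ne (ne ha₄ hb₄) with h | h
    · exact no_abbaab ha hab hz' hu' hy ha₃ ha₄ hb₄ o3 (by omega) oa₃ oa₄ h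
    · exact no_abbaab ha hab.symm hz hu hx hy hb₄ ha₄ o1 o2 hxy (by omega) h
  · exact no_abbaab ha hab.symm hz hu hx hy hu' hz' o1 o2 hxy o3 o4
  · rcases lt_or_gt_of_ne (ne ha₁ hb₁) with h | h
    · exact no_abbaab ha hab ha₁ hb₁ hb₂ hx hu hz h ob₁ ob₂ (by omega) o2
    · rcases lt_or_gt_of_ne (ne ha₄ hb₃) with h' | h'
      · exact no_abbaab ha hab hz' hu' hy ha₃ ha₄ hb₃ o3 (by omega) oa₃ oa₄ h'
      · exact no_abbaab ha hab.symm hb₁ ha₁ hx hy hb₃ ha₄ h (by omega) hxy ob₃ h'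
  · rcases lt_or_gt_of_ne (ne ha₂ hb₁) with h | h
    · exact no_abbaab ha hab ha₂ hb₁ hb₂ hx hu hz h ob₁ ob₂ (by omega) o2
    · exact no_abbaab ha hab.symm hb₁ ha₂ hx hy hu' hz' h oa₂ hxy o3 o4

/-- Remove the first and the last occurrence of every letter. -/
noncomputable def trim (ℓ : ℤ → ℕ) (P : Finset ℤ) : Finset ℤ := trimFirst ℓ P P ∩ trimLast ℓ P P

theorem trim_subset : trim ℓ P ⊆ P := fun _ hz => (mem_trimFirst.1 (Finset.mem_inter.1 hz).1).1

/-- Occurrences that remain if the first two and the last two of every letter are removed. -/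
theorem exists_of_mem_trim_trim {x : ℤ} (hx : x ∈ trim ℓ (trim ℓ P)) :
    ∃ u₁ u₂ u₃ u₄, (u₁ ∈ P ∧ ℓ u₁ = ℓ x) ∧ (u₂ ∈ P ∧ ℓ u₂ = ℓ x) ∧ (u₃ ∈ P ∧ ℓ u₃ = ℓ x) ∧
      (u₄ ∈ P ∧ ℓ u₄ = ℓ x) ∧ u₁ < u₂ ∧ u₂ < x ∧ x < u₃ ∧ u₃ < u₄ := by
  obtain ⟨h1, h2⟩ := Finset.mem_inter.1 hx
  obtain ⟨-, u₂, hu₂, e₂, o₂⟩ := mem_trimFirst.1 h1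
  obtain ⟨-, u₃, hu₃, e₃, o₃⟩ := mem_trimLast.1 h2
  obtain ⟨-, u₁, hu₁, e₁, o₁⟩ := mem_trimFirst.1 (Finset.mem_inter.1 hu₂).1
  obtain ⟨-, u₄, hu₄, e₄, o₄⟩ := mem_trimLast.1 (Finset.mem_inter.1 hu₃).2
  exact ⟨u₁, u₂, u₃, u₄, ⟨hu₁, e₁.trans e₂⟩, ⟨trim_subset hu₂, e₂⟩, ⟨trim_subset hu₃, e₃⟩,
    ⟨hu₄, e₄.trans e₃⟩, o₁, o₂, o₃, o₄⟩

open scoped Classical in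
/-- An occurrence spanning some letter is charged to the spanned letter that starts first. No
letter is charged twice: of two occurrences spanning the same letter, one spans the letter of the
other one, which starts earlier. -/
theorem card_spanning_le (ha : DblFree ℓ P 2) :
    ((trim ℓ (trim ℓ P)).filter fun x => ∃ b, Spans ℓ P x b).card ≤ letters ℓ P := by
  have hsub : trim ℓ (trim ℓ P) ⊆ P := trim_subset.trans trim_subset
  have hex : ∀ x, (∃ b, Spans ℓ P x b) →
      ∃ z ∈ P, Spans ℓ P x (ℓ z) ∧ ∀ w ∈ P, Spans ℓ P x (ℓ w) → z ≤ w := by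
    rintro x ⟨b, hb⟩
    obtain ⟨z, hz, ez, -⟩ := hb.2.1
    obtain ⟨m, hm, hmin⟩ := Finset.exists_min_image (P.filter fun z => Spans ℓ P x (ℓ z)) id
      ⟨z, Finset.mem_filter.2 ⟨hz, ez ▸ hb⟩⟩
    rw [Finset.mem_filter] at hm
    exact ⟨m, hm.1, hm.2, fun w hw hs => hmin w (Finset.mem_filter.2 ⟨hw, hs⟩)⟩
  choose! f hfP hfS hfmin using hex
  refine Finset.card_le_card_of_injOn (fun x => ℓ (f x)) ?_ ?_
  · intro x hx
    have hx := (Finset.mem_filter.1 (Finset.mem_coe.1 hx)).2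
    exact Finset.mem_coe.2 (Finset.mem_image_of_mem _ (hfP x hx))
  · have key : ∀ x ∈ trim ℓ (trim ℓ P), ∀ y ∈ trim ℓ (trim ℓ P), (∃ b, Spans ℓ P x b) →
        (∃ b, Spans ℓ P y b) → ℓ (f x) = ℓ (f y) → ¬ x < y := by
      intro x hx y hy sx sy e hxy
      have Sx := hfS x sx
      have Sy := hfS y sy
      rw [← e] at Sy
      have hfe : f x = f y := le_antisymm (hfmin x sx _ (hfP y sy) (e ▸ Sx))
        (hfmin y sy _ (hfP x sx) Sy)
      obtain ⟨⟨z, hz, ez, hzx⟩, -⟩ := Sx.2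
      obtain ⟨-, ⟨w, hw, ew, hyw⟩⟩ := Sy.2
      obtain ⟨u₁, u₂, u₃, u₄, h1, h2, h3, h4, o1, o2, o3, o4⟩ := exists_of_mem_trim_trim hx
      obtain ⟨v₁, v₂, v₃, v₄, k1, k2, k3, k4, q1, q2, q3, q4⟩ := exists_of_mem_trim_trim hy
      have hxP := hsub hx
      have hyP := hsub hy
      -- the letters of `x` and `y` do not occur within the span of the letter charged
      have A : ∀ u ∈ P, ℓ u = ℓ x → x < u → y < u := fun u hu eu hlt => by
        have := (Sx.1 w hw ew u hu eu).2 hlt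
        omega
      have B : ∀ u ∈ P, ℓ u = ℓ y → u < y → u < x := fun u hu eu hlt => by
        have := (Sy.1 z hz ez u hu eu).1 hlt
        omega
      by_cases hne : ℓ x = ℓ y
      · have := B x hxP hne hxy
        omega
      · rcases spans_or_spans ha hne ⟨hxP, rfl⟩ ⟨hyP, rfl⟩ hxy
          (fun u hu hxu huy => ⟨fun eu => by have := A u hu eu hxu; omega,
            fun eu => by have := B u hu eu huy; omega⟩) h1 h2 h3 h4 k1 k2 k3 k4
          o1 o2 (A u₃ h3.1 h3.2 o3) o4 q1 (B v₂ k2.1 k2.2 q2) q3 q4 with h | h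
        -- the letter of `y` is spanned by `x` and starts before the letter charged
        · have c1 := hfmin x sx v₂ k2.1 (by rw [k2.2]; exact h)
          have c2 := (Sy.1 (f x) (hfP x sx) rfl v₂ k2.1 k2.2).1 q2
          omega
        · have c1 := hfmin y sy u₂ h2.1 (by rw [h2.2]; exact h)
          have c2 := (Sx.1 (f x) (hfP x sx) rfl u₂ h2.1 h2.2).1 o2
          omega
    intro x hx y hy e
    have hx := Finset.mem_filter.1 (Finset.mem_coe.1 hx)
    have hy := Finset.mem_filter.1 (Finset.mem_coe.1 hy)
    have h1 := key x hx.1 y hy.1 hx.2 hy.2 e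
    have h2 := key y hy.1 x hx.1 hy.2 hx.2 e.symm
    omega

/-- Four occurrences of every letter are trimmed and one is charged by `card_spanning_le`; of the
others, every block contains at most one by `spans_or_spans`. -/
theorem dblBound_two (H : ℕ) : DblBound 2 H 5 1 := by
  classical
  intro ℓ β P Q hPQ hm hf hb _ haQ
  have ha := haQ.mono hPQ
  have hmP := hm.mono hPQ
  have hsub : trim ℓ (trim ℓ P) ⊆ P := trim_subset.trans trim_subset
  have h1 : P.card ≤ (trim ℓ P).card + 2 * letters ℓ P := card_le_trim_both P
  have h2 : (trim ℓ P).card ≤ (trim ℓ (trim ℓ P)).card + 2 * letters ℓ (trim ℓ P) :=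
    card_le_trim_both _
  have h3 : letters ℓ (trim ℓ P) ≤ letters ℓ P := letters_mono trim_subset
  have h4 := card_spanning_le ha
  have h5 := Finset.card_filter_add_card_filter_not (s := trim ℓ (trim ℓ P))
    fun x => ∃ b, Spans ℓ P x b
  have h6 : ((trim ℓ (trim ℓ P)).filter fun x => ¬ ∃ b, Spans ℓ P x b).card ≤ 2 ^ H := by
    have hsub' := (Finset.filter_subset (fun x => ¬ ∃ b, Spans ℓ P x b)
      (trim ℓ (trim ℓ P))).trans hsub
    rw [← (hb.mono hsub').inc_card]
    refine inc_card_le_blocks (hf.mono hsub') ?_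
    intro x hx y hy e hxy
    by_contra hne
    rw [Finset.mem_filter] at hx hy
    have hxP := hsub hx.1
    have hyP := hsub hy.1
    obtain ⟨u₁, u₂, u₃, u₄, h1, h2, h3, h4, o1, o2, o3, o4⟩ := exists_of_mem_trim_trim hx.1
    obtain ⟨v₁, v₂, v₃, v₄, k1, k2, k3, k4, q1, q2, q3, q4⟩ := exists_of_mem_trim_trim hy.1
    have bet : ∀ u ∈ P, x < u → u < y → ℓ u ≠ ℓ x ∧ ℓ u ≠ ℓ y := by
      intro u hu hxu huy
      have b1 := hmP x hxP u hu hxu.le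
      have b2 := hmP u hu y hyP huy.le
      constructor
      · intro eu
        have := hb u hu x hxP eu (by omega)
        omega
      · intro eu
        have := hb u hu y hyP eu (by omega)
        omega
    have A : y < u₃ := by
      by_contra hc
      have : u₃ ≠ y := fun h => hne (by rw [← h3.2, h])
      exact (bet u₃ h3.1 o3 (by omega)).1 h3.2
    have B : v₂ < x := by
      by_contra hc
      have : v₂ ≠ x := fun h => hne (by rw [← k2.2, h])
      exact (bet v₂ k2.1 (by omega) q2).2 k2.2
    rcases spans_or_spans ha hne ⟨hxP, rfl⟩ ⟨hyP, rfl⟩ hxy bet h1 h2 h3 h4 k1 k2 k3 k4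
      o1 o2 A o4 q1 B q3 q4 with h | h
    · exact hx.2 ⟨_, h⟩
    · exact hy.2 ⟨_, h⟩
  have : P.card ≤ 5 * letters ℓ P + 2 ^ H := by omega
  rw [one_mul]
  exact_mod_cast this

end Base

/-! ### The recursions for double Davenport-Schinzel sequences -/

section Hidden
variable {ℓ : ℤ → ℕ} {β γ : ℤ → ℤ} {P Q G X : Finset ℤ}

/-- If a set of positions has one occurrence for each of its incidences, and `Q` contains further
occurrences of the letter on both sides in the same group, then any alternation of these positions
is a doubled alternation of `Q`: each occurrence is paired with the one to its left, unless the
preceding one lies in the same group, in which case it is paired with the one to its right. -/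
theorem Chain.double (hm : Mono γ Q) (hXQ : X ⊆ Q)
    (huniq : ∀ x ∈ X, ∀ y ∈ X, ℓ x = ℓ y → γ x = γ y → x = y)
    (hlo : ∀ x ∈ X, ∃ y ∈ Q, ℓ y = ℓ x ∧ γ y = γ x ∧ y < x)
    (hhi : ∀ x ∈ X, ∃ y ∈ Q, ℓ y = ℓ x ∧ γ y = γ x ∧ x < y) (k : ℕ) :
    ∀ (a b : ℕ) (x z : ℤ), x ∈ X → ℓ x = b → Chain Eq ℓ X k a b x z →
      ∃ z', Chain (· < ·) ℓ Q k a b x z' := by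
  induction k using Nat.strong_induction_on with
  | _ k ih =>
    intro a b x z hx ex hc
    match k, hc with
    | 0, hc => exact ⟨z, hc⟩
    | k + 1, hc =>
      obtain ⟨h, _, hhX, -, eh, -, hxh, -, rfl, hc'⟩ := hc
      have hle := hm x (hXQ hx) h (hXQ hhX) hxh.le
      rcases hle.lt_or_eq with hlt | heq
      · obtain ⟨y, hy, ey, gy, hyh⟩ := hlo h hhX
        obtain ⟨z', hz'⟩ := ih k (by omega) b a h z hhX eh hc'
        exact ⟨z', y, h, hy, hXQ hhX, ey.trans eh, eh, hm.lt (hXQ hx) hy (by omega), hyh.le, hyh,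
          hz'⟩
      · obtain ⟨y, hy, ey, gy, hhy⟩ := hhi h hhX
        match k, hc' with
        | 0, _ =>
          exact ⟨y + 1, h, y, hXQ hhX, hy, eh, ey.trans eh, hxh, hhy.le, hhy,
            show y < y + 1 by omega⟩
        | k + 1, hc' =>
          obtain ⟨w, _, hw, -, ew, -, hhw, -, rfl, hc''⟩ := hc'
          have hle' := hm h (hXQ hhX) w (hXQ hw) hhw.le
          have hlt' : γ h < γ w := by
            refine lt_of_le_of_ne hle' fun hcon => ?_
            have := huniq x hx w hw (ex.trans ew.symm) (heq.trans hcon)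
            omega
          obtain ⟨v, hv, ev, gv, hvw⟩ := hlo w hw
          obtain ⟨z', hz'⟩ := ih k (by omega) a b w z hw ew hc''
          exact ⟨z', h, y, hXQ hhX, hy, eh, ey.trans eh, hxh, hhy.le, hhy, v, w, hv, hXQ hw,
            ev.trans ew, ew, hm.lt hy hv (by omega), hvw.le, hvw, hz'⟩

/-- The incidences with three occurrences in `Q` are those of an alternation-free sequence. -/
theorem exists_hidden {s : ℕ} (hm : Mono γ Q) (hQ : DblFree ℓ Q s) (K : Finset (ℕ × ℤ))
    (hK : ∀ c ∈ K, ∃ x ∈ Q, ∃ y ∈ Q, ∃ z ∈ Q, ℓ x = c.1 ∧ ℓ y = c.1 ∧ ℓ z = c.1 ∧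
      γ x = c.2 ∧ γ z = c.2 ∧ x < y ∧ y < z) :
    ∃ X ⊆ Q, inc ℓ γ X = K ∧ AltFree ℓ X (s + 2) := by
  choose! lo hloQ hid hidQ hi hhiQ elo eid ehi glo ghi olo ohi using hK
  have gid : ∀ c ∈ K, γ (hid c) = c.2 := fun c hc => by
    have h1 := hm _ (hloQ c hc) _ (hidQ c hc) (olo c hc).le
    have h2 := hm _ (hidQ c hc) _ (hhiQ c hc) (ohi c hc).le
    have h3 := glo c hc
    have h4 := ghi c hc
    omega
  have hXQ : K.image hid ⊆ Q := fun x hx => by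
    obtain ⟨c, hc, rfl⟩ := Finset.mem_image.1 hx
    exact hidQ c hc
  refine ⟨K.image hid, hXQ, ?_, ?_⟩
  · ext c
    rw [mem_inc]
    constructor
    · rintro ⟨x, hx, e1, e2⟩
      obtain ⟨d, hd, rfl⟩ := Finset.mem_image.1 hx
      rw [eid d hd] at e1
      rw [gid d hd] at e2
      rwa [← Prod.ext e1 e2]
    · exact fun hc => ⟨hid c, Finset.mem_image_of_mem _ hc, eid c hc, gid c hc⟩
  · intro a b x z hab hc
    obtain ⟨h, _, hhX, -, eh, -, hxh, -, rfl, hc'⟩ := hc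
    obtain ⟨z', hz'⟩ := Chain.double hm hXQ (fun x hx y hy e e' => by
        obtain ⟨c, hc, rfl⟩ := Finset.mem_image.1 hx
        obtain ⟨d, hd, rfl⟩ := Finset.mem_image.1 hy
        rw [eid c hc, eid d hd] at e
        rw [gid c hc, gid d hd] at e'
        rw [Prod.ext e e'])
      (fun x hx => by
        obtain ⟨c, hc, rfl⟩ := Finset.mem_image.1 hx
        exact ⟨lo c, hloQ c hc, (elo c hc).trans (eid c hc).symm,
          (glo c hc).trans (gid c hc).symm, olo c hc⟩)
      (fun x hx => by
        obtain ⟨c, hc, rfl⟩ := Finset.mem_image.1 hx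
        exact ⟨hi c, hhiQ c hc, (ehi c hc).trans (eid c hc).symm,
          (ghi c hc).trans (gid c hc).symm, ohi c hc⟩)
      (s + 1) b a h z hhX eh hc'
    obtain ⟨w, hw, ew, hcw⟩ := hz'.drop_last
    exact hQ a b h w hab (hXQ hhX) hw eh ew hcw

end Hidden

section Step
variable {ℓ : ℤ → ℕ} {β γ : ℤ → ℤ} {P Q G X : Finset ℤ}

theorem After.mono {a : ℕ} (h : After ℓ P X a) (hPQ : P ⊆ Q) : After ℓ Q X a := by
  obtain ⟨y, hy, h⟩ := h
  exact ⟨y, hPQ hy, h⟩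

theorem Before.mono {a : ℕ} (h : Before ℓ P X a) (hPQ : P ⊆ Q) : Before ℓ Q X a := by
  obtain ⟨y, hy, h⟩ := h
  exact ⟨y, hPQ hy, h⟩

theorem leftOf_trimLast : LeftOf ℓ X (trimLast ℓ X Q) := fun _ hz => (mem_trimLast.1 hz).2

theorem rightOf_trimFirst : RightOf ℓ X (trimFirst ℓ X Q) := fun _ hz => (mem_trimFirst.1 hz).2

theorem trimLast_subset : trimLast ℓ X Q ⊆ Q := fun _ hz => (mem_trimLast.1 hz).1

theorem trimFirst_subset : trimFirst ℓ X Q ⊆ Q := fun _ hz => (mem_trimFirst.1 hz).1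

/-- The contribution of the first and the last occurrences of global letters. -/
theorem dbl_firsts_lasts {s h H : ℕ} {A₁ B₁ : ℝ} (hh : h ≤ H) (hD₁ : DblBound (s + 1) h A₁ B₁)
    (hA₁ : 0 ≤ A₁) (hB₁ : 0 ≤ B₁) (hPQ : P ⊆ Q) (hm : Mono β Q) (hf : Fits β P H)
    (hb : Blocked ℓ β P) (hsep : Separated ℓ P Q) (hQ : DblFree ℓ Q (s + 2)) (hGP : G ⊆ P)
    (hγ : γ = fun x => β x / 2 ^ h) :
    ((firsts ℓ γ P G).card : ℝ) + (lasts ℓ γ P G).card ≤ (A₁ + 1) *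
      ((inc ℓ γ (firsts ℓ γ P G)).card + (inc ℓ γ (lasts ℓ γ P G)).card) + 2 * B₁ * 2 ^ H := by
  have hmγ : Mono γ P := hγ ▸ (hm.mono hPQ).div h
  have hFP : firsts ℓ γ P G ⊆ P := fun x hx => by
    simp only [firsts, Finset.mem_filter] at hx
    exact hGP hx.1
  have hLP : lasts ℓ γ P G ⊆ P := fun x hx => by
    simp only [lasts, Finset.mem_filter] at hx
    exact hGP hx.1
  have b1 := hD₁.sum (t := 1) hA₁ hB₁ hh hm (hf.mono hFP) (hb.mono hFP) fun g => by
    set X := (firsts ℓ γ P G).filter fun x => β x / 2 ^ h = g with hX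
    have hXP : X ⊆ P := (Finset.filter_subset _ _).trans hFP
    refine ⟨trimLast ℓ X X, trimLast ℓ X Q, trimLast_subset, ?_, trimLast_subset,
      trimLast_mono (hXP.trans hPQ), separated_trimLast (hsep.mono hXP subset_rfl), ?_⟩
    · rw [one_mul]; exact card_le_trimLast X
    · refine hQ.of_after (by omega) trimLast_subset (hXP.trans hPQ) leftOf_trimLast fun x hx => ?_
      have hx' := hx
      simp only [hX, firsts, Finset.mem_filter] at hx'
      refine (Later.after hmγ hx'.1.2.1 hXP fun y hy => ?_).mono hPQ
      rw [hγ]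
      exact (Finset.mem_filter.1 hy).2.trans hx'.2.symm
  have b2 := hD₁.sum (t := 1) hA₁ hB₁ hh hm (hf.mono hLP) (hb.mono hLP) fun g => by
    set X := (lasts ℓ γ P G).filter fun x => β x / 2 ^ h = g with hX
    have hXP : X ⊆ P := (Finset.filter_subset _ _).trans hLP
    refine ⟨trimFirst ℓ X X, trimFirst ℓ X Q, trimFirst_subset, ?_, trimFirst_subset,
      trimFirst_mono (hXP.trans hPQ), separated_trimFirst (hsep.mono hXP subset_rfl), ?_⟩
    · rw [one_mul]; exact card_le_trimFirst X
    · refine hQ.of_before (by omega) trimFirst_subset (hXP.trans hPQ) rightOf_trimFirst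
        fun x hx => ?_
      have hx' := hx
      simp only [hX, lasts, Finset.mem_filter] at hx'
      refine (Earlier.before hmγ hx'.1.2.2.1 hXP fun y hy => ?_).mono hPQ
      rw [hγ]
      exact (Finset.mem_filter.1 hy).2.trans hx'.2.symm
  rw [← hγ] at b1 b2
  push_cast at b1 b2
  linarith

/-- The contribution of middle occurrences. -/
theorem dbl_mids {s h H : ℕ} {A₂ B₂ : ℝ} (hh : h ≤ H) (hs : 1 ≤ s) (hD₂ : DblBound s h A₂ B₂)
    (hA₂ : 0 ≤ A₂) (hB₂ : 0 ≤ B₂) (hPQ : P ⊆ Q) (hm : Mono β Q) (hf : Fits β P H)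
    (hb : Blocked ℓ β P) (hsep : Separated ℓ P Q) (hQ : DblFree ℓ Q (s + 2)) (hGP : G ⊆ P)
    (hγ : γ = fun x => β x / 2 ^ h) (hX : X ⊆ mids ℓ γ G) :
    (X.card : ℝ) ≤ (A₂ + 2) * (inc ℓ γ X).card + B₂ * 2 ^ H := by
  have hmG : Mono γ G := hγ ▸ (hm.mono (hGP.trans hPQ)).div h
  have hXP : X ⊆ P := hX.trans (mids_subset.trans hGP)
  have := hD₂.sum (t := 2) hA₂ hB₂ hh hm (hf.mono hXP) (hb.mono hXP) fun g => by
    set Y := X.filter fun x => β x / 2 ^ h = g with hY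
    have hYX : Y ⊆ X := Finset.filter_subset _ _
    have hYP : Y ⊆ P := hYX.trans hXP
    have key := fun x (hx : x ∈ Y) => before_after_of_mids hmG hx (hYX.trans hX) fun y hy => by
      rw [hγ]
      exact (Finset.mem_filter.1 hy).2.trans (Finset.mem_filter.1 hx).2.symm
    refine ⟨trim ℓ Y, trimFirst ℓ Y Q ∩ trimLast ℓ Y Q, trim_subset, card_le_trim_both Y,
      Finset.inter_subset_left.trans trimFirst_subset,
      Finset.inter_subset_inter (trimFirst_mono (hYP.trans hPQ)) (trimLast_mono (hYP.trans hPQ)),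
      separated_trim_both (hsep.mono hYP subset_rfl), ?_⟩
    exact hQ.of_before_after hs (Finset.inter_subset_left.trans trimFirst_subset) (hYP.trans hPQ)
      (fun z hz => leftOf_trimLast z (Finset.mem_inter.1 hz).2)
      (fun z hz => rightOf_trimFirst z (Finset.mem_inter.1 hz).1)
      (fun x hx => (key x hx).1.mono (hGP.trans hPQ))
      fun x hx => (key x hx).2.mono (hGP.trans hPQ)
  rw [← hγ] at this
  exact_mod_cast this

/-- Every incidence of `G` comes from two or more occurrences in `G`. -/
def Heavy (ℓ : ℤ → ℕ) (γ : ℤ → ℤ) (G : Finset ℤ) : Prop :=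
  ∀ x ∈ G, ∃ y ∈ G, ∃ z ∈ G, ℓ y = ℓ x ∧ ℓ z = ℓ x ∧ γ y = γ x ∧ γ z = γ x ∧ y < z

/-- The contribution of middle occurrences that are not feathers, for odd orders. -/
theorem dbl_mids_of_hasPairs {s h H : ℕ} {A₃ B₃ : ℝ} (hh : h ≤ H) (hs : 1 ≤ s) (hse : Even s)
    (hD₃ : DblBound s h A₃ B₃) (hA₃ : 0 ≤ A₃) (hB₃ : 0 ≤ B₃) (hPQ : P ⊆ Q) (hm : Mono β Q)
    (hf : Fits β P H) (hb : Blocked ℓ β P) (hsep : Separated ℓ P Q) (hQ : DblFree ℓ Q (s + 3))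
    (hGP : G ⊆ P) (hγ : γ = fun x => β x / 2 ^ h) (hG : Heavy ℓ γ G) (hX : X ⊆ mids ℓ γ G)
    (hN : HasPairs ℓ γ G X) :
    (X.card : ℝ) ≤ (A₃ + 2) * (inc ℓ γ X).card + B₃ * 2 ^ H := by
  have hmG : Mono γ G := hγ ▸ (hm.mono (hGP.trans hPQ)).div h
  have hXP : X ⊆ P := hX.trans (mids_subset.trans hGP)
  have := hD₃.sum (t := 2) hA₃ hB₃ hh hm (hf.mono hXP) (hb.mono hXP) fun g => by
    set Y := X.filter fun x => β x / 2 ^ h = g with hY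
    have hYX : Y ⊆ X := Finset.filter_subset _ _
    have hYP : Y ⊆ P := hYX.trans hXP
    have hYG : Y ⊆ G := hYX.trans (hX.trans mids_subset)
    have hg : ∀ x ∈ Y, γ x = g := fun x hx => by
      rw [hγ]; exact (Finset.mem_filter.1 hx).2
    have key := fun x (hx : x ∈ Y) => before_after_of_mids hmG hx (hYX.trans hX) fun y hy =>
      (hg y hy).trans (hg x hx).symm
    refine ⟨trim ℓ Y, trimFirst ℓ Y Q ∩ trimLast ℓ Y Q, trim_subset, card_le_trim_both Y,
      Finset.inter_subset_left.trans trimFirst_subset,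
      Finset.inter_subset_inter (trimFirst_mono (hYP.trans hPQ)) (trimLast_mono (hYP.trans hPQ)),
      separated_trim_both (hsep.mono hYP subset_rfl), ?_⟩
    refine hQ.of_pairs hs hse (Finset.inter_subset_left.trans trimFirst_subset) (hYP.trans hPQ)
      (fun z hz => leftOf_trimLast z (Finset.mem_inter.1 hz).2)
      (fun z hz => rightOf_trimFirst z (Finset.mem_inter.1 hz).1)
      (fun x hx => (key x hx).1.mono (hGP.trans hPQ))
      (fun x hx => (key x hx).2.mono (hGP.trans hPQ)) fun x hx y hy hne => ?_
    obtain ⟨u, hu, v, hv, eu, ev, huv, hcase⟩ :=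
      hN x (hYX hx) y (hYX hy) ((hg x hx).trans (hg y hy).symm) hne
    obtain ⟨u₁, hu₁, u₂, hu₂, eu₁, eu₂, gu₁, gu₂, ou⟩ := hG u hu
    obtain ⟨v₁, hv₁, v₂, hv₂, ev₁, ev₂, gv₁, gv₂, ov⟩ := hG v hv
    refine ⟨u₁, hPQ (hGP hu₁), u₂, hPQ (hGP hu₂), v₁, hPQ (hGP hv₁), v₂, hPQ (hGP hv₂),
      eu₁.trans eu, eu₂.trans eu, ev₁.trans ev, ev₂.trans ev, ou, hmG.lt hu₂ hv₁ (by omega), ov,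
      hcase.imp (fun h w hw => hmG.lt (hYG hw) hu₁ ?_) (fun h w hw => hmG.lt hv₂ (hYG hw) ?_)⟩
    · rw [hg w hw, gu₁, ← hg x hx]; exact h
    · rw [hg w hw, gv₂, ← hg x hx]; exact h
  rw [← hγ] at this
  exact_mod_cast this

/-- The contribution of the local letters. -/
theorem dbl_locals {s h H : ℕ} {A B : ℝ} (hh : h ≤ H) (hD : DblBound s h A B)
    (hA : 0 ≤ A) (hB : 0 ≤ B) (hPQ : P ⊆ Q) (hm : Mono β Q) (hf : Fits β P H)
    (hb : Blocked ℓ β P) (hsep : Separated ℓ P Q) (hQ : DblFree ℓ Q s)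
    (hγ : γ = fun x => β x / 2 ^ h) :
    ((locals ℓ γ P).card : ℝ) ≤ A * letters ℓ (locals ℓ γ P) + B * 2 ^ H := by
  have b1 := hD.sum (t := 0) (X := locals ℓ γ P) hA hB hh hm (hf.mono locals_subset)
    (hb.mono locals_subset) fun g => by
      have hXP := (Finset.filter_subset (fun x => β x / 2 ^ h = g) (locals ℓ γ P)).trans
        locals_subset
      exact ⟨_, Q, subset_rfl, by omega, subset_rfl, hXP.trans hPQ, hsep.mono hXP subset_rfl, hQ⟩
  rw [← hγ] at b1
  have c1 : ((inc ℓ γ (locals ℓ γ P)).card : ℝ) ≤ letters ℓ (locals ℓ γ P) := by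
    exact_mod_cast inc_locals_card
  have := mul_le_mul_of_nonneg_left c1 hA
  push_cast at b1
  linarith

/-- The recursion for two groups. -/
theorem dblBound_step_two_groups {s h : ℕ} {A B A₁ B₁ : ℝ} (hD : DblBound (s + 2) h A B)
    (hD₁ : DblBound (s + 1) h A₁ B₁) (hA0 : 0 ≤ A) (hB : 0 ≤ B) (hA₁ : 0 ≤ A₁) (hB₁ : 0 ≤ B₁)
    (hA : 2 * (A₁ + 1) ≤ A) : DblBound (s + 2) (h + 1) A (B + 2 * B₁) := by
  intro ℓ β P Q hPQ hm hf hb hsep hQ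
  obtain ⟨γ, hγ⟩ : ∃ γ : ℤ → ℤ, γ = fun x => β x / 2 ^ h := ⟨_, rfl⟩
  have hh : h ≤ h + 1 := by omega
  obtain ⟨G, hG⟩ : ∃ G, G = globals ℓ γ P := ⟨_, rfl⟩
  have hGP : G ⊆ P := hG ▸ globals_subset
  have hgl : ∀ x ∈ G, Earlier ℓ γ P x ∨ Later ℓ γ P x := fun x hx => globals_global (hG ▸ hx)
  have hM : mids ℓ γ G = ∅ := mids_eq_empty (by
    have := (hf.mono hGP).div hh
    rwa [← hγ, Nat.add_sub_cancel_left] at this)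
  have b1 := dbl_locals hh hD hA0 hB hPQ hm hf hb hsep hQ hγ
  have b2 := dbl_firsts_lasts hh hD₁ hA₁ hB₁ hPQ hm hf hb hsep hQ hGP hγ
  have c1 : P ⊆ locals ℓ γ P ∪ (firsts ℓ γ P G ∪ lasts ℓ γ P G) := fun x hx => by
    rw [Finset.mem_union]
    refine (mem_locals_or_globals hx).imp id fun h => ?_
    rw [← hG, split_global hGP hgl, hM, Finset.union_empty] at h
    exact h
  have c2 : (P.card : ℝ) ≤ (locals ℓ γ P).card + ((firsts ℓ γ P G).card
      + (lasts ℓ γ P G).card) := by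
    exact_mod_cast (Finset.card_le_card c1).trans ((Finset.card_union_le _ _).trans
      (by have := Finset.card_union_le (firsts ℓ γ P G) (lasts ℓ γ P G); omega))
  have c3 : ((inc ℓ γ (firsts ℓ γ P G)).card : ℝ) + (inc ℓ γ (lasts ℓ γ P G)).card
      ≤ 2 * letters ℓ G := by
    have h1 := inc_firsts_card_le (ℓ := ℓ) (γ := γ) (P := P) (G := G)
    have h2 := inc_lasts_card_le (ℓ := ℓ) (γ := γ) (P := P) (G := G)
    exact_mod_cast (show _ ≤ 2 * letters ℓ G by omega)
  have c4 : (letters ℓ (locals ℓ γ P) : ℝ) = letters ℓ P - letters ℓ G := by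
    rw [← letters_locals_add_globals (ℓ := ℓ) (γ := γ) (P := P), hG]
    push_cast; ring
  rw [c4] at b1
  have m1 := mul_le_mul_of_nonneg_left c3 (show 0 ≤ A₁ + 1 by linarith)
  have m2 := mul_le_mul_of_nonneg_right hA (Nat.cast_nonneg (α := ℝ) (letters ℓ G))
  linarith

open scoped Classical in
/-- The occurrences of global letters that are not alone in their group. -/
noncomputable def heavies (ℓ : ℤ → ℕ) (γ : ℤ → ℤ) (P : Finset ℤ) : Finset ℤ :=
  (globals ℓ γ P).filter fun x => ∃ y ∈ P, ℓ y = ℓ x ∧ γ y = γ x ∧ y ≠ x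

open scoped Classical in
/-- The occurrences of global letters that are alone in their group. -/
noncomputable def lights (ℓ : ℤ → ℕ) (γ : ℤ → ℤ) (P : Finset ℤ) : Finset ℤ :=
  (globals ℓ γ P).filter fun x => ¬ ∃ y ∈ P, ℓ y = ℓ x ∧ γ y = γ x ∧ y ≠ x

theorem heavies_subset : heavies ℓ γ P ⊆ globals ℓ γ P := by
  classical exact Finset.filter_subset _ _

theorem lights_subset : lights ℓ γ P ⊆ globals ℓ γ P := by
  classical exact Finset.filter_subset _ _

theorem heavy_heavies : Heavy ℓ γ (heavies ℓ γ P) := by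
  intro x hx
  have hx' := hx
  simp only [heavies, Finset.mem_filter] at hx'
  obtain ⟨hxg, y, hy, ey, gy, hne⟩ := hx'
  have hyh : y ∈ heavies ℓ γ P := by
    simp only [heavies, Finset.mem_filter]
    exact ⟨mem_globals_iff_of_eq (globals_subset hxg) hy ey.symm hxg, x, globals_subset hxg,
      ey.symm, gy.symm, hne.symm⟩
  rcases lt_or_gt_of_ne hne with h | h
  · exact ⟨y, hyh, x, hx, ey, rfl, gy, rfl, h⟩
  · exact ⟨x, hx, y, hyh, rfl, ey, rfl, gy, h⟩

/-- The contribution of all but the middle heavy occurrences. -/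
theorem dbl_split {s h H : ℕ} {A B A₁ B₁ A' B' : ℝ} (hh : h ≤ H) (hD : DblBound (s + 2) h A B)
    (hD₁ : DblBound (s + 1) h A₁ B₁) (hL : DblBound (s + 2) (H - h) A' B') (hA0 : 0 ≤ A)
    (hB : 0 ≤ B) (hA₁ : 0 ≤ A₁) (hB₁ : 0 ≤ B₁) (hA' : 0 ≤ A') (hPQ : P ⊆ Q) (hm : Mono β Q)
    (hf : Fits β P H) (hb : Blocked ℓ β P) (hsep : Separated ℓ P Q) (hQ : DblFree ℓ Q (s + 2))
    (hγ : γ = fun x => β x / 2 ^ h) (hG : G = heavies ℓ γ P) :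
    ∃ f n : ℝ, 0 ≤ f ∧ f ≤ 2 * n ∧ letters ℓ G ≤ n ∧ 0 ≤ n ∧
      f + (inc ℓ γ (mids ℓ γ G)).card = (inc ℓ γ G).card ∧
      (P.card : ℝ) ≤ A * (letters ℓ P - n) + A' * n + (A₁ + 1) * f + (mids ℓ γ G).card
        + (B + 2 * B₁ + B' / 2 ^ h) * 2 ^ H := by
  have hGg : G ⊆ globals ℓ γ P := hG ▸ heavies_subset
  have hGP : G ⊆ P := hGg.trans globals_subset
  have hgl : ∀ x ∈ G, Earlier ℓ γ P x ∨ Later ℓ γ P x := fun x hx => globals_global (hGg hx)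
  have hs := inc_split_card hGP hgl
  have hLP : lights ℓ γ P ⊆ P := lights_subset.trans globals_subset
  have b1 := dbl_locals hh hD hA0 hB hPQ hm hf hb hsep hQ hγ
  have b2 := dbl_firsts_lasts hh hD₁ hA₁ hB₁ hPQ hm hf hb hsep hQ hGP hγ
  have b3 := hL ℓ γ (lights ℓ γ P) Q (hLP.trans hPQ) (hγ ▸ hm.div h)
    (hγ ▸ (hf.mono (lights_subset.trans globals_subset)).div hh) (fun x hx y hy e e' => by
      simp only [lights, Finset.mem_filter] at hx
      by_contra hne
      exact hx.2 ⟨y, hLP hy, e.symm, e'.symm, Ne.symm hne⟩) (hsep.mono hLP subset_rfl) hQ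
  have e : (2 : ℝ) ^ (H - h) = 2 ^ H / 2 ^ h := by
    rw [eq_div_iff (by positivity), ← pow_add, Nat.sub_add_cancel hh]
  rw [e] at b3
  have c1 : P ⊆ (locals ℓ γ P ∪ lights ℓ γ P) ∪
      ((firsts ℓ γ P G ∪ lasts ℓ γ P G) ∪ mids ℓ γ G) := fun x hx => by
    rw [Finset.union_assoc (firsts ℓ γ P G), ← split_global hGP hgl, hG]
    simp only [heavies, lights, Finset.mem_union, Finset.mem_filter]
    have := mem_locals_or_globals (ℓ := ℓ) (γ := γ) hx
    by_cases hy : ∃ y ∈ P, ℓ y = ℓ x ∧ γ y = γ x ∧ y ≠ x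
    · exact this.imp Or.inl fun h => ⟨h, hy⟩
    · exact Or.inl (this.imp id fun h => ⟨h, hy⟩)
  have c2 : (P.card : ℝ) ≤ ((locals ℓ γ P).card + (lights ℓ γ P).card) + (((firsts ℓ γ P G).card
      + (lasts ℓ γ P G).card) + (mids ℓ γ G).card) := by
    exact_mod_cast (Finset.card_le_card c1).trans ((Finset.card_union_le _ _).trans (add_le_add
      (Finset.card_union_le _ _) ((Finset.card_union_le _ _).trans
        (add_le_add_left (Finset.card_union_le _ _) _))))
  have c3 : letters ℓ G ≤ letters ℓ (globals ℓ γ P) := letters_mono hGg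
  have c3' : letters ℓ (lights ℓ γ P) ≤ letters ℓ (globals ℓ γ P) := letters_mono lights_subset
  have c3r : (letters ℓ (lights ℓ γ P) : ℝ) ≤ letters ℓ (globals ℓ γ P) := by exact_mod_cast c3'
  have h1 := inc_firsts_card_le (ℓ := ℓ) (γ := γ) (P := P) (G := G)
  have h2 := inc_lasts_card_le (ℓ := ℓ) (γ := γ) (P := P) (G := G)
  have c4 : (letters ℓ (locals ℓ γ P) : ℝ) = letters ℓ P - letters ℓ (globals ℓ γ P) := by
    rw [← letters_locals_add_globals (ℓ := ℓ) (γ := γ) (P := P)]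
    push_cast; ring
  rw [c4] at b1
  refine ⟨(inc ℓ γ (firsts ℓ γ P G)).card + (inc ℓ γ (lasts ℓ γ P G)).card,
    letters ℓ (globals ℓ γ P), by positivity, ?_, by exact_mod_cast c3, by positivity,
    by exact_mod_cast hs, ?_⟩
  · exact_mod_cast (show _ ≤ 2 * letters ℓ (globals ℓ γ P) by omega)
  · have := mul_le_mul_of_nonneg_left c3r hA'
    have e2 : B' * (2 ^ H / 2 ^ h : ℝ) = B' / 2 ^ h * 2 ^ H := by ring
    linarith

/-- The heavy incidences are those of an order-`s` sequence. -/
theorem exists_hidden_heavies {s h H : ℕ} (hh : h ≤ H) (hPQ : P ⊆ Q) (hm : Mono β Q)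
    (hf : Fits β P H) (hsep : Separated ℓ P Q) (hQ : DblFree ℓ Q s)
    (hγ : γ = fun x => β x / 2 ^ h) (hG : G = heavies ℓ γ P) :
    ∃ X, inc ℓ γ X = inc ℓ γ G ∧ letters ℓ X = letters ℓ G ∧ Mono γ X ∧ Fits γ X (H - h) ∧
      AltFree ℓ X (s + 2) := by
  have hGP : G ⊆ P := hG ▸ heavies_subset.trans globals_subset
  have hmγ : Mono γ Q := hγ ▸ hm.div h
  obtain ⟨X, hXQ, hX, ha⟩ := exists_hidden hmγ hQ (inc ℓ γ G) fun c hc => by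
    obtain ⟨x, hx, e1, e2⟩ := mem_inc.1 hc
    obtain ⟨y, hy, z, hz, ey, ez, gy, gz, hyz⟩ := (hG ▸ heavy_heavies : Heavy ℓ γ G) x hx
    obtain ⟨w, hw, ew, h1, h2⟩ := hsep y (hGP hy) z (hGP hz) (ey.trans ez.symm) hyz
    exact ⟨y, hPQ (hGP hy), w, hw, z, hPQ (hGP hz), ey.trans e1, ew.trans (ey.trans e1),
      ez.trans e1, gy.trans e2, gz.trans e2, h1, h2⟩
  have hfst : ∀ Y, Y.image ℓ = (inc ℓ γ Y).image Prod.fst := fun Y => by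
    ext a; simp [inc]
  refine ⟨X, hX, by rw [letters, letters, hfst, hfst, hX], hmγ.mono hXQ, ?_, ha⟩
  have hfG : Fits γ G (H - h) := hγ ▸ (hf.mono hGP).div hh
  have hb : ∀ x ∈ X, ∃ y ∈ G, γ y = γ x := fun x hx => by
    have : (ℓ x, γ x) ∈ inc ℓ γ X := mem_inc.2 ⟨x, hx, rfl, rfl⟩
    rw [hX] at this
    obtain ⟨y, hy, -, e⟩ := mem_inc.1 this
    exact ⟨y, hy, e⟩
  intro x hx y hy
  obtain ⟨x', hx', ex⟩ := hb x hx
  obtain ⟨y', hy', ey⟩ := hb y hy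
  rw [← ex, ← ey]
  exact hfG x' hx' y' hy'

/-- The recursion in which all middle occurrences are treated alike. -/
theorem dblBound_step {s h H : ℕ} {A B A₁ B₁ A₂ B₂ A' B' D D' : ℝ} (hh : h ≤ H) (hs : 1 ≤ s)
    (hD : DblBound (s + 2) h A B) (hD₁ : DblBound (s + 1) h A₁ B₁) (hD₂ : DblBound s h A₂ B₂)
    (hL : DblBound (s + 2) (H - h) A' B') (hDS : DSBound (s + 2) (H - h) D D') (hA0 : 0 ≤ A)
    (hB : 0 ≤ B) (hA₁ : 0 ≤ A₁) (hB₁ : 0 ≤ B₁) (hA₂ : 0 ≤ A₂) (hB₂ : 0 ≤ B₂) (hA' : 0 ≤ A')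
    (hD0 : 0 ≤ D) (hA : A' + 2 * A₁ + (A₂ + 2) * D ≤ A) :
    DblBound (s + 2) H A (B + 2 * B₁ + B₂ + B' / 2 ^ h + (A₂ + 2) * (D' / 2 ^ h)) := by
  intro ℓ β P Q hPQ hm hf hb hsep hQ
  obtain ⟨γ, hγ⟩ : ∃ γ : ℤ → ℤ, γ = fun x => β x / 2 ^ h := ⟨_, rfl⟩
  obtain ⟨G, hG⟩ : ∃ G, G = heavies ℓ γ P := ⟨_, rfl⟩
  obtain ⟨f, n, hf0, hfn, hGn, hn0, hsum, hle⟩ := dbl_split hh hD hD₁ hL hA0 hB hA₁ hB₁ hA' hPQ hm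
    hf hb hsep hQ hγ hG
  have hGP : G ⊆ P := hG ▸ heavies_subset.trans globals_subset
  obtain ⟨X, hXi, hXl, hXm, hXf, hXa⟩ := exists_hidden_heavies hh hPQ hm hf hsep hQ hγ hG
  have b1 := hDS ℓ γ X hXm hXf hXa
  rw [hXi, hXl] at b1
  have b2 := dbl_mids hh hs hD₂ hA₂ hB₂ hPQ hm hf hb hsep hQ hGP hγ (subset_refl (mids ℓ γ G))
  have e : (2 : ℝ) ^ (H - h) = 2 ^ H / 2 ^ h := by
    rw [eq_div_iff (by positivity), ← pow_add, Nat.sub_add_cancel hh]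
  rw [e] at b1
  have m0 := mul_le_mul_of_nonneg_left hGn hD0
  have m1 := mul_le_mul_of_nonneg_left (show ((inc ℓ γ G).card : ℝ) ≤
    D * n + D' * (2 ^ H / 2 ^ h) by linarith) (show 0 ≤ A₂ + 2 by linarith)
  have m2 := mul_le_mul_of_nonneg_right hA hn0
  have m3 := mul_le_mul_of_nonneg_left hfn hA₁
  have m4 : 0 ≤ A₂ * f := mul_nonneg hA₂ hf0
  have b6 : ((inc ℓ γ (mids ℓ γ G)).card : ℝ) = (inc ℓ γ G).card - f := by linarith
  rw [b6] at b2
  have e2 : (A₂ + 2) * (D' * (2 ^ H / 2 ^ h : ℝ)) = (A₂ + 2) * (D' / 2 ^ h) * 2 ^ H := by ring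
  linarith

/-- The recursion for odd orders. -/
theorem dblBound_step_odd {s h H : ℕ} {A B A₁ B₁ A₂ B₂ A₃ B₃ A' B' D D' F F' : ℝ} (hh : h ≤ H)
    (hs : 1 ≤ s) (hse : Even s) (hD : DblBound (s + 3) h A B) (hD₁ : DblBound (s + 2) h A₁ B₁)
    (hD₂ : DblBound (s + 1) h A₂ B₂) (hD₃ : DblBound s h A₃ B₃)
    (hL : DblBound (s + 3) (H - h) A' B') (hDS : DSBound (s + 3) (H - h) D D')
    (hFe : FeatherBound (s + 3) (H - h) F F') (hA0 : 0 ≤ A)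
    (hB : 0 ≤ B) (hA₁ : 0 ≤ A₁) (hB₁ : 0 ≤ B₁) (hA₂ : 0 ≤ A₂) (hB₂ : 0 ≤ B₂) (hA₃ : 0 ≤ A₃)
    (hB₃ : 0 ≤ B₃) (hA' : 0 ≤ A') (hD0 : 0 ≤ D) (hF0 : 0 ≤ F)
    (hA : A' + 2 * A₁ + 2 * (A₂ + 2) * F + (A₃ + 2) * D ≤ A) :
    DblBound (s + 3) H A (B + 2 * B₁ + B₂ + 2 * B₃ + B' / 2 ^ h + 2 * (A₂ + 2) * (F' / 2 ^ h)
      + (A₃ + 2) * (D' / 2 ^ h)) := by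
  intro ℓ β P Q hPQ hm hf hb hsep hQ
  obtain ⟨γ, hγ⟩ : ∃ γ : ℤ → ℤ, γ = fun x => β x / 2 ^ h := ⟨_, rfl⟩
  obtain ⟨G, hG⟩ : ∃ G, G = heavies ℓ γ P := ⟨_, rfl⟩
  obtain ⟨f, n, hf0, hfn, hGn, hn0, hsum, hle⟩ := dbl_split (s := s + 1) hh hD hD₁ hL hA0 hB hA₁
    hB₁ hA' hPQ hm hf hb hsep hQ hγ hG
  have hGP : G ⊆ P := hG ▸ heavies_subset.trans globals_subset
  obtain ⟨X, hXi, hXl, hXm, hXf, hXa⟩ := exists_hidden_heavies hh hPQ hm hf hsep hQ hγ hG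
  have b1 := hDS ℓ γ X hXm hXf hXa
  have b2 := hFe ℓ γ X hXm hXf hXa
  have b3 := hFe.hawks_le hXm hXf hXa
  rw [hXi, hXl] at b1 b2 b3
  have hfG : Fits γ G (H - h) := hγ ▸ (hf.mono hGP).div hh
  obtain ⟨M₁, M₂, M₃, hM, hc1, hc2, hp2, hp3⟩ := exists_mids_split (ℓ := ℓ) hfG
  have hM₁ : M₁ ⊆ mids ℓ γ G := by rw [hM]; exact Finset.subset_union_left
  have hM₂ : M₂ ⊆ mids ℓ γ G := by
    rw [hM]; exact Finset.subset_union_left.trans Finset.subset_union_right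
  have hM₃ : M₃ ⊆ mids ℓ γ G := by
    rw [hM]; exact Finset.subset_union_right.trans Finset.subset_union_right
  have hHe : Heavy ℓ γ G := hG ▸ heavy_heavies
  have b4 := dbl_mids (s := s + 1) hh (by omega) hD₂ hA₂ hB₂ hPQ hm hf hb hsep hQ hGP hγ hM₁
  have b5 := dbl_mids_of_hasPairs hh hs hse hD₃ hA₃ hB₃ hPQ hm hf hb hsep hQ hGP hγ hHe hM₂ hp2
  have b6 := dbl_mids_of_hasPairs hh hs hse hD₃ hA₃ hB₃ hPQ hm hf hb hsep hQ hGP hγ hHe hM₃ hp3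
  have e : (2 : ℝ) ^ (H - h) = 2 ^ H / 2 ^ h := by
    rw [eq_div_iff (by positivity), ← pow_add, Nat.sub_add_cancel hh]
  rw [e] at b1 b2 b3
  have c1 : ((inc ℓ γ M₁).card : ℝ) ≤ (doves (inc ℓ γ G)).card + (hawks (inc ℓ γ G)).card := by
    exact_mod_cast hc1
  have c2 : ((inc ℓ γ M₂).card : ℝ) + (inc ℓ γ M₃).card ≤ (inc ℓ γ (mids ℓ γ G)).card := by
    exact_mod_cast hc2
  have c3 : ((mids ℓ γ G).card : ℝ) ≤ M₁.card + (M₂.card + M₃.card) := by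
    rw [hM]
    exact_mod_cast (Finset.card_union_le _ _).trans (add_le_add_right (Finset.card_union_le _ _) _)
  have m0 := mul_le_mul_of_nonneg_left hGn hD0
  have m0' := mul_le_mul_of_nonneg_left hGn hF0
  have m1 := mul_le_mul_of_nonneg_left (show ((inc ℓ γ M₁).card : ℝ) ≤
    2 * (F * n + F' * (2 ^ H / 2 ^ h)) by linarith) (show 0 ≤ A₂ + 2 by linarith)
  have m2 := mul_le_mul_of_nonneg_left (show ((inc ℓ γ M₂).card : ℝ) + (inc ℓ γ M₃).card ≤
    D * n + D' * (2 ^ H / 2 ^ h) - f by linarith) (show 0 ≤ A₃ + 2 by linarith)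
  have m3 := mul_le_mul_of_nonneg_right hA hn0
  have m4 := mul_le_mul_of_nonneg_left hfn hA₁
  have m5 : 0 ≤ A₃ * f := mul_nonneg hA₃ hf0
  have e2 : (A₃ + 2) * (D' * (2 ^ H / 2 ^ h : ℝ)) = (A₃ + 2) * (D' / 2 ^ h) * 2 ^ H := by ring
  have e3 : (A₂ + 2) * (F' * (2 ^ H / 2 ^ h : ℝ)) = (A₂ + 2) * (F' / 2 ^ h) * 2 ^ H := by ring
  linarith

end Step

/-! ### The coefficients -/

theorem fea_succ_succ {s i : ℕ} (hs : 2 ≤ s) (hi : 1 ≤ i) :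
    fea (s + 1) (i + 1) = fea (s + 1) i + fea s (i + 1) + 1 := by
  obtain ⟨s, rfl⟩ := Nat.exists_eq_add_of_le' hs
  obtain ⟨i, rfl⟩ := Nat.exists_eq_add_of_le' hi
  rw [fea]

theorem fea_succ_one {s : ℕ} (hs : 2 ≤ s) : fea (s + 1) 1 = fea s 1 + 1 := by
  obtain ⟨s, rfl⟩ := Nat.exists_eq_add_of_le' hs
  rw [fea]

theorem fea_two (i : ℕ) : fea 2 i = 0 := by rw [fea]

theorem ds_one (i : ℕ) : ds 1 i = 1 := by rw [ds]

theorem ds_two (i : ℕ) : ds 2 i = 2 := by rw [ds]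

theorem dblds_one (i : ℕ) : dblds 1 i = 2 := by rw [dblds]

theorem dblds_two (i : ℕ) : dblds 2 i = 5 := by rw [dblds]

theorem ds_succ_one {s : ℕ} (hs : 2 ≤ s) : ds (s + 1) 1 = 2 * ds s 1 := by
  obtain ⟨s, rfl⟩ := Nat.exists_eq_add_of_le' hs
  rw [ds]

theorem dblds_succ_one {s : ℕ} (hs : 2 ≤ s) : dblds (s + 1) 1 = 2 * (dblds s 1 + 1) := by
  obtain ⟨s, rfl⟩ := Nat.exists_eq_add_of_le' hs
  rw [dblds]

theorem ds_even {s i : ℕ} (hs : 1 ≤ s) (h : s = 1 ∨ Even s) (hi : 1 ≤ i) :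
    ds (s + 2) (i + 1) = 2 * ds (s + 1) (i + 1) + ds s (i + 1) * (ds (s + 2) i - 2) := by
  obtain ⟨s, rfl⟩ := Nat.exists_eq_add_of_le' hs
  obtain ⟨i, rfl⟩ := Nat.exists_eq_add_of_le' hi
  have : s = 0 ∨ Even (s + 3) := by
    rcases h with h | h
    · left; omega
    · right; simpa [Nat.even_add, parity_simps] using h
  rw [show s + 1 + 2 = s + 3 by ring, ds, if_pos this]

theorem dblds_even {s i : ℕ} (hs : 1 ≤ s) (h : s = 1 ∨ Even s) (hi : 1 ≤ i) :
    dblds (s + 2) (i + 1) = dblds (s + 2) i + 2 * dblds (s + 1) (i + 1)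
      + (dblds s (i + 1) + 2) * ds (s + 2) i := by
  obtain ⟨s, rfl⟩ := Nat.exists_eq_add_of_le' hs
  obtain ⟨i, rfl⟩ := Nat.exists_eq_add_of_le' hi
  have : s = 0 ∨ Even (s + 3) := by
    rcases h with h | h
    · left; omega
    · right; simpa [Nat.even_add, parity_simps] using h
  rw [show s + 1 + 2 = s + 3 by ring, dblds, if_pos this]

theorem ds_odd {s i : ℕ} (hs : 2 ≤ s) (h : Even s) (hi : 1 ≤ i) :
    ds (s + 3) (i + 1) = 2 * ds (s + 2) (i + 1) + 2 * ds (s + 1) (i + 1) * fea (s + 3) i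
      + ds s (i + 1) * ds (s + 3) i := by
  obtain ⟨i, rfl⟩ := Nat.exists_eq_add_of_le' hi
  have : ¬ (s = 0 ∨ Even (s + 3)) := by
    rw [not_or]
    exact ⟨by omega, by simpa [Nat.even_add, parity_simps] using h⟩
  rw [ds, if_neg this]

theorem dblds_odd {s i : ℕ} (hs : 2 ≤ s) (h : Even s) (hi : 1 ≤ i) :
    dblds (s + 3) (i + 1) = dblds (s + 3) i + 2 * dblds (s + 2) (i + 1)
      + 2 * (dblds (s + 1) (i + 1) + 2) * fea (s + 3) i
      + (dblds s (i + 1) + 2) * ds (s + 3) i := by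
  obtain ⟨i, rfl⟩ := Nat.exists_eq_add_of_le' hi
  have : ¬ (s = 0 ∨ Even (s + 3)) := by
    rw [not_or]
    exact ⟨by omega, by simpa [Nat.even_add, parity_simps] using h⟩
  rw [dblds, if_neg this]

theorem fea_nonneg (s i : ℕ) : 0 ≤ fea s i := by
  induction s using Nat.strong_induction_on generalizing i with
  | _ s ih =>
    match s with
    | 0 => rw [fea]
    | 1 => rw [fea]
    | 2 => rw [fea]
    | s + 3 =>
      induction i with
      | zero => rw [fea]
      | succ i ihi =>
        rcases Nat.eq_zero_or_pos i with rfl | hi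
        · rw [fea_succ_one (by omega)]
          have := ih (s + 2) (by omega) 1
          omega
        · rw [fea_succ_succ (by omega) hi]
          have h1 := ih (s + 2) (by omega) (i + 1)
          have h2 : 0 ≤ fea (s + 2 + 1) i := ihi
          omega

/-- A recursion step: `s + 2` is covered by the first recursion, `s + 3` with `s` even by the
second one. -/
theorem order_cases (s : ℕ) (hs : 3 ≤ s) :
    (∃ t, s = t + 2 ∧ 1 ≤ t ∧ (t = 1 ∨ Even t)) ∨ ∃ t, s = t + 3 ∧ 2 ≤ t ∧ Even t := by
  rcases Nat.even_or_odd s with h | h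
  · left
    obtain ⟨t, rfl⟩ := Nat.exists_eq_add_of_le' (show 2 ≤ s by omega)
    exact ⟨t, rfl, by omega, Or.inr (by simpa [Nat.even_add] using h)⟩
  · rcases Nat.lt_or_ge s 4 with h4 | h4
    · left; exact ⟨1, by omega, le_rfl, Or.inl rfl⟩
    · right
      obtain ⟨t, rfl⟩ := Nat.exists_eq_add_of_le' (show 3 ≤ s by omega)
      have h5 : Even t := by
        have := Nat.not_even_iff_odd.2 h
        by_contra h6
        exact this (by rw [Nat.even_add]; exact iff_of_false h6 (by decide))
      refine ⟨t, rfl, ?_, h5⟩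
      obtain ⟨r, rfl⟩ := h5
      omega

theorem ds_pos_and_two_mul_le (s : ℕ) : ∀ i, 1 ≤ s → 1 ≤ i →
    1 ≤ ds s i ∧ 2 * ds s i ≤ ds (s + 1) i := by
  induction s using Nat.strong_induction_on with
  | _ s ih =>
    intro i hs hi
    have hpos : 1 ≤ ds s i := by
      rcases Nat.lt_or_ge s 2 with h | h
      · obtain rfl : s = 1 := by omega
        rw [ds_one]
      · obtain ⟨t, rfl⟩ := Nat.exists_eq_add_of_le' h
        have := ih (t + 1) (by omega) i (by omega) hi
        have h2 := this.2
        rw [show t + 1 + 1 = t + 2 by ring] at h2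
        omega
    refine ⟨hpos, ?_⟩
    induction i, hi using Nat.le_induction with
    | base =>
      rcases Nat.lt_or_ge s 2 with h | h
      · obtain rfl : s = 1 := by omega
        rw [ds_one, ds_two]; norm_num
      · rw [ds_succ_one h]
    | succ i hi ihi =>
      have hp' : ∀ i, 1 ≤ i → 1 ≤ ds s i := by
        intro i hi
        rcases Nat.lt_or_ge s 2 with h | h
        · obtain rfl : s = 1 := by omega
          rw [ds_one]
        · obtain ⟨t, rfl⟩ := Nat.exists_eq_add_of_le' h
          have h2 := (ih (t + 1) (by omega) i (by omega) hi)
          have h3 := h2.2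
          rw [show t + 1 + 1 = t + 2 by ring] at h3
          omega
      have h2 := ihi (hp' i hi)
      have h3 := hp' i hi
      rcases Nat.lt_or_ge s 2 with h | h
      · obtain rfl : s = 1 := by omega
        rw [ds_one, ds_two]; norm_num
      · rcases order_cases (s + 1) (by omega) with ⟨t, e, ht, hte⟩ | ⟨t, e, ht, hte⟩
        · obtain rfl : s = t + 1 := by omega
          rw [show t + 1 + 1 = t + 2 by ring] at h2 ⊢
          rw [ds_even ht hte hi]
          have := (ih t (by omega) (i + 1) ht (by omega)).1
          have : 0 ≤ ds t (i + 1) * (ds (t + 2) i - 2) :=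
            mul_nonneg (by omega) (by omega)
          omega
        · obtain rfl : s = t + 2 := by omega
          rw [show t + 2 + 1 = t + 3 by ring] at h2 ⊢
          rw [ds_odd ht hte hi]
          have h4 := (ih t (by omega) (i + 1) (by omega) (by omega)).1
          have h5 := (ih (t + 1) (by omega) (i + 1) (by omega) (by omega)).1
          have h6 : 0 ≤ 2 * ds (t + 1) (i + 1) * fea (t + 3) i :=
            mul_nonneg (by omega) (fea_nonneg _ _)
          have : 0 ≤ ds t (i + 1) * ds (t + 3) i :=
            mul_nonneg (by omega) (by omega)
          omega

theorem ds_pos {s i : ℕ} (hs : 1 ≤ s) (hi : 1 ≤ i) : 1 ≤ ds s i :=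
  (ds_pos_and_two_mul_le s i hs hi).1

theorem two_mul_ds_le {s i : ℕ} (hs : 1 ≤ s) (hi : 1 ≤ i) : 2 * ds s i ≤ ds (s + 1) i :=
  (ds_pos_and_two_mul_le s i hs hi).2

theorem ds_one_le {s i : ℕ} (hs : 1 ≤ s) (hi : 1 ≤ i) : ds s 1 ≤ ds s i := by
  induction s, hs using Nat.le_induction with
  | base => rw [ds_one, ds_one]
  | succ s hs ih =>
    rcases Nat.lt_or_ge s 2 with h | h
    · obtain rfl : s = 1 := by omega
      rw [ds_two, ds_two]
    · rw [ds_succ_one h]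
      have := two_mul_ds_le hs hi
      omega

theorem fea_one_le {s i : ℕ} (hs : 2 ≤ s) (hi : 1 ≤ i) : fea s 1 ≤ fea s i := by
  induction s, hs using Nat.le_induction with
  | base => rw [fea_two, fea_two]
  | succ s hs ih =>
    rw [fea_succ_one hs]
    obtain ⟨i, rfl⟩ := Nat.exists_eq_add_of_le' hi
    rcases Nat.eq_zero_or_pos i with rfl | h
    · rw [fea_succ_one hs]
    · rw [fea_succ_succ hs h]
      have := fea_nonneg (s + 1) i
      omega

theorem dblds_pos_and_le (s : ℕ) : ∀ i, 1 ≤ s → 1 ≤ i →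
    2 ≤ dblds s i ∧ 2 * dblds s i + (if s = 1 then 0 else 2) ≤ dblds (s + 1) i := by
  induction s using Nat.strong_induction_on with
  | _ s ih =>
    intro i hs hi
    have hp' : ∀ i, 1 ≤ i → 2 ≤ dblds s i := by
      intro i hi
      rcases Nat.lt_or_ge s 2 with h | h
      · obtain rfl : s = 1 := by omega
        rw [dblds_one]
      · obtain ⟨t, rfl⟩ := Nat.exists_eq_add_of_le' h
        have h2 := (ih (t + 1) (by omega) i (by omega) hi)
        have h3 := h2.2
        rw [show t + 1 + 1 = t + 2 by ring] at h3
        split_ifs at h3 <;> omega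
    refine ⟨hp' i hi, ?_⟩
    rcases Nat.lt_or_ge s 2 with h | h
    · obtain rfl : s = 1 := by omega
      rw [dblds_one, dblds_two]; norm_num
    rw [if_neg (by omega)]
    induction i, hi using Nat.le_induction with
    | base => rw [dblds_succ_one h]; omega
    | succ i hi h2 =>
      have h3 := hp' i hi
      rcases order_cases (s + 1) (by omega) with ⟨t, e, ht, hte⟩ | ⟨t, e, ht, hte⟩
      · obtain rfl : s = t + 1 := by omega
        rw [show t + 1 + 1 = t + 2 by ring] at h2 ⊢
        rw [dblds_even ht hte hi]
        have h4 := (ih t (by omega) (i + 1) ht (by omega)).1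
        have h5 := ds_pos (s := t + 2) (by omega) hi
        have : 0 ≤ (dblds t (i + 1) + 2) * ds (t + 2) i := mul_nonneg (by omega) (by omega)
        omega
      · obtain rfl : s = t + 2 := by omega
        rw [show t + 2 + 1 = t + 3 by ring] at h2 ⊢
        rw [dblds_odd ht hte hi]
        have h4 := (ih t (by omega) (i + 1) (by omega) (by omega)).1
        have h5 := (ih (t + 1) (by omega) (i + 1) (by omega) (by omega)).1
        have h6 : 0 ≤ 2 * (dblds (t + 1) (i + 1) + 2) * fea (t + 3) i :=
          mul_nonneg (by omega) (fea_nonneg _ _)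
        have h7 := ds_pos (s := t + 3) (by omega) hi
        have : 0 ≤ (dblds t (i + 1) + 2) * ds (t + 3) i := mul_nonneg (by omega) (by omega)
        omega

theorem two_le_dblds {s i : ℕ} (hs : 1 ≤ s) (hi : 1 ≤ i) : 2 ≤ dblds s i :=
  (dblds_pos_and_le s i hs hi).1

theorem two_mul_dblds_le {s i : ℕ} (hs : 1 ≤ s) (hi : 1 ≤ i) :
    2 * dblds s i ≤ dblds (s + 1) i := by
  have := (dblds_pos_and_le s i hs hi).2
  split_ifs at this <;> omega

theorem dblds_one_le {s i : ℕ} (hs : 1 ≤ s) (hi : 1 ≤ i) : dblds s 1 ≤ dblds s i := by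
  induction s, hs using Nat.le_induction with
  | base => rw [dblds_one, dblds_one]
  | succ s hs ih =>
    rcases Nat.lt_or_ge s 2 with h | h
    · obtain rfl : s = 1 := by omega
      rw [dblds_two, dblds_two]
    · rw [dblds_succ_one h]
      have := (dblds_pos_and_le s i hs hi).2
      rw [if_neg (by omega)] at this
      omega

/-! ### The logarithm of Ackermann's function -/

/-- The binary logarithm of Ackermann's function: `acker i j = 2 ^ level i j` for `i, j ≥ 1`. -/
def level (i j : ℕ) : ℕ := Nat.log 2 (acker i j)

theorem acker_one (j : ℕ) : acker 1 j = 2 ^ j := by rw [acker]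

theorem acker_succ_one {i : ℕ} (hi : 1 ≤ i) : acker (i + 1) 1 = 2 := by
  obtain ⟨i, rfl⟩ := Nat.exists_eq_add_of_le' hi
  rw [acker]

theorem acker_succ_succ {i j : ℕ} (hi : 1 ≤ i) (hj : 1 ≤ j) :
    acker (i + 1) (j + 1) = acker (i + 1) j * acker i (acker (i + 1) j) := by
  obtain ⟨i, rfl⟩ := Nat.exists_eq_add_of_le' hi
  obtain ⟨j, rfl⟩ := Nat.exists_eq_add_of_le' hj
  rw [acker]

theorem acker_eq {i j : ℕ} (hi : 1 ≤ i) (hj : 1 ≤ j) : acker i j = 2 ^ level i j := by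
  suffices ∃ e, acker i j = 2 ^ e by
    obtain ⟨e, h⟩ := this
    rw [level, h, Nat.log_pow (by norm_num)]
  induction i, hi using Nat.le_induction generalizing j with
  | base => exact ⟨j, acker_one j⟩
  | succ i hi ih =>
    induction j, hj using Nat.le_induction with
    | base => exact ⟨1, by rw [acker_succ_one hi, pow_one]⟩
    | succ j hj ihj =>
      obtain ⟨e, he⟩ := ihj
      obtain ⟨f, hf⟩ := ih (j := acker (i + 1) j) (he ▸ Nat.one_le_two_pow)
      exact ⟨e + f, by rw [acker_succ_succ hi hj, hf, he, pow_add]⟩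

theorem acker_pos {i j : ℕ} (hi : 1 ≤ i) (hj : 1 ≤ j) : 1 ≤ acker i j := by
  rw [acker_eq hi hj]; exact Nat.one_le_two_pow

theorem level_one (j : ℕ) : level 1 j = j := by
  rw [level, acker_one, Nat.log_pow (by norm_num)]

theorem level_succ_one {i : ℕ} (hi : 1 ≤ i) : level (i + 1) 1 = 1 := by
  rw [level, acker_succ_one hi]
  exact Nat.log_pow (b := 2) (by norm_num) 1

theorem level_succ_succ {i j : ℕ} (hi : 1 ≤ i) (hj : 1 ≤ j) :
    level (i + 1) (j + 1) = level (i + 1) j + level i (acker (i + 1) j) := by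
  have h := acker_succ_succ hi hj
  rw [acker_eq (i := i + 1) (j := j + 1) (by omega) (by omega),
    acker_eq hi (acker_pos (by omega) hj)] at h
  nth_rw 1 [acker_eq (i := i + 1) (j := j) (by omega) hj] at h
  rw [← pow_add] at h
  exact Nat.pow_right_injective le_rfl h

/-- The induction along Ackermann's function: a tree of height at most `c * level (i + 1) (j + 1)`
is cut at height `h = c * level (i + 1) j`, so that `2 ^ h = w ^ c` for `w = acker (i + 1) j`, and
the part above has height at most `c * level i w`. -/
theorem acker_induction (c : ℕ) (R : ℕ → ℕ → ℕ → Prop)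
    (hone : ∀ j H, 1 ≤ j → H ≤ c * j → R 1 j H)
    (hbase : ∀ i H, 1 ≤ i → H ≤ c → R (i + 1) 1 H)
    (hmono : ∀ i j H, 1 ≤ i → 1 ≤ j → R i j H → R i (j + 1) H)
    (hstep : ∀ i j h H, 1 ≤ i → 1 ≤ j → h = c * level (i + 1) j → h ≤ H →
      2 ^ h = acker (i + 1) j ^ c → H - h ≤ c * level i (acker (i + 1) j) → R (i + 1) j h →
        R i (acker (i + 1) j) (H - h) → R (i + 1) (j + 1) H) :
    ∀ i j H, 1 ≤ i → 1 ≤ j → H ≤ c * level i j → R i j H := by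
  intro i j H hi
  induction i, hi using Nat.le_induction generalizing j H with
  | base => intro hj hH; exact hone j H hj (by rwa [level_one] at hH)
  | succ i hi ih =>
    intro hj
    induction j, hj using Nat.le_induction generalizing H with
    | base => intro hH; exact hbase i H hi (by rwa [level_succ_one hi, mul_one] at hH)
    | succ j hj ihj =>
      intro hH
      by_cases hc : H ≤ c * level (i + 1) j
      · exact hmono _ _ _ (by omega) hj (ihj H hc)
      · have hle : H - c * level (i + 1) j ≤ c * level i (acker (i + 1) j) := by
          rw [level_succ_succ hi hj, mul_add] at hH
          omega
        refine hstep i j _ H hi hj rfl (by omega) ?_ hle (ihj _ le_rfl)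
          (ih _ _ (acker_pos (by omega) hj) hle)
        rw [acker_eq (by omega) hj, ← pow_mul, mul_comm]

/-! ### Bounds in terms of Ackermann's function -/

theorem tail_succ (c j : ℝ) (k : ℕ) (hc : 0 ≤ c) (hj : 0 ≤ j) :
    (c * j) ^ (k + 1) + c * (c * (j + 1)) ^ k ≤ (c * (j + 1)) ^ (k + 1) := by
  have h : (c * j) ^ k ≤ (c * (j + 1)) ^ k := by gcongr; linarith
  have h2 := mul_le_mul_of_nonneg_right h (mul_nonneg hc hj)
  rw [pow_succ, pow_succ]
  linarith

/-- The term contributed by the contracted sequence: with `2 ^ h = w ^ c` blocks to a group, the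
large argument `w` of the induction hypothesis cancels. -/
theorem tail_div_le {c w h k : ℕ} (j : ℝ) (hj : 0 ≤ j) (hw : 1 ≤ w) (hh : 2 ^ h = w ^ c)
    (hk : k + 1 ≤ c) :
    ((c : ℝ) * w) ^ (k + 1) / 2 ^ h ≤ c * (c * (j + 1)) ^ k := by
  have h1 : (2 : ℝ) ^ h = (w : ℝ) ^ c := by exact_mod_cast hh
  have hw' : (1 : ℝ) ≤ w := by exact_mod_cast hw
  have h2 : (w : ℝ) ^ (k + 1) ≤ w ^ c := pow_le_pow_right₀ hw' hk
  have h3 : ((c : ℝ)) ^ k ≤ (c * (j + 1)) ^ k := by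
    gcongr
    nlinarith [Nat.cast_nonneg (α := ℝ) c]
  rw [h1, div_le_iff₀ (by positivity), mul_pow]
  have h4 : (c : ℝ) ^ (k + 1) ≤ c * (c * (j + 1)) ^ k := by
    rw [pow_succ']; gcongr
  gcongr

theorem pow_add_pow_le (h : ℝ) (k : ℕ) (h0 : 0 ≤ h) : h ^ (k + 1) + h ^ k ≤ (h + 1) ^ (k + 1) := by
  have : h ^ k ≤ (h + 1) ^ k := by gcongr; linarith
  rw [pow_succ, pow_succ]
  nlinarith

theorem featherBound_zero (s : ℕ) : FeatherBound s 0 0 0 := fun ℓ β P hm hf ha => by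
  have := featherBound_of_level_one s ℓ β P hm
    (fun x hx y hy => ediv_eq_of_le (Nat.zero_le 1) (hf x hx y hy)) ha
  simpa using this

theorem dsBound_zero (s : ℕ) : DSBound s 0 1 0 := fun ℓ β P hm hf ha => by
  have : inc ℓ β P ⊆ (P.image ℓ).biUnion fun a => (P.image β).image fun b => (a, b) := by
    intro ⟨a, b⟩ hc
    obtain ⟨x, hx, rfl, rfl⟩ := mem_inc.1 hc
    simp only [Finset.mem_biUnion, Finset.mem_image]
    exact ⟨ℓ x, ⟨x, hx, rfl⟩, β x, ⟨x, hx, rfl⟩, rfl⟩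
  have h1 := (Finset.card_le_card this).trans (Finset.card_biUnion_le_card_mul _ _ 1 fun a _ =>
    Finset.card_image_le.trans (hf.card_image_le.trans_eq (pow_zero 2)))
  rw [zero_mul, add_zero, one_mul]
  rw [mul_one] at h1
  exact_mod_cast h1

theorem dblBound_zero (s : ℕ) : DblBound s 0 1 0 := fun ℓ β P Q hPQ hm hf hb hsep hQ => by
  have h1 : P.card = letters ℓ P := by
    refine (Finset.card_image_of_injOn fun x hx y hy e => ?_).symm
    exact hb x hx y hy e (by simpa using hf x hx y hy)
  rw [zero_mul, add_zero, one_mul, h1]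

/-- Trees of height `H`, with binary cuts just below the root: the coefficients with second index
one. -/
theorem featherBound_row_one {s : ℕ} (hs : 2 ≤ s) (H : ℕ) :
    FeatherBound s H (fea s 1) ((fea s 1 + 1) * (H : ℝ) ^ (s - 2)) := by
  induction s, hs using Nat.le_induction generalizing H with
  | base => exact (featherBound_two H).weaken (by simp [fea_two]) (by simp [fea_two])
  | succ s hs ih =>
    obtain ⟨k, rfl⟩ := Nat.exists_eq_add_of_le' hs
    have hn : (0 : ℝ) ≤ fea (k + 2) 1 := by exact_mod_cast fea_nonneg _ _
    have e : (fea (k + 2 + 1) 1 : ℝ) = fea (k + 2) 1 + 1 := by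
      rw [fea_succ_one hs]; push_cast; rfl
    rw [e]
    induction H with
    | zero => exact (featherBound_zero _).weaken (by positivity) (by positivity)
    | succ H ihH =>
      refine (featherBound_step (Nat.le_succ H) ihH (ih H) (A' := 0) (B' := 0)
        (by rw [Nat.succ_sub (le_refl H), Nat.sub_self]; exact featherBound_of_level_one _)
        (by positivity) (by positivity) hn (by positivity) (by linarith)).weaken le_rfl ?_
      have := pow_add_pow_le H k (Nat.cast_nonneg H)
      rw [show k + 2 + 1 - 2 = k + 1 by omega, show k + 2 - 2 = k by omega]
      push_cast
      have h2 : (0 : ℝ) ≤ (H : ℝ) ^ k := by positivity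
      have h3 := mul_le_mul_of_nonneg_left this (show 0 ≤ (fea (k + 2) 1 : ℝ) + 1 + 1 by linarith)
      rw [zero_div]
      linarith

theorem dsBound_row_one {s : ℕ} (hs : 1 ≤ s) (H : ℕ) :
    DSBound s H (ds s 1) (ds s 1 * (H : ℝ) ^ (s - 2)) := by
  induction s, hs using Nat.le_induction generalizing H with
  | base => exact (dsBound_one (H := H)).weaken (by simp [ds_one]) (by simp [ds_one])
  | succ s hs ih =>
    rcases Nat.lt_or_ge s 2 with h | h
    · obtain rfl : s = 1 := by omega
      exact (dsBound_two (H := H)).weaken (by simp [ds_two]) (by simp [ds_two])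
    obtain ⟨k, rfl⟩ := Nat.exists_eq_add_of_le' h
    have hn : (1 : ℝ) ≤ ds (k + 2) 1 := by exact_mod_cast ds_pos hs le_rfl
    have e : (ds (k + 2 + 1) 1 : ℝ) = 2 * ds (k + 2) 1 := by
      rw [ds_succ_one h]; push_cast; rfl
    rw [e]
    induction H with
    | zero => exact (dsBound_zero _).weaken (by linarith) (by positivity)
    | succ H ihH =>
      refine (dsBound_step_two_groups (s := k + 1) ihH (ih H) (by positivity) (by positivity)
        (by positivity) (by positivity) le_rfl).weaken le_rfl ?_
      have := pow_add_pow_le H k (Nat.cast_nonneg H)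
      rw [show k + 2 + 1 - 2 = k + 1 by omega, show k + 2 - 2 = k by omega]
      push_cast
      nlinarith

theorem dblBound_row_one {s : ℕ} (hs : 1 ≤ s) (H : ℕ) :
    DblBound s H (dblds s 1) (dblds s 1 * (H : ℝ) ^ (s - 2)) := by
  induction s, hs using Nat.le_induction generalizing H with
  | base => exact (dblBound_one (H := H)).weaken (by simp [dblds_one]) (by simp [dblds_one])
  | succ s hs ih =>
    rcases Nat.lt_or_ge s 2 with h | h
    · obtain rfl : s = 1 := by omega
      exact (dblBound_two (H := H)).weaken (by simp [dblds_two]) (by simp [dblds_two])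
    obtain ⟨k, rfl⟩ := Nat.exists_eq_add_of_le' h
    have hn : (2 : ℝ) ≤ dblds (k + 2) 1 := by exact_mod_cast two_le_dblds hs le_rfl
    have e : (dblds (k + 2 + 1) 1 : ℝ) = 2 * (dblds (k + 2) 1 + 1) := by
      rw [dblds_succ_one h]; push_cast; rfl
    rw [e]
    induction H with
    | zero => exact (dblBound_zero _).weaken (by linarith) (by positivity)
    | succ H ihH =>
      refine (dblBound_step_two_groups (s := k + 1) ihH (ih H) (by positivity) (by positivity)
        (by positivity) (by positivity) le_rfl).weaken le_rfl ?_
      have := pow_add_pow_le H k (Nat.cast_nonneg H)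
      have h2 : (0 : ℝ) ≤ (H : ℝ) ^ k := by positivity
      rw [show k + 2 + 1 - 2 = k + 1 by omega, show k + 2 - 2 = k by omega]
      push_cast
      nlinarith

/-- The number of dove feathers. The summand `1` in the coefficient of the number of blocks
accounts for the order `2`, where the coefficient of the number of letters vanishes. -/
theorem featherBound_acker {c : ℕ} (hc : 1 ≤ c) {s : ℕ} (hs : 2 ≤ s) (hsc : s ≤ c + 2) :
    ∀ i j H, 1 ≤ i → 1 ≤ j → H ≤ c * level i j →
      FeatherBound s H (fea s i) ((fea s i + 1) * ((c : ℝ) * j) ^ (s - 2)) := by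
  have hc' : (1 : ℝ) ≤ c := by exact_mod_cast hc
  induction s, hs using Nat.le_induction with
  | base =>
    intro i j H _ _ _
    exact (featherBound_two H).weaken (by simp [fea_two]) (by simp [fea_two])
  | succ s hs ih =>
    specialize ih (by omega)
    obtain ⟨k, rfl⟩ := Nat.exists_eq_add_of_le' hs
    have hn : ∀ s i, (0 : ℝ) ≤ fea s i := fun s i => by exact_mod_cast fea_nonneg s i
    rw [show k + 2 + 1 - 2 = k + 1 by omega]
    rw [show k + 2 - 2 = k by omega] at ih
    apply acker_induction c
    · intro j H hj hH
      have hH' : (H : ℝ) ≤ c * j := by exact_mod_cast hH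
      have := hn (k + 2 + 1) 1
      refine (featherBound_row_one (by omega) H).weaken le_rfl ?_
      rw [show k + 2 + 1 - 2 = k + 1 by omega]
      gcongr
    · intro i H hi hH
      have hH' : (H : ℝ) ≤ c := by exact_mod_cast hH
      have := hn (k + 2 + 1) 1
      have h1 : (fea (k + 2 + 1) 1 : ℝ) ≤ fea (k + 2 + 1) (i + 1) := by
        exact_mod_cast fea_one_le (by omega) (by omega)
      refine (featherBound_row_one (by omega) H).weaken h1 ?_
      rw [show k + 2 + 1 - 2 = k + 1 by omega, Nat.cast_one, mul_one]
      gcongr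
      linarith
    · intro i j H _ _ h
      have := hn (k + 2 + 1) i
      refine h.weaken le_rfl ?_
      gcongr
      simp
    · intro i j h H hi hj hh hhH h2 hHh hD hD'
      have h0 := hn (k + 2) (i + 1)
      have h1 := hn (k + 2 + 1) i
      have hj' : (1 : ℝ) ≤ j := by exact_mod_cast hj
      have e : (fea (k + 2 + 1) (i + 1) : ℝ) = fea (k + 2 + 1) i + fea (k + 2) (i + 1) + 1 := by
        rw [fea_succ_succ hs hi]; push_cast; rfl
      have hD₁ := (ih (i + 1) j h (by omega) hj hh.le)
      rw [e] at hD ⊢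
      refine (featherBound_step hhH hD hD₁ hD' (by positivity) (by positivity) h0 (by positivity)
        le_rfl).weaken le_rfl ?_
      have t1 := tail_succ c j k (by linarith) (by linarith)
      have t2 := tail_div_le (k := k) (j : ℝ) (by linarith) (acker_pos (by omega) hj) h2 (by omega)
      have t3 : ((c : ℝ) * j) ^ k ≤ (c * (j + 1)) ^ k := by gcongr; linarith
      rw [mul_div_assoc]
      push_cast
      set X : ℝ := (c * (j + 1)) ^ k
      have hX : 0 ≤ X := by positivity
      have t4 : ((c : ℝ) * j) ^ k ≤ c * X := by nlinarith
      have u1 := mul_le_mul_of_nonneg_left t2 (show 0 ≤ (fea (k + 2 + 1) i : ℝ) + 1 by linarith)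
      have u2 := mul_le_mul_of_nonneg_left t4 (show 0 ≤ (fea (k + 2) (i + 1) : ℝ) + 1 by linarith)
      have u3 := mul_le_mul_of_nonneg_left t1
        (show 0 ≤ (fea (k + 2 + 1) i : ℝ) + fea (k + 2) (i + 1) + 1 + 1 by linarith)
      linarith

theorem pow_le_pow_of_one_le_right {x y : ℝ} (hx : 0 ≤ x) (hxy : x ≤ y) (hy : 1 ≤ y) {k l : ℕ}
    (h : l ≤ k) : x ^ l ≤ y ^ k :=
  (pow_le_pow_left₀ hx hxy l).trans (pow_le_pow_right₀ hy h)

/-- The number of incidences. For `c ≥ 4` the lower-order terms of the recursion fit into the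
coefficient of the number of blocks. -/
theorem dsBound_acker {c : ℕ} (hc : 4 ≤ c) (s : ℕ) : 1 ≤ s → s ≤ c + 2 →
    ∀ i j H, 1 ≤ i → 1 ≤ j → H ≤ c * level i j →
      DSBound s H (ds s i) (ds s i * ((c : ℝ) * j) ^ (s - 2)) := by
  have hc' : (4 : ℝ) ≤ c := by exact_mod_cast hc
  induction s using Nat.strong_induction_on with
  | _ s ih =>
  intro hs hsc
  rcases Nat.lt_or_ge s 3 with hs3 | hs3
  · intro i j H _ _ _
    obtain rfl | rfl : s = 1 ∨ s = 2 := by omega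
    · exact (dsBound_one (H := H)).weaken (by simp [ds_one]) (by simp [ds_one])
    · exact (dsBound_two (H := H)).weaken (by simp [ds_two]) (by simp [ds_two])
  obtain ⟨k, rfl⟩ := Nat.exists_eq_add_of_le' hs3
  have hn : ∀ s i, 1 ≤ s → 1 ≤ i → (1 : ℝ) ≤ ds s i := fun s i h h' => by
    exact_mod_cast ds_pos h h'
  rw [show k + 3 - 2 = k + 1 by omega]
  apply acker_induction c
  · intro j H hj hH
    have hH' : (H : ℝ) ≤ c * j := by exact_mod_cast hH
    have := hn (k + 3) 1 (by omega) le_rfl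
    refine (dsBound_row_one (by omega) H).weaken le_rfl ?_
    rw [show k + 3 - 2 = k + 1 by omega]
    gcongr
  · intro i H hi hH
    have hH' : (H : ℝ) ≤ c := by exact_mod_cast hH
    have := hn (k + 3) 1 (by omega) le_rfl
    have h1 : (ds (k + 3) 1 : ℝ) ≤ ds (k + 3) (i + 1) := by
      exact_mod_cast ds_one_le (by omega) (by omega)
    refine (dsBound_row_one (by omega) H).weaken h1 ?_
    rw [show k + 3 - 2 = k + 1 by omega, Nat.cast_one, mul_one]
    gcongr
    linarith
  · intro i j H hi _ h
    have := hn (k + 3) i (by omega) hi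
    refine h.weaken le_rfl ?_
    gcongr
    simp
  · intro i j h H hi hj hh hhH h2 hHh hD hD'
    have hj' : (1 : ℝ) ≤ j := by exact_mod_cast hj
    have hlow : ∀ t, 1 ≤ t → t < k + 3 → DSBound t h (ds t (i + 1))
        (ds t (i + 1) * ((c : ℝ) * (j + 1)) ^ k) := fun t ht htk =>
      (ih t htk ht (by omega) (i + 1) j h (by omega) hj hh.le).weaken le_rfl (by
        have := hn t (i + 1) ht (by omega)
        refine mul_le_mul_of_nonneg_left ?_ (by linarith)
        exact pow_le_pow_of_one_le_right (by positivity) (by nlinarith) (by nlinarith) (by omega))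
    have t1 := tail_succ c j k (by linarith) (by linarith)
    have t2 := tail_div_le (k := k) (j : ℝ) (by linarith) (acker_pos (by omega) hj) h2 (by omega)
    have m2 : 2 * (ds (k + 1) (i + 1) : ℝ) ≤ ds (k + 2) (i + 1) := by
      exact_mod_cast two_mul_ds_le (by omega) (by omega)
    have n0 := hn (k + 3) (i + 1) (by omega) (by omega)
    have n1 := hn (k + 2) (i + 1) (by omega) (by omega)
    have n2 := hn (k + 1) (i + 1) (by omega) (by omega)
    have n3 := hn (k + 3) i (by omega) hi
    push_cast
    set X : ℝ := (c * (j + 1)) ^ k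
    have hX : 0 ≤ X := by positivity
    have hcX : 4 * X ≤ c * X := by gcongr
    rcases order_cases (k + 3) hs3 with ⟨t, e, ht, hte⟩ | ⟨t, e, ht, hte⟩
    · obtain rfl : t = k + 1 := by omega
      have e := ds_even ht hte hi
      rw [show k + 1 + 2 = k + 3 by ring, show k + 1 + 1 = k + 2 by ring] at e
      have e' : (ds (k + 3) (i + 1) : ℝ) = 2 * ds (k + 2) (i + 1) +
        ds (k + 1) (i + 1) * (ds (k + 3) i - 2) := by exact_mod_cast e
      refine (dsBound_step (s := k + 1) hhH hD (hlow _ (by omega) (by omega))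
        (hlow _ (by omega) (by omega)) hD' (by positivity) (by positivity)
        (by positivity) (by positivity) (by linarith) (by linarith) e'.ge).weaken le_rfl ?_
      rw [mul_div_assoc]
      have u1 := mul_le_mul_of_nonneg_left t1 (show 0 ≤ (ds (k + 3) (i + 1) : ℝ) by linarith)
      have u2 := mul_le_mul_of_nonneg_left t2
        (show 0 ≤ (ds (k + 1) (i + 1) : ℝ) * ds (k + 3) i by positivity)
      have u3 : (ds (k + 3) (i + 1) : ℝ) * (c * X) = (2 * ds (k + 2) (i + 1) +
        ds (k + 1) (i + 1) * (ds (k + 3) i - 2)) * (c * X) := by rw [← e']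
      have u4 := mul_le_mul_of_nonneg_right m2 (show 0 ≤ 2 * (c * X) - 2 * X by linarith)
      have u5 := mul_le_mul_of_nonneg_left hcX (show 0 ≤ (ds (k + 1) (i + 1) : ℝ) by linarith)
      have u6 : 0 ≤ (ds (k + 1) (i + 1) : ℝ) * X := by positivity
      linarith
    · obtain ⟨l, rfl⟩ : ∃ l, k = l + 1 := ⟨k - 1, by omega⟩
      obtain rfl : t = l + 1 := by omega
      have e := ds_odd ht hte hi
      rw [show l + 1 + 2 = l + 3 by ring, show l + 1 + 1 = l + 2 by ring] at e
      have e' : (ds (l + 1 + 3) (i + 1) : ℝ) = 2 * ds (l + 3) (i + 1) +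
        2 * ds (l + 2) (i + 1) * fea (l + 1 + 3) i + ds (l + 1) (i + 1) * ds (l + 1 + 3) i := by
        exact_mod_cast e
      have hF := featherBound_acker (c := c) (by omega) (s := l + 1 + 3) (by omega) hsc i
        (acker (i + 1) j) (H - h) hi (acker_pos (by omega) hj) hHh
      rw [show l + 1 + 3 - 2 = l + 1 + 1 by omega] at hF
      have m3 : 2 * (ds (l + 1) (i + 1) : ℝ) ≤ ds (l + 2) (i + 1) := by
        exact_mod_cast two_mul_ds_le (by omega) (by omega)
      have n4 := hn (l + 1) (i + 1) (by omega) (by omega)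
      have n5 : (0 : ℝ) ≤ fea (l + 1 + 3) i := by exact_mod_cast fea_nonneg _ _
      refine (dsBound_step_odd (s := l + 1) hhH hte hD (hlow _ (by omega) (by omega))
        (hlow _ (by omega) (by omega)) (hlow _ (by omega) (by omega)) hF hD' (by positivity)
        (by positivity) (by positivity) (by positivity) (by positivity) (by positivity)
        (by positivity) (by positivity) e'.ge).weaken le_rfl ?_
      rw [mul_div_assoc, mul_div_assoc]
      have u1 := mul_le_mul_of_nonneg_left t1 (show 0 ≤ (ds (l + 1 + 3) (i + 1) : ℝ) by linarith)
      have u2 := mul_le_mul_of_nonneg_left t2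
        (show 0 ≤ (ds (l + 1) (i + 1) : ℝ) * ds (l + 1 + 3) i by positivity)
      have u2' := mul_le_mul_of_nonneg_left t2
        (show 0 ≤ 2 * (ds (l + 2) (i + 1) : ℝ) * (fea (l + 1 + 3) i + 1) by positivity)
      have u3 : (ds (l + 1 + 3) (i + 1) : ℝ) * (c * X) = (2 * ds (l + 3) (i + 1) +
        2 * ds (l + 2) (i + 1) * fea (l + 1 + 3) i + ds (l + 1) (i + 1) * ds (l + 1 + 3) i)
          * (c * X) := by rw [← e']
      have u4 := mul_le_mul_of_nonneg_right m2 (show 0 ≤ 2 * (c * X) - 2 * X by linarith)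
      have u5 := mul_le_mul_of_nonneg_left hcX (show 0 ≤ (ds (l + 2) (i + 1) : ℝ) by linarith)
      have u6 : 0 ≤ (ds (l + 2) (i + 1) : ℝ) * X := by positivity
      have u7 := mul_le_mul_of_nonneg_right m3 hX
      linarith

/-- The size of a separated set of occurrences in a double DS sequence. -/
theorem dblBound_acker {c : ℕ} (hc : 4 ≤ c) (s : ℕ) : 1 ≤ s → s ≤ c + 2 →
    ∀ i j H, 1 ≤ i → 1 ≤ j → H ≤ c * level i j →
      DblBound s H (dblds s i) (dblds s i * ((c : ℝ) * j) ^ (s - 2)) := by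
  have hc' : (4 : ℝ) ≤ c := by exact_mod_cast hc
  induction s using Nat.strong_induction_on with
  | _ s ih =>
  intro hs hsc
  rcases Nat.lt_or_ge s 3 with hs3 | hs3
  · intro i j H _ _ _
    obtain rfl | rfl : s = 1 ∨ s = 2 := by omega
    · exact (dblBound_one (H := H)).weaken (by simp [dblds_one]) (by simp [dblds_one])
    · exact (dblBound_two (H := H)).weaken (by simp [dblds_two]) (by simp [dblds_two])
  obtain ⟨k, rfl⟩ := Nat.exists_eq_add_of_le' hs3
  have hn : ∀ s i, 1 ≤ s → 1 ≤ i → (2 : ℝ) ≤ dblds s i := fun s i h h' => by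
    exact_mod_cast two_le_dblds h h'
  have hds := dsBound_acker hc (k + 3) (by omega) hsc
  rw [show k + 3 - 2 = k + 1 by omega] at hds ⊢
  apply acker_induction c
  · intro j H hj hH
    have hH' : (H : ℝ) ≤ c * j := by exact_mod_cast hH
    have := hn (k + 3) 1 (by omega) le_rfl
    refine (dblBound_row_one (by omega) H).weaken le_rfl ?_
    rw [show k + 3 - 2 = k + 1 by omega]
    gcongr
  · intro i H hi hH
    have hH' : (H : ℝ) ≤ c := by exact_mod_cast hH
    have := hn (k + 3) 1 (by omega) le_rfl
    have h1 : (dblds (k + 3) 1 : ℝ) ≤ dblds (k + 3) (i + 1) := by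
      exact_mod_cast dblds_one_le (by omega) (by omega)
    refine (dblBound_row_one (by omega) H).weaken h1 ?_
    rw [show k + 3 - 2 = k + 1 by omega, Nat.cast_one, mul_one]
    gcongr
    linarith
  · intro i j H hi _ h
    have := hn (k + 3) i (by omega) hi
    refine h.weaken le_rfl ?_
    gcongr
    simp
  · intro i j h H hi hj hh hhH h2 hHh hD hD'
    have hj' : (1 : ℝ) ≤ j := by exact_mod_cast hj
    have hlow : ∀ t, 1 ≤ t → t < k + 3 → DblBound t h (dblds t (i + 1))
        (dblds t (i + 1) * ((c : ℝ) * (j + 1)) ^ k) := fun t ht htk =>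
      (ih t htk ht (by omega) (i + 1) j h (by omega) hj hh.le).weaken le_rfl (by
        have := hn t (i + 1) ht (by omega)
        refine mul_le_mul_of_nonneg_left ?_ (by linarith)
        exact pow_le_pow_of_one_le_right (by positivity) (by nlinarith) (by nlinarith) (by omega))
    have t1 := tail_succ c j k (by linarith) (by linarith)
    have t2 := tail_div_le (k := k) (j : ℝ) (by linarith) (acker_pos (by omega) hj) h2 (by omega)
    have hS := hds i (acker (i + 1) j) (H - h) hi (acker_pos (by omega) hj) hHh
    have m2 : 2 * (dblds (k + 1) (i + 1) : ℝ) ≤ dblds (k + 2) (i + 1) := by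
      exact_mod_cast two_mul_dblds_le (by omega) (by omega)
    have n0 := hn (k + 3) (i + 1) (by omega) (by omega)
    have n1 := hn (k + 2) (i + 1) (by omega) (by omega)
    have n2 := hn (k + 1) (i + 1) (by omega) (by omega)
    have n3 := hn (k + 3) i (by omega) hi
    have n6 : (1 : ℝ) ≤ ds (k + 3) i := by exact_mod_cast ds_pos (by omega) hi
    push_cast
    set X : ℝ := (c * (j + 1)) ^ k
    have hX : 0 ≤ X := by positivity
    have hcX : 4 * X ≤ c * X := by gcongr
    have u0 := mul_le_mul_of_nonneg_left t2 (show 0 ≤ (dblds (k + 3) i : ℝ) by linarith)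
    have u1 := mul_le_mul_of_nonneg_left t1 (show 0 ≤ (dblds (k + 3) (i + 1) : ℝ) by linarith)
    rcases order_cases (k + 3) hs3 with ⟨t, e, ht, hte⟩ | ⟨t, e, ht, hte⟩
    · obtain rfl : t = k + 1 := by omega
      have e := dblds_even ht hte hi
      rw [show k + 1 + 2 = k + 3 by ring, show k + 1 + 1 = k + 2 by ring] at e
      have e' : (dblds (k + 3) (i + 1) : ℝ) = dblds (k + 3) i + 2 * dblds (k + 2) (i + 1) +
        (dblds (k + 1) (i + 1) + 2) * ds (k + 3) i := by exact_mod_cast e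
      refine (dblBound_step (s := k + 1) hhH (by omega) hD (hlow _ (by omega) (by omega))
        (hlow _ (by omega) (by omega)) hD' hS (by positivity) (by positivity) (by positivity)
        (by positivity) (by positivity) (by positivity) (by positivity) (by positivity)
        e'.ge).weaken le_rfl ?_
      rw [mul_div_assoc, mul_div_assoc]
      have u2 := mul_le_mul_of_nonneg_left t2
        (show 0 ≤ ((dblds (k + 1) (i + 1) : ℝ) + 2) * ds (k + 3) i by positivity)
      have u3 : (dblds (k + 3) (i + 1) : ℝ) * (c * X) = (dblds (k + 3) i
        + 2 * dblds (k + 2) (i + 1) + (dblds (k + 1) (i + 1) + 2) * ds (k + 3) i) * (c * X) := by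
        rw [← e']
      have u4 := mul_le_mul_of_nonneg_right m2 hX
      have u5 := mul_le_mul_of_nonneg_left hcX (show 0 ≤ (dblds (k + 2) (i + 1) : ℝ) by linarith)
      have u6 : 0 ≤ (dblds (k + 2) (i + 1) : ℝ) * X := by positivity
      linarith
    · obtain ⟨l, rfl⟩ : ∃ l, k = l + 1 := ⟨k - 1, by omega⟩
      obtain rfl : t = l + 1 := by omega
      have e := dblds_odd ht hte hi
      rw [show l + 1 + 2 = l + 3 by ring, show l + 1 + 1 = l + 2 by ring] at e
      have e' : (dblds (l + 1 + 3) (i + 1) : ℝ) = dblds (l + 1 + 3) i + 2 * dblds (l + 3) (i + 1)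
        + 2 * (dblds (l + 2) (i + 1) + 2) * fea (l + 1 + 3) i
        + (dblds (l + 1) (i + 1) + 2) * ds (l + 1 + 3) i := by
        exact_mod_cast e
      have hF := featherBound_acker (c := c) (by omega) (s := l + 1 + 3) (by omega) hsc i
        (acker (i + 1) j) (H - h) hi (acker_pos (by omega) hj) hHh
      rw [show l + 1 + 3 - 2 = l + 1 + 1 by omega] at hF
      have m3 : 2 * (dblds (l + 1) (i + 1) : ℝ) ≤ dblds (l + 2) (i + 1) := by
        exact_mod_cast two_mul_dblds_le (by omega) (by omega)
      have m4 : 2 * (dblds (l + 2) (i + 1) : ℝ) + 2 ≤ dblds (l + 3) (i + 1) := by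
        have := (dblds_pos_and_le (l + 2) (i + 1) (by omega) (by omega)).2
        rw [if_neg (by omega)] at this
        exact_mod_cast this
      have n4 := hn (l + 1) (i + 1) (by omega) (by omega)
      have n5 : (0 : ℝ) ≤ fea (l + 1 + 3) i := by exact_mod_cast fea_nonneg _ _
      refine (dblBound_step_odd (s := l + 1) hhH (by omega) hte hD (hlow _ (by omega) (by omega))
        (hlow _ (by omega) (by omega)) (hlow _ (by omega) (by omega)) hD' hS hF (by positivity)
        (by positivity) (by positivity) (by positivity) (by positivity) (by positivity)
        (by positivity) (by positivity) (by positivity) (by positivity) (by positivity)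
        e'.ge).weaken le_rfl ?_
      rw [mul_div_assoc, mul_div_assoc, mul_div_assoc]
      have u2 := mul_le_mul_of_nonneg_left t2
        (show 0 ≤ ((dblds (l + 1) (i + 1) : ℝ) + 2) * ds (l + 1 + 3) i by positivity)
      have u2' := mul_le_mul_of_nonneg_left t2
        (show 0 ≤ 2 * ((dblds (l + 2) (i + 1) : ℝ) + 2) * (fea (l + 1 + 3) i + 1) by positivity)
      have u3 : (dblds (l + 1 + 3) (i + 1) : ℝ) * (c * X) = (dblds (l + 1 + 3) i
        + 2 * dblds (l + 3) (i + 1) + 2 * (dblds (l + 2) (i + 1) + 2) * fea (l + 1 + 3) i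
        + (dblds (l + 1) (i + 1) + 2) * ds (l + 1 + 3) i) * (c * X) := by
        rw [← e']
      have u4 := mul_le_mul_of_nonneg_right m4 (show 0 ≤ 2 * (c * X) - 2 * X by linarith)
      have u5 := mul_le_mul_of_nonneg_left hcX (show 0 ≤ (dblds (l + 2) (i + 1) : ℝ) by linarith)
      have u6 := mul_le_mul_of_nonneg_right (hn (l + 2) (i + 1) (by omega) (by omega)) hX
      have u7 := mul_le_mul_of_nonneg_right m3 hX
      linarith

/-! ### From lists to sets of positions -/

/-- The flattened list of blocks, where every symbol is paired with the index of its block; the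
indices start at `p`. -/
def tag : ℕ → List (List ℕ) → List (ℕ × ℕ)
  | _, [] => []
  | p, b :: B => b.map (fun a => (a, p)) ++ tag (p + 1) B

theorem tag_map_fst (p : ℕ) (B : List (List ℕ)) : (tag p B).map Prod.fst = B.flatten := by
  induction B generalizing p with
  | nil => rfl
  | cons b B ih =>
    rw [tag, List.map_append, ih, List.flatten_cons, List.map_map]
    simp [Function.comp_def]

theorem snd_of_mem_tag {p : ℕ} {B : List (List ℕ)} {x : ℕ × ℕ} (h : x ∈ tag p B) :
    p ≤ x.2 ∧ x.2 < p + B.length := by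
  induction B generalizing p with
  | nil => simp [tag] at h
  | cons b B ih =>
    rw [tag, List.mem_append, List.mem_map] at h
    rw [List.length_cons]
    rcases h with ⟨a, -, rfl⟩ | h
    · simp
    · have := ih h
      omega

theorem mem_tag {p q a : ℕ} {B : List (List ℕ)} : (a, p + q) ∈ tag p B ↔ a ∈ B.getD q [] := by
  induction B generalizing p q with
  | nil => simp [tag]
  | cons b B ih =>
    rw [tag, List.mem_append, List.mem_map]
    cases q with
    | zero =>
      have : (a, p) ∉ tag (p + 1) B := fun h => by
        have := snd_of_mem_tag h
        simp only at this
        omega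
      simp [this]
    | succ q =>
      rw [show p + (q + 1) = p + 1 + q by ring, ih]
      simp only [List.getD_cons_succ, Prod.mk.injEq, or_iff_right_iff_imp]
      rintro ⟨_, -, -, h⟩
      omega

theorem nodup_tag {p : ℕ} {B : List (List ℕ)} (hB : IsBlocked B) : (tag p B).Nodup := by
  induction B generalizing p with
  | nil => simp [tag]
  | cons b B ih =>
    rw [tag, List.nodup_append]
    refine ⟨(hB b (by simp)).map fun x y h => by simpa using h,
      ih fun c hc => hB c (by simp [hc]), ?_⟩
    rintro x hx y hy rfl
    obtain ⟨a, -, rfl⟩ := List.mem_map.1 hx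
    have := snd_of_mem_tag hy
    simp only at this
    omega

theorem sorted_tag (p : ℕ) (B : List (List ℕ)) :
    (tag p B).Pairwise fun x y => x.2 ≤ y.2 := by
  induction B generalizing p with
  | nil => simp [tag]
  | cons b B ih =>
    rw [tag, List.pairwise_append]
    refine ⟨?_, ih _, ?_⟩
    · rw [List.pairwise_map]
      exact List.pairwise_of_forall fun _ _ => le_rfl
    · intro x hx y hy
      obtain ⟨a, -, rfl⟩ := List.mem_map.1 hx
      have := snd_of_mem_tag hy
      simp only at this ⊢
      omega

/-- The letter at a position of the flattened list of blocks. -/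
def letterAt (B : List (List ℕ)) (x : ℤ) : ℕ := ((tag 0 B).getD x.toNat (0, 0)).1

/-- The index of the block at a position of the flattened list of blocks. -/
def blockAt (B : List (List ℕ)) (x : ℤ) : ℤ := ((tag 0 B).getD x.toNat (0, 0)).2

/-- The positions of the flattened list of blocks. -/
noncomputable def positions (B : List (List ℕ)) : Finset ℤ := Finset.Ico 0 (B.flatten.length : ℤ)

section positions
variable {B : List (List ℕ)}

theorem length_tag (p : ℕ) (B : List (List ℕ)) : (tag p B).length = B.flatten.length := by
  rw [← tag_map_fst p, List.length_map]

theorem exists_nat_of_mem_positions {x : ℤ} (hx : x ∈ positions B) :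
    ∃ (k : ℕ) (hk : k < (tag 0 B).length), x = k ∧ letterAt B x = (tag 0 B)[k].1 ∧
      blockAt B x = (tag 0 B)[k].2 := by
  rw [positions, Finset.mem_Ico] at hx
  obtain ⟨k, rfl⟩ := Int.eq_ofNat_of_zero_le hx.1
  have hk : k < (tag 0 B).length := by
    rw [length_tag]; omega
  refine ⟨k, hk, rfl, ?_, ?_⟩
  · rw [letterAt, Int.toNat_natCast, List.getD_eq_getElem _ _ hk]
  · rw [blockAt, Int.toNat_natCast, List.getD_eq_getElem _ _ hk]

theorem mono_blockAt : Mono (blockAt B) (positions B) := by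
  intro x hx y hy hxy
  obtain ⟨k, hk, rfl, -, e⟩ := exists_nat_of_mem_positions hx
  obtain ⟨l, hl, rfl, -, e'⟩ := exists_nat_of_mem_positions hy
  rw [e, e']
  rcases Nat.eq_or_lt_of_le (show k ≤ l by exact_mod_cast hxy) with rfl | h
  · exact le_rfl
  · exact_mod_cast List.pairwise_iff_getElem.1 (sorted_tag 0 B) k l hk hl h

theorem fits_blockAt {H : ℕ} (h : B.length ≤ 2 ^ H) : Fits (blockAt B) (positions B) H := by
  have : ∀ x ∈ positions B, blockAt B x / 2 ^ H = 0 := by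
    intro x hx
    obtain ⟨k, hk, rfl, -, e⟩ := exists_nat_of_mem_positions hx
    have h1 := (snd_of_mem_tag (List.getElem_mem hk)).2
    rw [e]
    apply Int.ediv_eq_zero_of_lt (by positivity)
    exact_mod_cast (by omega : (tag 0 B)[k].2 < 2 ^ H)
  intro x hx y hy
  rw [this x hx, this y hy]

theorem blocked_positions (hB : IsBlocked B) :
    Blocked (letterAt B) (blockAt B) (positions B) := by
  intro x hx y hy h1 h2
  obtain ⟨k, hk, rfl, e1, e2⟩ := exists_nat_of_mem_positions hx
  obtain ⟨l, hl, rfl, e3, e4⟩ := exists_nat_of_mem_positions hy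
  rw [e1, e3] at h1
  rw [e2, e4] at h2
  have := (List.Nodup.getElem_inj_iff (nodup_tag hB) (hi := hk) (hj := hl)).1
    (Prod.ext h1 (by exact_mod_cast h2))
  rw [this]

theorem mem_inc_positions {a p : ℕ} :
    (a, (p : ℤ)) ∈ inc (letterAt B) (blockAt B) (positions B) ↔ a ∈ B.getD p [] := by
  have h := mem_tag (p := 0) (q := p) (a := a) (B := B)
  rw [zero_add] at h
  rw [← h, mem_inc]
  constructor
  · rintro ⟨x, hx, h1, h2⟩
    obtain ⟨k, hk, rfl, e1, e2⟩ := exists_nat_of_mem_positions hx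
    have : (tag 0 B)[k] = (a, p) :=
      Prod.ext (e1.symm.trans h1) (Int.ofNat.inj (e2.symm.trans h2))
    rw [← this]
    exact List.getElem_mem hk
  · intro h
    obtain ⟨k, hk, e⟩ := List.getElem_of_mem h
    have hx : (k : ℤ) ∈ positions B := by
      rw [length_tag] at hk
      rw [positions, Finset.mem_Ico]; omega
    obtain ⟨l, hl, hkl, e1, e2⟩ := exists_nat_of_mem_positions hx
    obtain rfl : k = l := by exact_mod_cast hkl
    exact ⟨k, hx, by rw [e1, e], by rw [e2, e]⟩

theorem nonneg_of_mem_inc_positions {a : ℕ} {v : ℤ}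
    (h : (a, v) ∈ inc (letterAt B) (blockAt B) (positions B)) : ∃ p : ℕ, v = p := by
  obtain ⟨x, hx, -, rfl⟩ := mem_inc.1 h
  exact ⟨_, rfl⟩

theorem drop_toNat_of_mem_positions {x : ℤ} (hx : x ∈ positions B) :
    B.flatten.drop x.toNat = letterAt B x :: B.flatten.drop (x.toNat + 1) := by
  obtain ⟨k, hk, rfl, e, -⟩ := exists_nat_of_mem_positions hx
  rw [Int.toNat_natCast, e]
  rw [length_tag] at hk
  rw [List.drop_eq_getElem_cons hk]
  congr 1
  simp only [← tag_map_fst 0 B, List.getElem_map]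

theorem letters_positions : letters (letterAt B) (positions B) = B.flatten.toFinset.card := by
  rw [letters]
  congr 1
  ext a
  rw [Finset.mem_image, List.mem_toFinset]
  constructor
  · rintro ⟨x, hx, rfl⟩
    have h : letterAt B x ∈ B.flatten.drop x.toNat := by
      rw [drop_toNat_of_mem_positions hx]; simp
    exact List.mem_of_mem_drop h
  · intro h
    obtain ⟨b, hb, hab⟩ := List.mem_flatten.1 h
    obtain ⟨p, hp, rfl⟩ := List.getElem_of_mem hb
    have : a ∈ B.getD p [] := by rwa [List.getD_eq_getElem _ _ hp]
    obtain ⟨x, hx, h1, -⟩ := mem_inc.1 (mem_inc_positions.2 this)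
    exact ⟨x, hx, h1⟩

theorem card_positions : (positions B).card = B.flatten.length := by
  rw [positions, Int.card_Ico, sub_zero, Int.toNat_natCast]

/-! ### Forbidden patterns -/

/-- The alternation of length `k` that starts with `a`. -/
def altWord : ℕ → ℕ → ℕ → List ℕ
  | 0, _, _ => []
  | k + 1, a, b => a :: altWord k b a

/-- The alternation of length `k` that starts with `a`, with all letters doubled. -/
def dblWord : ℕ → ℕ → ℕ → List ℕ
  | 0, _, _ => []
  | k + 1, a, b => a :: a :: dblWord k b a

theorem map_range_eq_altWord (k a b : ℕ) :
    (List.range k).map (fun x => if x % 2 = 0 then a else b) = altWord k a b := by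
  induction k generalizing a b with
  | zero => rfl
  | succ k ih =>
    rw [List.range_succ_eq_map, List.map_cons, List.map_map, altWord, ← ih b a]
    congr 1
    refine List.map_congr_left fun x _ => ?_
    simp only [Function.comp, Nat.succ_eq_add_one]
    rcases Nat.mod_two_eq_zero_or_one x with h | h
    · rw [if_neg (by omega), if_pos h]
    · rw [if_pos (by omega), if_neg (by omega)]

theorem alt_map_eq (k a b : ℕ) :
    (alt k).map (fun x => if x = 0 then a else b) = altWord k a b := by
  rw [alt, List.map_map, ← map_range_eq_altWord]
  rfl

theorem mem_dblInit {x : ℕ} {l : List ℕ} (h : x ∈ dblInit l) : x ∈ l := by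
  induction l with
  | nil => exact h
  | cons y l ih =>
    cases l with
    | nil => exact h
    | cons z l =>
      rw [dblInit] at h
      simp only [List.mem_cons] at h ih ⊢
      tauto

theorem mem_dbl {x : ℕ} {l : List ℕ} (h : x ∈ dbl l) : x ∈ l := by
  cases l with
  | nil => exact h
  | cons y l =>
    rw [dbl, List.mem_cons] at h
    exact List.mem_cons.2 (h.imp_right mem_dblInit)

theorem dblInit_map (f : ℕ → ℕ) (l : List ℕ) : (dblInit l).map f = dblInit (l.map f) := by
  induction l with
  | nil => rfl
  | cons y l ih =>
    cases l with
    | nil => rfl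
    | cons z l =>
      simp only [dblInit, List.map_cons, List.cons.injEq, true_and] at ih ⊢
      exact ih

theorem dbl_map (f : ℕ → ℕ) (l : List ℕ) : (dbl l).map f = dbl (l.map f) := by
  cases l with
  | nil => rfl
  | cons y l => rw [dbl, List.map_cons, dblInit_map, List.map_cons, dbl]

theorem dblInit_altWord (k a b : ℕ) :
    dblInit (altWord (k + 1) a b) = dblWord k a b ++ [if Even k then a else b] := by
  induction k generalizing a b with
  | zero => simp [altWord, dblInit, dblWord]
  | succ k ih =>
    have := ih b a
    rw [altWord] at this
    rw [altWord, altWord, dblInit, this, dblWord]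
    by_cases hk : Even k
    · simp [hk, Nat.even_add_one]
    · simp [hk, Nat.even_add_one]

theorem contained_of_sublist {σ S : List ℕ} {a b : ℕ} (hab : a ≠ b)
    (hσ : ∀ x ∈ σ, x = 0 ∨ x = 1)
    (h : (σ.map fun x => if x = 0 then a else b).Sublist S) : Contained σ S := by
  refine ⟨_, ?_, h⟩
  intro x hx y hy e
  rcases hσ x hx with rfl | rfl <;> rcases hσ y hy with rfl | rfl <;> simp_all

theorem mem_alt {k x : ℕ} (h : x ∈ alt k) : x = 0 ∨ x = 1 := by
  obtain ⟨y, -, rfl⟩ := List.mem_map.1 h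
  omega

theorem drop_sublist_drop {l : List ℕ} {i j : ℕ} (h : i ≤ j) : (l.drop j).Sublist (l.drop i) := by
  obtain ⟨d, rfl⟩ := Nat.exists_eq_add_of_le h
  rw [← List.drop_drop]
  exact List.drop_sublist _ _

theorem nonneg_of_mem_positions {x : ℤ} (hx : x ∈ positions B) : 0 ≤ x :=
  (Finset.mem_Ico.1 hx).1

theorem altWord_sublist {k a b : ℕ} {x z : ℤ} (hx : -1 ≤ x)
    (h : Chain Eq (letterAt B) (positions B) k a b x z) :
    (altWord k a b).Sublist (B.flatten.drop (x + 1).toNat) := by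
  induction k generalizing a b x with
  | zero => exact List.nil_sublist _
  | succ k ih =>
    obtain ⟨y, y', hy, hy', e, e', hxy, -, rfl, hc⟩ := h
    have h0 := nonneg_of_mem_positions hy
    refine List.Sublist.trans ?_ (drop_sublist_drop (show (x + 1).toNat ≤ y.toNat by omega))
    rw [drop_toNat_of_mem_positions hy, e, altWord]
    have := ih (by omega) hc
    rw [show (y + 1).toNat = y.toNat + 1 by omega] at this
    exact this.cons_cons a

theorem dblWord_sublist {k a b : ℕ} {x z : ℤ} (hx : -1 ≤ x) (hz : z ∈ positions B)
    (h : Chain (· < ·) (letterAt B) (positions B) k a b x z) :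
    (dblWord k a b ++ [letterAt B z]).Sublist (B.flatten.drop (x + 1).toNat) := by
  induction k generalizing a b x with
  | zero =>
    have h' : x < z := h
    refine List.Sublist.trans ?_ (drop_sublist_drop (show (x + 1).toNat ≤ z.toNat by omega))
    rw [drop_toNat_of_mem_positions hz, dblWord, List.nil_append]
    exact (List.nil_sublist _).cons_cons _
  | succ k ih =>
    obtain ⟨y, y', hy, hy', e, e', hxy, -, hlt, hc⟩ := h
    have h0 := nonneg_of_mem_positions hy
    have h1 : y < y' := hlt
    refine List.Sublist.trans ?_ (drop_sublist_drop (show (x + 1).toNat ≤ y.toNat by omega))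
    rw [drop_toNat_of_mem_positions hy, e, dblWord, List.cons_append]
    refine List.Sublist.cons_cons a ?_
    refine List.Sublist.trans ?_
      (drop_sublist_drop (show y.toNat + 1 ≤ y'.toNat by omega))
    rw [drop_toNat_of_mem_positions hy', e']
    have := ih (by omega) hc
    rw [show (y' + 1).toNat = y'.toNat + 1 by omega] at this
    exact this.cons_cons a

theorem altFree_positions {k : ℕ} (h : ¬ Contained (alt k) B.flatten) :
    AltFree (letterAt B) (positions B) k := by
  intro a b x z hab hc
  refine h (contained_of_sublist hab (fun _ => mem_alt) ?_)
  rw [alt_map_eq]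
  cases k with
  | zero => exact List.nil_sublist _
  | succ k =>
    obtain ⟨y, y', hy, hy', e, e', hxy, h1, h2, hc⟩ := hc
    have h0 := nonneg_of_mem_positions hy
    have hc' : Chain Eq (letterAt B) (positions B) (k + 1) a b (-1) z :=
      ⟨y, y', hy, hy', e, e', by omega, h1, h2, hc⟩
    exact (altWord_sublist le_rfl hc').trans (List.drop_sublist _ _)

theorem dblFree_positions {k : ℕ} (h : ¬ Contained (dbl (alt (k + 2))) B.flatten) :
    DblFree (letterAt B) (positions B) k := by
  intro a b x z hab hx hz ex ez hc
  refine h (contained_of_sublist hab (fun _ hy => mem_alt (mem_dbl hy)) ?_)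
  rw [dbl_map, alt_map_eq, altWord, dbl, dblInit_altWord, ← ez, ← ex]
  have h0 := nonneg_of_mem_positions hx
  have := dblWord_sublist (by omega) hz hc
  rw [show (x + 1).toNat = x.toNat + 1 by omega, ← ex] at this
  have := this.cons_cons (letterAt B x)
  rw [← drop_toNat_of_mem_positions hx] at this
  exact this.trans (List.drop_sublist _ _)

end positions

/-! ### The canonical derivation tree -/

theorem mem_pairUp {C : List (List ℕ)} {a p : ℕ} (h : a ∈ (pairUp C).getD p []) :
    ∃ q, q / 2 = p ∧ a ∈ C.getD q [] := by
  induction C using pairUp.induct generalizing p with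
  | case1 => simp [pairUp] at h
  | case2 b =>
    cases p with
    | zero => exact ⟨0, rfl, by simpa [pairUp] using h⟩
    | succ p => simp [pairUp] at h
  | case3 b c l ih =>
    cases p with
    | zero =>
      have h' : a ∈ b ++ c := by simpa [pairUp] using h
      rcases List.mem_append.1 h' with h | h
      · exact ⟨0, rfl, by simpa using h⟩
      · exact ⟨1, rfl, by simpa using h⟩
    | succ p =>
      obtain ⟨q, rfl, hq⟩ := ih (p := p) (by simpa [pairUp] using h)
      exact ⟨q + 2, by omega, by simpa using hq⟩

theorem mem_contract {C : List (List ℕ)} {a p : ℕ} (h : a ∈ (contract C).getD p []) :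
    ∃ q, q / 2 = p ∧ a ∈ C.getD q [] := by
  apply mem_pairUp
  rcases Nat.lt_or_ge p (contract C).length with hp | hp
  · rw [List.getD_eq_getElem _ _ hp] at h
    simp only [contract, List.getElem_map, List.mem_filter, List.mem_reverse, List.mem_dedup] at h
    rw [List.getD_eq_getElem]
    exact h.1
  · rw [List.getD_eq_default _ _ hp] at h
    simp at h

/-- A symbol in the block of a node appears in a leaf below that node. -/
theorem exists_leaf {B : List (List ℕ)} {a k p : ℕ} (h : a ∈ block B (k, p)) :
    ∃ T, T / 2 ^ k = p ∧ a ∈ B.getD T [] := by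
  induction k generalizing p with
  | zero => exact ⟨p, by simp, h⟩
  | succ k ih =>
    rw [block, Function.iterate_succ_apply'] at h
    obtain ⟨q, rfl, hq⟩ := mem_contract h
    obtain ⟨T, rfl, hT⟩ := ih hq
    exact ⟨T, by rw [pow_succ, Nat.div_div_eq_div_mul], hT⟩

theorem below_succ_iff {k q K Q : ℕ} :
    Below (k + 1, q / 2) (K, Q) ↔ k + 1 ≤ K ∧ q / 2 ^ (K - k) = Q := by
  unfold Below
  refine and_congr_right fun h => ?_
  simp only at h ⊢
  rw [Nat.div_div_eq_div_mul, ← pow_succ', show K - (k + 1) + 1 = K - k by omega]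

theorem div_pow_eq_of_le {x y k K : ℕ} (h : k ≤ K) (e : x / 2 ^ k = y / 2 ^ k) :
    x / 2 ^ K = y / 2 ^ K := by
  obtain ⟨d, rfl⟩ := Nat.exists_eq_add_of_le h
  rw [pow_add, ← Nat.div_div_eq_div_mul, e, Nat.div_div_eq_div_mul]

theorem div_pow_cast (x k : ℕ) : ((x : ℤ)) / 2 ^ k = ((x / 2 ^ k : ℕ) : ℤ) := by
  push_cast; rfl

variable {B : List (List ℕ)} {a p : ℕ}

theorem IsDoveFeather.isDove (h : IsDoveFeather B a p) :
    IsDove (inc (letterAt B) (blockAt B) (positions B)) (a, (p : ℤ)) := by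
  obtain ⟨⟨k, q⟩, ⟨hv, ⟨-, K, Q, t, hcr, ht, hb1, hb2⟩, hn⟩, ⟨hp1, -, hp2⟩, hp3⟩ := h
  simp only at hb1 hb2 hp2 hn
  rw [below_succ_iff] at hb1
  have e1 : t / 2 ^ (k + 1) = q / 2 := hb2.2
  have e2 : p / 2 ^ k = q := hp2
  have e3 : p / 2 ^ (k + 1) = q / 2 := by rw [pow_succ, ← Nat.div_div_eq_div_mul, e2]
  obtain ⟨T, hT, hTB⟩ := exists_leaf hcr.2.1
  have e4 : t / 2 ^ K = 2 * Q := by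
    rw [div_pow_eq_of_le hb1.1 (e1.trans e3.symm), ← hb1.2, ← e2, Nat.div_div_eq_div_mul, ← pow_add,
      Nat.add_sub_cancel' (by omega)]
  refine ⟨mem_inc_positions.2 hp1, k, ⟨t, T, mem_inc_positions.2 ht.1, ?_,
    mem_inc_positions.2 hTB, ?_, ?_, ?_⟩, ?_⟩
  · intro u hu
    obtain ⟨u, rfl⟩ := nonneg_of_mem_inc_positions hu
    exact_mod_cast ht.2 (mem_inc_positions.1 hu)
  · rw [div_pow_cast, div_pow_cast]
    intro e
    have := div_pow_eq_of_le hb1.1 (by exact_mod_cast e : T / 2 ^ (k + 1) = t / 2 ^ (k + 1))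
    omega
  · rw [div_pow_cast, div_pow_cast, e1, e3]
  · rw [div_pow_cast, div_pow_cast]
    intro e
    have e' : p / 2 ^ k = t / 2 ^ k := by exact_mod_cast e
    exact hn ⟨hv, K, Q, t, hcr, ht, ⟨by simp only; omega, hb1.2⟩, Nat.zero_le _,
      by simpa using e'.symm.trans e2⟩
  · intro u hu hlt
    obtain ⟨u, rfl⟩ := nonneg_of_mem_inc_positions hu
    rw [div_pow_cast, div_pow_cast]
    intro e
    have e' : u / 2 ^ k = p / 2 ^ k := by exact_mod_cast e
    have := hp3 ⟨mem_inc_positions.1 hu, Nat.zero_le _, e'.trans e2⟩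
    simp only at hlt
    omega

theorem IsHawkFeather.isHawk (h : IsHawkFeather B a p) :
    IsHawk (inc (letterAt B) (blockAt B) (positions B)) (a, (p : ℤ)) := by
  obtain ⟨⟨k, q⟩, ⟨hv, ⟨-, K, Q, t, hcr, ht, hb1, hb2⟩, hn⟩, ⟨hp1, -, hp2⟩, hp3⟩ := h
  simp only at hb1 hb2 hp2 hn
  rw [below_succ_iff] at hb1
  have e1 : t / 2 ^ (k + 1) = q / 2 := hb2.2
  have e2 : p / 2 ^ k = q := hp2
  have e3 : p / 2 ^ (k + 1) = q / 2 := by rw [pow_succ, ← Nat.div_div_eq_div_mul, e2]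
  obtain ⟨T, hT, hTB⟩ := exists_leaf hcr.1
  have e4 : t / 2 ^ K = 2 * Q + 1 := by
    rw [div_pow_eq_of_le hb1.1 (e1.trans e3.symm), ← hb1.2, ← e2, Nat.div_div_eq_div_mul, ← pow_add,
      Nat.add_sub_cancel' (by omega)]
  have hr : ∀ {u : ℕ}, (a, -1 - (u : ℤ)) ∈ refl (inc (letterAt B) (blockAt B) (positions B)) ↔
      a ∈ B.getD u [] := fun {u} => by
    rw [mem_refl, sub_sub_cancel, mem_inc_positions]
  have hr' : ∀ {u : ℤ}, (a, u) ∈ refl (inc (letterAt B) (blockAt B) (positions B)) →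
      ∃ w : ℕ, u = -1 - w := fun {u} h => by
    obtain ⟨w, hw⟩ := nonneg_of_mem_inc_positions (mem_refl.1 h)
    exact ⟨w, by omega⟩
  refine ⟨hr.2 hp1, k, ⟨-1 - t, -1 - T, hr.2 ht.1, ?_, hr.2 hTB, ?_, ?_, ?_⟩, ?_⟩
  · intro u hu
    obtain ⟨u, rfl⟩ := hr' hu
    have := ht.2 (hr.1 hu)
    omega
  · rw [refl_ediv, refl_ediv, div_pow_cast, div_pow_cast]
    intro e
    have := div_pow_eq_of_le hb1.1 (by omega : T / 2 ^ (k + 1) = t / 2 ^ (k + 1))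
    omega
  · simp only
    rw [refl_ediv, refl_ediv, div_pow_cast, div_pow_cast, e1, e3]
  · simp only
    rw [refl_ediv, refl_ediv, div_pow_cast, div_pow_cast]
    intro e
    have e' : p / 2 ^ k = t / 2 ^ k := by omega
    exact hn ⟨hv, K, Q, t, hcr, ht, ⟨by simp only; omega, hb1.2⟩, Nat.zero_le _,
      by simpa using e'.symm.trans e2⟩
  · intro u hu hlt
    obtain ⟨u, rfl⟩ := hr' hu
    simp only at hlt ⊢
    rw [refl_ediv, refl_ediv, div_pow_cast, div_pow_cast]
    intro e
    have e' : u / 2 ^ k = p / 2 ^ k := by omega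
    have := hp3 ⟨hr.1 hu, Nat.zero_le _, e'.trans e2⟩
    omega

theorem doveFeathers_le (B : List (List ℕ)) :
    doveFeathers B ≤ (doves (inc (letterAt B) (blockAt B) (positions B))).card := by
  classical
  refine Finset.card_le_card_of_injOn (fun x => (x.1, (x.2 : ℤ))) ?_ ?_
  · intro x hx
    have hx' := (Finset.mem_filter.1 hx).2
    exact mem_doves.2 hx'.isDove
  · rintro ⟨x, y⟩ - ⟨x', y'⟩ - h
    simpa using h

theorem hawkFeathers_le (B : List (List ℕ)) :
    hawkFeathers B ≤ (hawks (inc (letterAt B) (blockAt B) (positions B))).card := by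
  classical
  refine Finset.card_le_card_of_injOn (fun x => (x.1, (x.2 : ℤ))) ?_ ?_
  · intro x hx
    have hx' := (Finset.mem_filter.1 hx).2
    refine mem_hawks.2 ⟨?_, hx'.isHawk⟩
    obtain ⟨v, hv, hp, -⟩ := hx'
    exact mem_inc_positions.2 hp.1
  · rintro ⟨x, y⟩ - ⟨x', y'⟩ - h
    simpa using h

/-! ### The extremal functions -/

theorem natCast_sSup_le {X : Set ℕ} {r : ℝ} (hr : 0 ≤ r) (h : ∀ k ∈ X, (k : ℝ) ≤ r) :
    ((sSup X : ℕ) : ℝ) ≤ r := by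
  rcases X.eq_empty_or_nonempty with rfl | hne
  · simpa using hr
  · exact h _ (Nat.sSup_mem hne ⟨⌊r⌋₊, fun k hk => Nat.le_floor (h k hk)⟩)

theorem DSBound.le_of_mem_exSet {s H n m l : ℕ} {A C : ℝ} (h : DSBound s H A C) (hm : m ≤ 2 ^ H)
    (hl : l ∈ exSet (alt (s + 2)) n m) : (l : ℝ) ≤ A * n + C * 2 ^ H := by
  obtain ⟨S, rfl, hS, rfl, B, rfl, hB, hBm⟩ := hl
  have := h _ _ _ mono_blockAt (fits_blockAt (hBm.trans hm)) (altFree_positions hS)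
  rwa [letters_positions, (blocked_positions hB).inc_card, card_positions] at this

theorem FeatherBound.le_of_mem_featherSet {s H n m l : ℕ} {A C : ℝ} (h : FeatherBound s H A C)
    (hm : m ≤ 2 ^ H) (hl : l ∈ featherSet s n m) : (l : ℝ) ≤ A * n + C * 2 ^ H := by
  obtain ⟨B, rfl, hB, hS, rfl, rfl | rfl⟩ := hl
  · have := h _ _ _ mono_blockAt (fits_blockAt hm) (altFree_positions hS)
    rw [letters_positions] at this
    exact le_trans (by exact_mod_cast doveFeathers_le B) this
  · have := h.hawks_le mono_blockAt (fits_blockAt hm) (altFree_positions hS)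
    rw [letters_positions] at this
    exact le_trans (by exact_mod_cast hawkFeathers_le B) this

/-- The positions of `P` preceded by an even (`e = 0`) or odd (`e = 1`) number of occurrences of
the same letter. -/
def parityClass (ℓ : ℤ → ℕ) (P : Finset ℤ) (e : ℕ) : Finset ℤ :=
  P.filter fun x => (P.filter fun z => ℓ z = ℓ x ∧ z < x).card % 2 = e

theorem separated_parityClass (ℓ : ℤ → ℕ) (P : Finset ℤ) (e : ℕ) :
    Separated ℓ (parityClass ℓ P e) P := by
  intro x hx y hy hxy hlt
  obtain ⟨hxP, hx⟩ := Finset.mem_filter.1 hx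
  obtain ⟨hyP, hy⟩ := Finset.mem_filter.1 hy
  by_contra! hc
  have h1 : (P.filter fun z => ℓ z = ℓ y ∧ z < y) =
      insert x (P.filter fun z => ℓ z = ℓ x ∧ z < x) := by
    ext z
    simp only [Finset.mem_filter, Finset.mem_insert]
    constructor
    · rintro ⟨hz, e1, hzy⟩
      rcases lt_trichotomy z x with h | h | h
      · exact Or.inr ⟨hz, e1.trans hxy.symm, h⟩
      · exact Or.inl h
      · exact absurd hzy (not_lt.2 (hc z hz (e1.trans hxy.symm) h))
    · rintro (rfl | ⟨hz, e1, hzx⟩)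
      · exact ⟨hxP, hxy, hlt⟩
      · exact ⟨hz, e1.trans hxy, hzx.trans hlt⟩
  rw [h1, Finset.card_insert_of_notMem (by simp)] at hy
  omega

theorem card_parityClass (ℓ : ℤ → ℕ) (P : Finset ℤ) :
    P.card ≤ (parityClass ℓ P 0).card + (parityClass ℓ P 1).card := by
  refine (Finset.card_le_card fun x hx => ?_).trans (Finset.card_union_le _ _)
  rw [Finset.mem_union, parityClass, parityClass, Finset.mem_filter, Finset.mem_filter]
  exact (Nat.mod_two_eq_zero_or_one _).imp (⟨hx, ·⟩) (⟨hx, ·⟩)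

/-- A double DS sequence is the union of two separated sets of occurrences; this is the factor `2`
in the bound on double DS sequences. -/
theorem DblBound.le_of_mem_exSet {s H n m l : ℕ} {A C : ℝ} (h : DblBound s H A C) (hA : 0 ≤ A)
    (hm : m ≤ 2 ^ H) (hl : l ∈ exSet (dbl (alt (s + 2))) n m) :
    (l : ℝ) ≤ 2 * (A * n + C * 2 ^ H) := by
  obtain ⟨S, rfl, hS, rfl, B, rfl, hB, hBm⟩ := hl
  have hf := fits_blockAt (hBm.trans hm)
  have key : ∀ e, ((parityClass (letterAt B) (positions B) e).card : ℝ) ≤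
      A * B.flatten.toFinset.card + C * 2 ^ H := fun e => by
    have hsub : parityClass (letterAt B) (positions B) e ⊆ positions B := Finset.filter_subset _ _
    refine (h _ _ _ _ hsub mono_blockAt (hf.mono hsub)
      (fun x hx y hy => blocked_positions hB x (hsub hx) y (hsub hy))
      (separated_parityClass _ _ e) (dblFree_positions hS)).trans ?_
    rw [← letters_positions]
    gcongr
    exact Finset.card_le_card (Finset.image_subset_image hsub)
  have h2 := card_parityClass (letterAt B) (positions B)
  rw [card_positions] at h2
  have h3 : (B.flatten.length : ℝ) ≤ (parityClass (letterAt B) (positions B) 0).card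
    + (parityClass (letterAt B) (positions B) 1).card := by exact_mod_cast h2
  linarith [key 0, key 1]

theorem eq_zero_of_mem_exSet {σ : List ℕ} {n l : ℕ} (h : l ∈ exSet σ n 0) : l = 0 := by
  obtain ⟨S, rfl, -, -, B, rfl, -, hB⟩ := h
  obtain rfl : B = [] := List.eq_nil_of_length_eq_zero (by omega)
  rfl

theorem eq_zero_of_mem_featherSet {s n l : ℕ} (h : l ∈ featherSet s n 0) : l = 0 := by
  obtain ⟨B, hB, -, -, -, rfl | rfl⟩ := h
  all_goals
    obtain rfl : B = [] := List.eq_nil_of_length_eq_zero hB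
    simp [doveFeathers, hawkFeathers]

/-- Rounding `c` up to an integer `c' ≥ 4` changes the bounds by an absolute constant factor. -/
theorem pow_ceil_le {s : ℕ} {c j : ℝ} (hs : 3 ≤ s) (hc : (s : ℝ) - 2 ≤ c) (hj : 0 ≤ j) :
    (((⌈c⌉₊ + 3 : ℕ) : ℝ) * j) ^ (s - 2) ≤ Real.exp 4 * (c * j) ^ (s - 2) := by
  have hs' : (3 : ℝ) ≤ s := by exact_mod_cast hs
  have hc0 : 0 < c := by linarith
  have h1 : ((⌈c⌉₊ + 3 : ℕ) : ℝ) ≤ c * (4 / c + 1) := by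
    push_cast
    rw [mul_add, mul_div_cancel₀ _ hc0.ne']
    linarith [Nat.ceil_lt_add_one hc0.le]
  have h2 : 4 / c + 1 ≤ Real.exp (4 / c) := Real.add_one_le_exp _
  have h3 : (4 / c + 1) ^ (s - 2) ≤ Real.exp 4 := by
    refine (pow_le_pow_left₀ (by positivity) h2 _).trans ?_
    rw [← Real.exp_nat_mul, Real.exp_le_exp, Nat.cast_sub (by omega), mul_div_assoc',
      div_le_iff₀ hc0]
    push_cast
    linarith
  calc (((⌈c⌉₊ + 3 : ℕ) : ℝ) * j) ^ (s - 2) ≤ (c * (4 / c + 1) * j) ^ (s - 2) := by gcongr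
    _ = (4 / c + 1) ^ (s - 2) * (c * j) ^ (s - 2) := by rw [← mul_pow]; ring
    _ ≤ _ := by gcongr

theorem one_le_fea {s i : ℕ} (hs : 3 ≤ s) (hi : 1 ≤ i) : 1 ≤ fea s i := by
  refine le_trans ?_ (fea_one_le (by omega) hi)
  obtain ⟨t, rfl⟩ := Nat.exists_eq_add_of_le' hs
  rw [fea]
  linarith [fea_nonneg (t + 2) 1]

/-- The bounds on the extremal functions in terms of Ackermann's function. -/
theorem extremal_le {s i n m j : ℕ} {c : ℝ} (hs : 3 ≤ s) (hi : 1 ≤ i) (hc : (s : ℝ) - 2 ≤ c)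
    (hj : 1 ≤ j) (hm : (m : ℝ) ≤ (acker i j : ℝ) ^ c) :
    (Feather s n m : ℝ) ≤ (fea s i : ℝ) *
      ((n : ℝ) + 4 * Real.exp 4 * ((c * (j : ℝ)) ^ (s - 2) * (m : ℝ))) ∧
    (DS s n m : ℝ) ≤ (ds s i : ℝ) *
      ((n : ℝ) + 4 * Real.exp 4 * ((c * (j : ℝ)) ^ (s - 2) * (m : ℝ))) ∧
    (dblDS s n m : ℝ) ≤ 2 * (dblds s i : ℝ) *
      ((n : ℝ) + 4 * Real.exp 4 * ((c * (j : ℝ)) ^ (s - 2) * (m : ℝ))) := by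
  have hs' : (3 : ℝ) ≤ s := by exact_mod_cast hs
  have hc0 : 0 < c := by linarith
  have hF : (1 : ℝ) ≤ fea s i := by exact_mod_cast one_le_fea hs hi
  have hD : (1 : ℝ) ≤ ds s i := by exact_mod_cast ds_pos (by omega) hi
  have hE : (2 : ℝ) ≤ dblds s i := by exact_mod_cast two_le_dblds (by omega) hi
  set T : ℝ := (c * (j : ℝ)) ^ (s - 2)
  have hT : 0 ≤ T := by positivity
  have hR : 0 ≤ (n : ℝ) + 4 * Real.exp 4 * (T * m) := by positivity
  have hr1 := mul_nonneg (show 0 ≤ (fea s i : ℝ) by linarith) hR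
  have hr2 := mul_nonneg (show 0 ≤ (ds s i : ℝ) by linarith) hR
  have hr3 := mul_nonneg (show 0 ≤ 2 * (dblds s i : ℝ) by linarith) hR
  rcases Nat.eq_zero_or_pos m with rfl | hm0
  · refine ⟨natCast_sSup_le hr1 fun k hk => ?_, natCast_sSup_le hr2 fun k hk => ?_,
      natCast_sSup_le hr3 fun k hk => ?_⟩
    · rw [eq_zero_of_mem_featherSet hk]; exact Nat.cast_zero.trans_le hr1
    · rw [eq_zero_of_mem_exSet hk]; exact Nat.cast_zero.trans_le hr2
    · rw [eq_zero_of_mem_exSet hk]; exact Nat.cast_zero.trans_le hr3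
  set d := ⌈c⌉₊ + 3 with hd
  have hcd : c ≤ d := by
    rw [hd]; push_cast
    linarith [Nat.le_ceil c]
  have hd4 : 4 ≤ d := by
    have := Nat.ceil_pos.2 hc0
    omega
  have hsd : s ≤ d + 2 := by
    have : (s : ℝ) ≤ (d + 2 : ℕ) := by push_cast; linarith
    exact_mod_cast this
  set H := Nat.clog 2 m
  have hmH : m ≤ 2 ^ H := Nat.le_pow_clog (by norm_num) m
  have hH2 : (2 : ℝ) ^ H ≤ 2 * m := by
    rcases Nat.lt_or_ge 1 m with h | h
    · have h1 := Nat.pow_pred_clog_lt_self (b := 2) (by norm_num) h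
      have h2 : H = (Nat.clog 2 m).pred + 1 :=
        (Nat.succ_pred_eq_of_pos (Nat.clog_pos (by norm_num) h)).symm
      rw [h2, pow_succ]
      have : (2 : ℝ) ^ (Nat.clog 2 m).pred ≤ m := by exact_mod_cast h1.le
      linarith
    · obtain rfl : m = 1 := by omega
      simp [H]
  have hHd : H ≤ d * level i j := by
    apply Nat.clog_le_of_le_pow
    have h1 : (acker i j : ℝ) ^ c ≤ (acker i j : ℝ) ^ (d : ℝ) :=
      Real.rpow_le_rpow_of_exponent_le (by exact_mod_cast acker_pos hi hj) hcd
    rw [Real.rpow_natCast] at h1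
    have h2 := hm.trans h1
    rw [acker_eq hi hj] at h2
    rw [mul_comm, pow_mul]
    exact_mod_cast h2
  have hTd : ((d : ℝ) * j) ^ (s - 2) * 2 ^ H ≤ 2 * Real.exp 4 * (T * m) := by
    calc ((d : ℝ) * j) ^ (s - 2) * 2 ^ H ≤ Real.exp 4 * T * (2 * m) := by
          gcongr
          exact pow_ceil_le hs hc (Nat.cast_nonneg j)
      _ = _ := by ring
  have hTm : 0 ≤ Real.exp 4 * (T * m) := by positivity
  refine ⟨natCast_sSup_le hr1 fun k hk => ?_, natCast_sSup_le hr2 fun k hk => ?_,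
    natCast_sSup_le hr3 fun k hk => ?_⟩
  · refine ((featherBound_acker (by omega) (by omega) hsd i j H hi hj
      hHd).le_of_mem_featherSet hmH hk).trans ?_
    rw [mul_assoc, mul_add]
    have : ((fea s i : ℝ) + 1) * (((d : ℝ) * j) ^ (s - 2) * 2 ^ H) ≤
        (2 * fea s i) * (2 * Real.exp 4 * (T * m)) := by
      gcongr; linarith
    linarith
  · refine ((dsBound_acker hd4 s (by omega) hsd i j H hi hj hHd).le_of_mem_exSet hmH hk).trans ?_
    rw [mul_assoc, mul_add]
    have := mul_le_mul_of_nonneg_left hTd (show 0 ≤ (ds s i : ℝ) by linarith)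
    have := mul_nonneg (show 0 ≤ (ds s i : ℝ) by linarith) hTm
    linarith
  · refine ((dblBound_acker hd4 s (by omega) hsd i j H hi hj hHd).le_of_mem_exSet (by linarith)
      hmH hk).trans ?_
    rw [mul_assoc, mul_assoc, mul_add]
    have := mul_le_mul_of_nonneg_left hTd (show 0 ≤ (dblds s i : ℝ) by linarith)
    have := mul_nonneg (show 0 ≤ (dblds s i : ℝ) by linarith) hTm
    linarith

/-! ### Closed forms and growth of the coefficients -/

theorem ds_index_one {s : ℕ} (hs : 2 ≤ s) : ds s 1 = 2 ^ (s - 1) := by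
  induction s, hs using Nat.le_induction with
  | base => rw [ds_two]; norm_num
  | succ s hs ih =>
    obtain ⟨t, rfl⟩ := Nat.exists_eq_add_of_le' hs
    rw [ds_succ_one hs, ih, show t + 2 + 1 - 1 = t + 2 - 1 + 1 by omega, pow_succ]
    ring

theorem dblds_index_one {s : ℕ} (hs : 2 ≤ s) : dblds s 1 = 2 ^ (s + 1) - 2 ^ (s - 2) - 2 := by
  induction s, hs using Nat.le_induction with
  | base => rw [dblds_two]; norm_num
  | succ s hs ih =>
    obtain ⟨t, rfl⟩ := Nat.exists_eq_add_of_le' hs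
    rw [dblds_succ_one hs, ih, show t + 2 + 1 - 2 = t + 2 - 2 + 1 by omega, pow_succ 2 (t + 2 + 1),
      pow_succ 2 (t + 2 - 2)]
    ring

theorem fea_eq_choose {s i : ℕ} (hs : 2 ≤ s) (hi : 1 ≤ i) :
    fea s i = ((i + s - 2).choose (s - 2) : ℤ) - 1 := by
  induction s, hs using Nat.le_induction generalizing i with
  | base => simp [fea_two]
  | succ s hs ih =>
    obtain ⟨t, rfl⟩ := Nat.exists_eq_add_of_le' hs
    induction i, hi using Nat.le_induction with
    | base =>
      rw [fea_succ_one hs, ih le_rfl]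
      simp only [show 1 + (t + 2) - 2 = t + 1 by omega, show t + 2 - 2 = t by omega,
        show 1 + (t + 2 + 1) - 2 = t + 1 + 1 by omega, show t + 2 + 1 - 2 = t + 1 by omega,
        Nat.choose_succ_self_right]
      push_cast; ring
    | succ i hi ih2 =>
      rw [fea_succ_succ hs hi, ih2, ih (by omega)]
      rw [show i + 1 + (t + 2 + 1) - 2 = i + t + 1 + 1 by omega,
        show t + 2 + 1 - 2 = t + 1 by omega, show i + (t + 2 + 1) - 2 = i + t + 1 by omega,
        show t + 2 - 2 = t by omega, show i + 1 + (t + 2) - 2 = i + t + 1 by omega,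
        Nat.choose_succ_succ' (i + t + 1) t]
      push_cast; ring

theorem ds_three {i : ℕ} (hi : 1 ≤ i) : ds 3 i = 2 * (i : ℤ) + 2 := by
  induction i, hi using Nat.le_induction with
  | base => rw [ds_index_one (by norm_num)]; norm_num
  | succ i hi ih =>
    rw [ds_even (s := 1) le_rfl (Or.inl rfl) hi, ds_one, ds_two, ih]
    push_cast; ring

theorem dblds_three {i : ℕ} (hi : 1 ≤ i) : dblds 3 i = 4 * (i : ℤ) ^ 2 + 14 * i - 6 := by
  induction i, hi using Nat.le_induction with
  | base => rw [dblds_index_one (by norm_num)]; norm_num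
  | succ i hi ih =>
    rw [dblds_even (s := 1) le_rfl (Or.inl rfl) hi, dblds_one, dblds_two, ih, ds_three hi]
    push_cast; ring

theorem ds_four {i : ℕ} (hi : 1 ≤ i) : ds 4 i = 10 * 2 ^ i - 4 * (i : ℤ) - 8 := by
  induction i, hi using Nat.le_induction with
  | base => rw [ds_index_one (by norm_num)]; norm_num
  | succ i hi ih =>
    rw [ds_even (s := 2) (by norm_num) (Or.inr even_two) hi, ds_two, ih, ds_three (by omega)]
    push_cast; ring

theorem add_one_le_two_pow (i : ℕ) : (i : ℤ) + 1 ≤ 2 ^ i := by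
  exact_mod_cast Nat.lt_two_pow_self (n := i)

theorem sq_le_two_mul_two_pow {i : ℕ} (hi : 1 ≤ i) : (i : ℤ) ^ 2 ≤ 2 * 2 ^ i := by
  induction i, hi using Nat.le_induction with
  | base => norm_num
  | succ i hi ih =>
    rcases Nat.lt_or_ge i 3 with h | h
    · interval_cases i <;> norm_num
    · rw [pow_succ 2]
      have : (3 : ℤ) ≤ i := by exact_mod_cast h
      push_cast
      nlinarith

theorem ds_four_bounds {i : ℕ} (hi : 1 ≤ i) : 4 * 2 ^ i ≤ ds 4 i ∧ ds 4 i ≤ 10 * 2 ^ i := by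
  rw [ds_four hi]
  have := add_one_le_two_pow i
  have h2 : (1 : ℤ) ≤ i := by exact_mod_cast hi
  have h3 : (2 : ℤ) ^ 1 ≤ 2 ^ i := pow_le_pow_right₀ (by norm_num) hi
  constructor <;> linarith

theorem dblds_four_bounds {i : ℕ} (hi : 1 ≤ i) : 2 ^ i ≤ dblds 4 i ∧ dblds 4 i ≤ 100 * 2 ^ i := by
  induction i, hi using Nat.le_induction with
  | base => rw [dblds_index_one (by norm_num)]; norm_num
  | succ i hi ih =>
    rw [dblds_even (s := 2) (by norm_num) (Or.inr even_two) hi, dblds_two,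
      dblds_three (by omega), ds_four hi, pow_succ]
    have h1 := add_one_le_two_pow i
    have h2 := sq_le_two_mul_two_pow hi
    have h3 : (1 : ℤ) ≤ i := by exact_mod_cast hi
    push_cast
    constructor <;> nlinarith

theorem mul_choose_le (i k : ℕ) : (i + k + 1) * (i + k).choose k ≤ (k + 1) * 2 ^ (i + k + 1) := by
  have := Nat.add_one_mul_choose_eq (i + k) k
  rw [this, mul_comm]
  exact Nat.mul_le_mul_left _ (Nat.choose_le_two_pow _ _)

theorem fea_five {i : ℕ} (hi : 1 ≤ i) : fea 5 i = ((i + 3).choose 3 : ℤ) - 1 :=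
  fea_eq_choose (by norm_num) hi

theorem mul_fea_five_le {i : ℕ} (hi : 1 ≤ i) : ((i : ℤ) + 4) * fea 5 i ≤ 64 * 2 ^ i := by
  rw [fea_five hi]
  have h : ((i : ℤ) + 3 + 1) * ((i + 3).choose 3 : ℤ) ≤ (3 + 1) * 2 ^ (i + 3 + 1) := by
    exact_mod_cast mul_choose_le i 3
  rw [pow_add, pow_add] at h
  have : (0 : ℤ) ≤ i := by positivity
  nlinarith

theorem mul_mul_fea_five_le {i : ℕ} (hi : 1 ≤ i) :
    ((i : ℤ) + 4) * (i + 5) * fea 5 i ≤ 640 * 2 ^ i := by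
  rw [fea_five hi]
  have h1 : (i + 4) * (i + 3).choose 3 = (i + 4).choose 4 * 4 := Nat.add_one_mul_choose_eq (i + 3) 3
  have h1' : ((i : ℤ) + 4) * ((i + 3).choose 3 : ℤ) = ((i + 4).choose 4 : ℤ) * 4 := by
    exact_mod_cast h1
  have h : ((i : ℤ) + 4 + 1) * ((i + 4).choose 4 : ℤ) ≤ (4 + 1) * 2 ^ (i + 4 + 1) := by
    exact_mod_cast mul_choose_le i 4
  rw [pow_add, pow_add] at h
  have h0 : (0 : ℤ) ≤ i := by positivity
  have h2 : ((i : ℤ) + 4) * (i + 5) * (((i + 3).choose 3 : ℤ) - 1) ≤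
      (i + 5) * (((i : ℤ) + 4) * ((i + 3).choose 3 : ℤ)) := by nlinarith
  rw [h1'] at h2
  linarith

theorem ds_five_bounds {i : ℕ} (hi : 1 ≤ i) :
    8 * ((i : ℤ) * 2 ^ i) ≤ ds 5 i ∧ ds 5 i ≤ 148 * ((i : ℤ) * 2 ^ i) := by
  induction i, hi using Nat.le_induction with
  | base => rw [ds_index_one (by norm_num)]; norm_num
  | succ i hi ih =>
    have e := ds_odd (s := 2) le_rfl even_two hi
    norm_num at e
    rw [e, ds_two, ds_three (by omega)]
    have h1 := ds_four_bounds (i := i + 1) (by omega)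
    have h2 := mul_fea_five_le hi
    have h3 := fea_nonneg 5 i
    rw [pow_succ] at h1 ⊢
    have h4 : (0 : ℤ) ≤ i * fea 5 i := by positivity
    push_cast
    constructor <;> nlinarith

theorem dblds_five_bounds {i : ℕ} (hi : 1 ≤ i) :
    (i : ℤ) * 2 ^ i ≤ dblds 5 i ∧ dblds 5 i ≤ 3000 * ((i : ℤ) * 2 ^ i) := by
  induction i, hi using Nat.le_induction with
  | base => rw [dblds_index_one (by norm_num)]; norm_num
  | succ i hi ih =>
    have e := dblds_odd (s := 2) le_rfl even_two hi
    norm_num at e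
    rw [e, dblds_two, dblds_three (by omega)]
    have h1 := dblds_four_bounds (i := i + 1) (by omega)
    have h2 := mul_mul_fea_five_le hi
    have h3 := fea_nonneg 5 i
    have h5 := ds_five_bounds hi
    have hi' : (1 : ℤ) ≤ i := by exact_mod_cast hi
    have h6 : (0 : ℤ) ≤ 2 ^ i := by positivity
    have h7 : (2 : ℤ) ^ i ≤ i * 2 ^ i := by nlinarith
    have h8 : (0 : ℤ) ≤ i * fea 5 i := by positivity
    have h9 : (0 : ℤ) ≤ (i : ℤ) ^ 2 * fea 5 i := by positivity
    rw [pow_succ] at h1 ⊢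
    push_cast
    constructor
    · have : (0 : ℤ) ≤ 2 * (4 * ((i : ℤ) + 1) ^ 2 + 14 * (i + 1) - 6 + 2) * fea 5 i := by
        apply mul_nonneg _ h3
        nlinarith
      linarith
    · have : 2 * (4 * ((i : ℤ) + 1) ^ 2 + 14 * (i + 1) - 6 + 2) * fea 5 i ≤
          8 * (((i : ℤ) + 4) * (i + 5) * fea 5 i) := by
        have : 2 * (4 * ((i : ℤ) + 1) ^ 2 + 14 * (i + 1) - 6 + 2) ≤
          8 * (((i : ℤ) + 4) * (i + 5)) := by nlinarith
        calc _ ≤ 8 * (((i : ℤ) + 4) * (i + 5)) * fea 5 i := mul_le_mul_of_nonneg_right this h3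
          _ = _ := by ring
      linarith

theorem isTheta_of_bounds {f : ℕ → ℤ} {g : ℕ → ℝ} (hg : ∀ i, 0 ≤ g i) {a b : ℝ} (ha : 0 < a)
    (h : ∀ i, 1 ≤ i → a * g i ≤ f i ∧ (f i : ℝ) ≤ b * g i) :
    (fun i => (f i : ℝ)) =Θ[Filter.atTop] g := by
  constructor
  · apply Asymptotics.IsBigO.of_bound b
    filter_upwards [Filter.eventually_ge_atTop 1] with i hi
    obtain ⟨h1, h2⟩ := h i hi
    have h0 := hg i
    rw [Real.norm_of_nonneg h0, Real.norm_of_nonneg ((by positivity : 0 ≤ a * g i).trans h1)]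
    exact h2
  · apply Asymptotics.IsBigO.of_bound a⁻¹
    filter_upwards [Filter.eventually_ge_atTop 1] with i hi
    obtain ⟨h1, h2⟩ := h i hi
    have h0 := hg i
    rw [Real.norm_of_nonneg h0, Real.norm_of_nonneg ((by positivity : 0 ≤ a * g i).trans h1),
      inv_mul_eq_div, le_div_iff₀ ha]
    linarith

/-! ### Growth of the coefficients of higher order -/

/-- `f i` is bounded by `2 ^ (i + D).choose t` for a constant `D`. -/
def ExpBounded (f : ℕ → ℤ) (t : ℕ) : Prop :=
  ∃ D : ℕ, ∀ i, 1 ≤ i → f i ≤ 2 ^ (i + D).choose t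

section ExpBounded
variable {f g u v : ℕ → ℤ} {t : ℕ}

theorem two_pow_choose_le {n m : ℕ} (t : ℕ) (h : n ≤ m) :
    (2 : ℤ) ^ n.choose t ≤ 2 ^ m.choose t :=
  pow_le_pow_right₀ (by norm_num) (Nat.choose_le_choose t h)

theorem choose_add_one_le {n t : ℕ} (h : t ≤ n) :
    n.choose (t + 1) + 1 ≤ (n + 1).choose (t + 1) := by
  rw [Nat.choose_succ_succ']
  have := Nat.choose_pos h
  omega

theorem le_choose (K t : ℕ) : K ≤ (K + t + 1).choose (t + 1) := by
  induction K with
  | zero => exact Nat.zero_le _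
  | succ K ih =>
    have := choose_add_one_le (n := K + t + 1) (t := t) (by omega)
    rw [show K + 1 + t + 1 = K + t + 1 + 1 by ring]
    omega

theorem ExpBounded.shift (h : ExpBounded f t) : ExpBounded (fun i => f (i + 1)) t := by
  obtain ⟨D, hD⟩ := h
  exact ⟨D + 1, fun i hi => (hD (i + 1) (by omega)).trans (two_pow_choose_le t (by omega))⟩

theorem ExpBounded.mono (h : ExpBounded f t) : ExpBounded f (t + 1) := by
  obtain ⟨D, hD⟩ := h
  refine ⟨D + 1, fun i hi => (hD i hi).trans (pow_le_pow_right₀ (by norm_num) ?_)⟩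
  rw [← add_assoc, Nat.choose_succ_succ']
  omega

theorem ExpBounded.of_le (h : ExpBounded g t) (hfg : ∀ i, 1 ≤ i → f i ≤ g i) : ExpBounded f t := by
  obtain ⟨D, hD⟩ := h
  exact ⟨D, fun i hi => (hfg i hi).trans (hD i hi)⟩

theorem ExpBounded.add (hf : ExpBounded f (t + 1)) (hg : ExpBounded g (t + 1)) :
    ExpBounded (fun i => f i + g i) (t + 1) := by
  obtain ⟨D, hD⟩ := hf
  obtain ⟨E, hE⟩ := hg
  refine ⟨D + E + t + 1, fun i hi => ?_⟩
  have h1 := (hD i hi).trans (two_pow_choose_le (t + 1) (show i + D ≤ i + D + E + t by omega))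
  have h2 := (hE i hi).trans (two_pow_choose_le (t + 1) (show i + E ≤ i + D + E + t by omega))
  have h3 := choose_add_one_le (n := i + D + E + t) (t := t) (by omega)
  have h4 : (2 : ℤ) ^ ((i + D + E + t).choose (t + 1) + 1) ≤
    2 ^ (i + D + E + t + 1).choose (t + 1) := pow_le_pow_right₀ (by norm_num) h3
  rw [pow_succ] at h4
  rw [show i + (D + E + t + 1) = i + D + E + t + 1 by ring]
  linarith

theorem ExpBounded.mul (hf : ExpBounded f (t + 1)) (hg : ExpBounded g t)
    (h0 : ∀ i, 1 ≤ i → 0 ≤ g i) :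
    ExpBounded (fun i => f i * g i) (t + 1) := by
  obtain ⟨D, hD⟩ := hf
  obtain ⟨E, hE⟩ := hg
  refine ⟨D + E + 1, fun i hi => ?_⟩
  have h1 := (hD i hi).trans (two_pow_choose_le (t + 1) (show i + D ≤ i + D + E by omega))
  have h2 := (hE i hi).trans (two_pow_choose_le t (show i + E ≤ i + D + E by omega))
  rw [show i + (D + E + 1) = i + D + E + 1 by ring, Nat.choose_succ_succ, add_comm, pow_add]
  exact mul_le_mul h1 h2 (h0 i hi) (by positivity)

theorem expBounded_const (c : ℤ) (t : ℕ) : ExpBounded (fun _ => c) (t + 1) := by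
  refine ⟨c.toNat + t, fun i hi => ?_⟩
  have h1 : c ≤ (2 : ℤ) ^ c.toNat := by
    have := (Nat.lt_two_pow_self (n := c.toNat)).le
    have h2 := Int.self_le_toNat c
    exact h2.trans (by exact_mod_cast this)
  refine h1.trans (pow_le_pow_right₀ (by norm_num) ((le_choose _ t).trans ?_))
  exact Nat.choose_le_choose _ (by omega)

/-- A linear recursion with factors of growth `t + 1` leads to growth `t + 2`: the exponents are
added by Pascal's rule. -/
theorem expBounded_of_recursion (hu : ExpBounded u (t + 2)) (hv : ExpBounded v (t + 1))
    (h0 : ∀ i, 1 ≤ i → 0 ≤ f i)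
    (h : ∀ i, 1 ≤ i → f (i + 1) ≤ u i + v i * f i) : ExpBounded f (t + 2) := by
  obtain ⟨D, hD⟩ := hu
  obtain ⟨E, hE⟩ := hv
  obtain ⟨K, hK⟩ := expBounded_const (f 1) (t + 1)
  refine ⟨D + E + K + t + 2, fun i hi => ?_⟩
  induction i, hi using Nat.le_induction with
  | base => exact (hK 1 le_rfl).trans (two_pow_choose_le _ (by omega))
  | succ i hi ih =>
    obtain ⟨n, hn⟩ : ∃ n, n = i + (D + E + K + t + 1) := ⟨_, rfl⟩
    rw [show i + (D + E + K + t + 2) = n + 1 by omega] at ih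
    rw [show i + 1 + (D + E + K + t + 2) = n + 1 + 1 by omega]
    have h1 := (hD i hi).trans (two_pow_choose_le (t + 2) (show i + D ≤ n + 1 by omega))
    have h2 := (hE i hi).trans (two_pow_choose_le (t + 1) (show i + E ≤ n by omega))
    have h3 := mul_le_mul h2 ih (h0 i hi) (by positivity)
    rw [← pow_add] at h3
    have h4 := choose_add_one_le (n := n) (t := t) (by omega)
    have h5 : (n + 1 + 1).choose (t + 2) = (n + 1).choose (t + 1) + (n + 1).choose (t + 2) :=
      Nat.choose_succ_succ _ _
    have h6 : (2 : ℤ) ^ (n + 1).choose (t + 2) ≤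
      2 ^ (n.choose (t + 1) + (n + 1).choose (t + 2)) := pow_le_pow_right₀ (by norm_num) (by omega)
    have h7 : (2 : ℤ) ^ (n.choose (t + 1) + (n + 1).choose (t + 2) + 1) ≤
      2 ^ (n + 1 + 1).choose (t + 2) := pow_le_pow_right₀ (by norm_num) (by omega)
    rw [pow_succ] at h7
    linarith [h i hi]

end ExpBounded

theorem fea_expBounded {s : ℕ} (hs : 2 ≤ s) (t : ℕ) : ExpBounded (fea s) (t + 1) := by
  induction t with
  | zero =>
    refine ⟨s, fun i hi => ?_⟩
    rw [fea_eq_choose hs hi, zero_add, Nat.choose_one_right]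
    have h1 : ((i + s - 2).choose (s - 2) : ℤ) ≤ 2 ^ (i + s - 2) := by
      exact_mod_cast Nat.choose_le_two_pow _ _
    have h2 : (2 : ℤ) ^ (i + s - 2) ≤ 2 ^ (i + s) := pow_le_pow_right₀ (by norm_num) (by omega)
    linarith
  | succ t ih => exact ih.mono

/-- Both coefficients of order `s` have growth `t`. -/
def CoefBounded (s t : ℕ) : Prop := ExpBounded (ds s) t ∧ ExpBounded (dblds s) t

theorem CoefBounded.mono {s t : ℕ} (h : CoefBounded s t) : CoefBounded s (t + 1) :=
  ⟨h.1.mono, h.2.mono⟩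

theorem CoefBounded.even {s t : ℕ} (hs : 2 ≤ s) (he : Even s) (h₁ : CoefBounded (s + 1) (t + 2))
    (h₂ : CoefBounded s (t + 1)) : CoefBounded (s + 2) (t + 2) := by
  have p1 : ∀ s i, 1 ≤ s → 1 ≤ i → 0 ≤ ds s i := fun s i h h' => by linarith [ds_pos h h']
  have p2 : ∀ s i, 1 ≤ s → 1 ≤ i → 0 ≤ dblds s i := fun s i h h' => by
    linarith [two_le_dblds h h']
  have h : ExpBounded (ds (s + 2)) (t + 2) := by
    refine expBounded_of_recursion (h₁.1.shift.add h₁.1.shift) h₂.1.shift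
      (fun i hi => p1 _ _ (by omega) hi) fun i hi => ?_
    rw [ds_even (by omega) (Or.inr he) hi]
    have := p1 s (i + 1) (by omega) (by omega)
    linarith
  refine ⟨h, expBounded_of_recursion (((h₁.2.shift.add h₁.2.shift).add
    (h.mul (h₂.2.shift.add (expBounded_const 2 t)) ?_))) (expBounded_const 1 t)
    (fun i hi => p2 _ _ (by omega) hi) fun i hi => ?_⟩
  · intro i hi
    have := p2 s (i + 1) (by omega) (by omega)
    linarith
  · rw [dblds_even (by omega) (Or.inr he) hi]
    linarith

theorem CoefBounded.odd {s t : ℕ} (hs : 2 ≤ s) (he : Even s) (h₁ : CoefBounded (s + 2) (t + 2))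
    (h₂ : CoefBounded (s + 1) (t + 2)) (h₃ : CoefBounded s (t + 1)) :
    CoefBounded (s + 3) (t + 2) := by
  have p1 : ∀ s i, 1 ≤ s → 1 ≤ i → 0 ≤ ds s i := fun s i h h' => by linarith [ds_pos h h']
  have p2 : ∀ s i, 1 ≤ s → 1 ≤ i → 0 ≤ dblds s i := fun s i h h' => by
    linarith [two_le_dblds h h']
  have hf := fea_expBounded (s := s + 3) (by omega) t
  have h : ExpBounded (ds (s + 3)) (t + 2) := by
    refine expBounded_of_recursion ((h₁.1.shift.add h₁.1.shift).add
      ((h₂.1.shift.add h₂.1.shift).mul hf fun i _ => fea_nonneg _ _)) h₃.1.shift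
      (fun i hi => p1 _ _ (by omega) hi) fun i hi => ?_
    rw [ds_odd (by omega) he hi]
    linarith
  refine ⟨h, expBounded_of_recursion ((((h₁.2.shift.add h₁.2.shift).add
    (((h₂.2.shift.add (expBounded_const 2 _)).add (h₂.2.shift.add (expBounded_const 2 _))).mul hf
      fun i _ => fea_nonneg _ _)).add
    (h.mul (h₃.2.shift.add (expBounded_const 2 t)) ?_))) (expBounded_const 1 t)
    (fun i hi => p2 _ _ (by omega) hi) fun i hi => ?_⟩
  · intro i hi
    have := p2 s (i + 1) (by omega) (by omega)
    linarith
  · rw [dblds_odd (by omega) he hi]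
    linarith

theorem coefBounded_two : CoefBounded 2 1 :=
  ⟨(expBounded_const 2 0).of_le fun i _ => (ds_two i).le,
    (expBounded_const 5 0).of_le fun i _ => (dblds_two i).le⟩

theorem coefBounded_four : CoefBounded 4 1 := by
  refine ⟨⟨7, fun i hi => ?_⟩, ⟨7, fun i hi => ?_⟩⟩ <;> rw [Nat.choose_one_right, pow_add]
  · linarith [ds_four_bounds hi, pow_pos (zero_lt_two (α := ℤ)) i]
  · linarith [dblds_four_bounds hi, pow_pos (zero_lt_two (α := ℤ)) i]

theorem coefBounded_three : CoefBounded 3 2 := by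
  refine ⟨coefBounded_four.mono.1.of_le fun i hi => ?_,
    coefBounded_four.mono.2.of_le fun i hi => ?_⟩
  · have := two_mul_ds_le (s := 3) (by norm_num) hi
    have := ds_pos (s := 3) (by norm_num) hi
    norm_num at *
    linarith
  · have := two_mul_dblds_le (s := 3) (by norm_num) hi
    have := two_le_dblds (s := 3) (by norm_num) hi
    norm_num at *
    linarith

/-- The orders `2 * t + 2` and `2 * t + 3` have growth `t`, with the exception of the order `5`,
where `i * 2 ^ i` is not covered by `t = 1`. -/
theorem coefBounded_aux (t : ℕ) : CoefBounded (2 * (t + 1) + 2) (t + 1) ∧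
    CoefBounded (2 * (t + 1) + 3) (t + 2) ∧ (1 ≤ t → CoefBounded (2 * (t + 1) + 3) (t + 1)) := by
  induction t with
  | zero =>
    exact ⟨coefBounded_four, CoefBounded.odd (s := 2) le_rfl even_two coefBounded_four.mono
      coefBounded_three coefBounded_two, fun h => absurd h (by norm_num)⟩
  | succ t ih =>
    obtain ⟨h1, h2, -⟩ := ih
    have he : Even (2 * (t + 1) + 2) := ⟨t + 2, by ring⟩
    have h3 := CoefBounded.even (by omega) he h2 h1
    have h4 := CoefBounded.odd (by omega) he h3 h2 h1
    rw [show 2 * (t + 1) + 2 + 2 = 2 * (t + 1 + 1) + 2 by ring] at h3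
    rw [show 2 * (t + 1) + 2 + 3 = 2 * (t + 1 + 1) + 3 by ring] at h4
    exact ⟨h3, h4.mono, fun _ => h4⟩

theorem coefBounded {s : ℕ} (hs : 4 ≤ s) (h5 : s ≠ 5) : CoefBounded s ((s - 2) / 2) := by
  obtain ⟨t, h | h⟩ : ∃ t, s = 2 * (t + 1) + 2 ∨ s = 2 * (t + 1) + 3 :=
    ⟨(s - 4) / 2, by omega⟩
  · rw [show (s - 2) / 2 = t + 1 by omega, h]
    exact (coefBounded_aux t).1
  · rw [show (s - 2) / 2 = t + 1 by omega, h]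
    exact (coefBounded_aux t).2.2 (by omega)

/-! ### Growth of Ackermann's function and its inverse -/

theorem two_pow_le_acker {i j : ℕ} (hi : 1 ≤ i) (hj : 1 ≤ j) : 2 ^ j ≤ acker i j := by
  induction i, hi using Nat.le_induction generalizing j with
  | base => rw [acker_one]
  | succ i hi ih =>
    induction j, hj using Nat.le_induction with
    | base => rw [acker_succ_one hi, pow_one]
    | succ j hj ihj =>
      rw [acker_succ_succ hi hj, pow_succ]
      have h1 : 1 ≤ acker (i + 1) j := acker_pos (by omega) hj
      exact Nat.mul_le_mul ihj ((Nat.pow_le_pow_right (by norm_num) h1).trans (ih h1))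

theorem two_mul_acker_le {i j : ℕ} (hi : 1 ≤ i) (hj : 1 ≤ j) :
    2 * acker i j ≤ acker i (j + 1) := by
  obtain ⟨i, rfl⟩ := Nat.exists_eq_add_of_le' hi
  rcases Nat.eq_zero_or_pos i with rfl | hi
  · rw [acker_one, acker_one, pow_succ, mul_comm]
  · rw [acker_succ_succ hi hj, mul_comm]
    have h1 : 1 ≤ acker (i + 1) j := acker_pos (by omega) hj
    exact Nat.mul_le_mul_left _
      ((Nat.pow_le_pow_right (n := 2) (by norm_num) h1).trans (two_pow_le_acker hi h1))

theorem acker_mono {i j k : ℕ} (hi : 1 ≤ i) (hj : 1 ≤ j) (hjk : j ≤ k) : acker i j ≤ acker i k := by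
  induction k, hjk using Nat.le_induction with
  | base => exact le_rfl
  | succ k hk ih =>
    have := two_mul_acker_le hi (hj.trans hk)
    omega

theorem two_pow_succ_le_acker {i j : ℕ} (hi : 1 ≤ i) (hj : 2 ≤ j) :
    2 ^ (j + 1) ≤ acker (i + 1) j := by
  induction j, hj using Nat.le_induction with
  | base =>
    rw [acker_succ_succ hi le_rfl, acker_succ_one hi]
    have := two_pow_le_acker hi (j := 2) (by norm_num)
    omega
  | succ j hj ih =>
    have := two_mul_acker_le (i := i + 1) (j := j) (by omega) (by omega)
    rw [pow_succ]
    omega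

theorem acker_two_pow_le {i j : ℕ} (hi : 1 ≤ i) (hj : 3 ≤ j) :
    acker i (2 ^ j) ≤ acker (i + 1) j := by
  obtain ⟨j, rfl⟩ := Nat.exists_eq_add_of_le' (show 1 ≤ j by omega)
  rw [acker_succ_succ hi (by omega)]
  refine (acker_mono hi Nat.one_le_two_pow (two_pow_succ_le_acker hi (by omega))).trans ?_
  exact Nat.le_mul_of_pos_left _ (acker_pos (by omega) (by omega))

theorem two_mul_le_two_pow {x : ℕ} (hx : 1 ≤ x) : 2 * x ≤ 2 ^ x := by
  obtain ⟨y, rfl⟩ := Nat.exists_eq_add_of_le' hx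
  rw [pow_succ, mul_comm]
  exact Nat.mul_le_mul_right _ Nat.lt_two_pow_self

/-- Raising the second argument of Ackermann's function to a fixed power is compensated by a fixed
increase of the first one. -/
theorem acker_pow_le {i j : ℕ} (hi : 1 ≤ i) (hj : 3 ≤ j) (r : ℕ) :
    acker i (2 * j ^ (r + 1)) ≤ acker (i + (r + 1)) j := by
  induction r generalizing i with
  | zero =>
    refine (acker_mono hi (Nat.mul_pos two_pos (Nat.pow_pos (by omega))) ?_).trans
      (acker_two_pow_le hi hj)
    rw [zero_add, pow_one]
    exact two_mul_le_two_pow (by omega)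
  | succ r ih =>
    have hx : j ≤ j ^ (r + 1) := Nat.le_self_pow (by omega) j
    have h1 : 2 * j ^ (r + 1 + 1) ≤ 2 ^ (2 * j ^ (r + 1)) := by
      rw [two_mul (j ^ (r + 1)), pow_add 2, pow_succ j (r + 1), ← mul_assoc]
      exact Nat.mul_le_mul (two_mul_le_two_pow (by omega)) (hx.trans Nat.lt_two_pow_self.le)
    refine (acker_mono hi (Nat.mul_pos two_pos (Nat.pow_pos (by omega))) h1).trans
      ((acker_two_pow_le hi (by omega)).trans ?_)
    rw [show i + (r + 1 + 1) = i + 1 + (r + 1) by ring]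
    exact ih (by omega)

theorem alpha_spec (n m : ℕ) :
    1 ≤ alpha n m ∧ m ≤ acker (alpha n m) (max ⌈(n : ℚ) / (m : ℚ)⌉₊ 3) := by
  refine Nat.sInf_mem (s := {i | 1 ≤ i ∧ m ≤ acker i (max ⌈(n : ℚ) / (m : ℚ)⌉₊ 3)}) ?_
  obtain ⟨J, hJ⟩ : ∃ J, J = max ⌈(n : ℚ) / (m : ℚ)⌉₊ 3 := ⟨_, rfl⟩
  rw [← hJ]
  have hJ3 : 3 ≤ J := hJ ▸ le_max_right _ _
  refine ⟨1 + (m + 1), by omega, le_trans ?_ (acker_pow_le le_rfl hJ3 m)⟩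
  rw [acker_one]
  have h1 : m + 1 < J ^ (m + 1) := Nat.lt_pow_self (by omega)
  have h2 : 2 * J ^ (m + 1) < 2 ^ (2 * J ^ (m + 1)) := Nat.lt_two_pow_self
  omega

/-- An integer `k`-th root of `J`, up to a factor `3`. -/
theorem exists_root (J : ℕ) (hJ : 1 ≤ J) {k : ℕ} (hk : 1 ≤ k) :
    ∃ j, 3 ≤ j ∧ J ≤ j ^ k ∧ j ^ k ≤ 3 ^ k * J := by
  have hex : ∃ j, 3 ≤ j ∧ J ≤ j ^ k :=
    ⟨J + 3, by omega, (Nat.le_add_right J 3).trans (Nat.le_self_pow (by omega) _)⟩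
  classical
  obtain ⟨h1, h2⟩ := Nat.find_spec hex
  refine ⟨Nat.find hex, h1, h2, ?_⟩
  rcases Nat.eq_or_lt_of_le h1 with h | h
  · rw [← h]
    exact Nat.le_mul_of_pos_right _ hJ
  · obtain ⟨i, hi⟩ := Nat.exists_eq_add_of_le' (show 1 ≤ Nat.find hex by omega)
    have h3 := Nat.find_min hex (m := i) (by omega)
    rw [not_and, not_le] at h3
    rw [hi]
    calc (i + 1) ^ k ≤ (3 * i) ^ k := Nat.pow_le_pow_left (by omega) k
      _ = 3 ^ k * i ^ k := mul_pow _ _ _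
      _ ≤ 3 ^ k * J := Nat.mul_le_mul_left _ (h3 (by omega)).le

/-- The bound in terms of the inverse of Ackermann's function: with `c = s - 2` and an index that
exceeds `alpha n m` by a constant, the factor `j ^ (s - 2)` is absorbed. -/
theorem dblDS_le_alpha {s : ℕ} (hs : 3 ≤ s) : ∃ K : ℝ, 0 ≤ K ∧ ∀ n m : ℕ, 1 ≤ m →
    (dblDS s n m : ℝ) ≤ K * (((n : ℝ) + m) * dblds s (alpha n m + (s - 2))) := by
  obtain ⟨r, rfl⟩ := Nat.exists_eq_add_of_le' hs
  rw [show r + 3 - 2 = r + 1 by omega]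
  refine ⟨2 * (1 + 4 * Real.exp 4 * (((r + 1 : ℕ) : ℝ) ^ (r + 1) * 3 ^ (r + 1) * 4)),
    by positivity, fun n m hm => ?_⟩
  obtain ⟨hα, hmα⟩ := alpha_spec n m
  set J := max ⌈(n : ℚ) / (m : ℚ)⌉₊ 3 with hJ
  have hJm : J * m ≤ n + 4 * m := by
    have hm' : (0 : ℚ) < m := by exact_mod_cast hm
    have h1 : (⌈(n : ℚ) / (m : ℚ)⌉₊ : ℚ) * m ≤ n + m := by
      have := mul_le_mul_of_nonneg_right
        (Nat.ceil_lt_add_one (show (0 : ℚ) ≤ (n : ℚ) / m by positivity)).le hm'.le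
      rwa [add_mul, one_mul, div_mul_cancel₀ _ hm'.ne'] at this
    have h2 : ⌈(n : ℚ) / (m : ℚ)⌉₊ * m ≤ n + m := by exact_mod_cast h1
    have h3 : J * m ≤ (⌈(n : ℚ) / (m : ℚ)⌉₊ + 3) * m := Nat.mul_le_mul_right _ (by omega)
    linarith
  obtain ⟨j, hj3, hj1, hj2⟩ := exists_root J (by omega) (k := r + 1) (by omega)
  have ha : m ≤ acker (alpha n m + (r + 1)) j :=
    hmα.trans ((acker_mono hα (by omega) (by omega)).trans (acker_pow_le hα hj3 r))
  have hc : ((r + 3 : ℕ) : ℝ) - 2 ≤ ((r + 1 : ℕ) : ℝ) := by push_cast; linarith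
  have hm2 : (m : ℝ) ≤ (acker (alpha n m + (r + 1)) j : ℝ) ^ ((r + 1 : ℕ) : ℝ) := by
    rw [Real.rpow_natCast]
    exact_mod_cast ha.trans (Nat.le_self_pow (by omega) _)
  have key := (extremal_le (n := n) (i := alpha n m + (r + 1)) hs (by omega) hc
    (show 1 ≤ j by omega) hm2).2.2
  rw [show r + 3 - 2 = r + 1 by omega] at key
  refine key.trans ?_
  have hE : (2 : ℝ) ≤ dblds (r + 3) (alpha n m + (r + 1)) := by
    exact_mod_cast two_le_dblds (by omega) (by omega)
  have h4 : ((j : ℝ) ^ (r + 1)) * m ≤ 3 ^ (r + 1) * (4 * ((n : ℝ) + m)) := by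
    have h5 : j ^ (r + 1) * m ≤ 3 ^ (r + 1) * (4 * (n + m)) := by
      calc j ^ (r + 1) * m ≤ 3 ^ (r + 1) * J * m := Nat.mul_le_mul_right _ hj2
        _ = 3 ^ (r + 1) * (J * m) := by ring
        _ ≤ _ := Nat.mul_le_mul_left _ (by omega)
    exact_mod_cast h5
  have h6 : (n : ℝ) + 4 * Real.exp 4 * ((((r + 1 : ℕ) : ℝ) * (j : ℝ)) ^ (r + 1) * (m : ℝ)) ≤
      (1 + 4 * Real.exp 4 * (((r + 1 : ℕ) : ℝ) ^ (r + 1) * 3 ^ (r + 1) * 4)) * ((n : ℝ) + m) := by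
    rw [mul_pow, mul_assoc (((r + 1 : ℕ) : ℝ) ^ (r + 1))]
    have h7 := mul_le_mul_of_nonneg_left h4
      (show 0 ≤ 4 * Real.exp 4 * ((r + 1 : ℕ) : ℝ) ^ (r + 1) by positivity)
    have h8 : (0 : ℝ) ≤ m := Nat.cast_nonneg m
    linarith
  have h9 := mul_le_mul_of_nonneg_left h6
    (show 0 ≤ 2 * (dblds (r + 3) (alpha n m + (r + 1)) : ℝ) by linarith)
  refine h9.trans_eq ?_
  ring

theorem add_pow_le_pow_add {a E : ℝ} (ha : 1 ≤ a) (hE : 0 ≤ E) (t : ℕ) :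
    (a + E) ^ t ≤ a ^ t + (1 + E) ^ t * a ^ (t - 1) := by
  induction t with
  | zero => simp
  | succ t ih =>
    rcases Nat.eq_zero_or_pos t with rfl | ht
    · simp
    have h1 : (a + E) ^ t ≤ (1 + E) ^ t * a ^ t := by
      rw [← mul_pow]
      gcongr
      nlinarith
    have h2 : a ^ t = a ^ (t - 1) * a := by rw [← pow_succ, Nat.sub_add_cancel ht]
    rw [Nat.add_sub_cancel, pow_succ, pow_succ a, pow_succ (1 + E)]
    have h3 := mul_le_mul_of_nonneg_right ih (show 0 ≤ a by linarith)
    have h4 := mul_le_mul_of_nonneg_right h1 hE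
    have h5 : (1 + E) ^ t * a ^ (t - 1) * a = (1 + E) ^ t * a ^ t := by rw [h2]; ring
    linarith

theorem choose_add_le {t : ℕ} (E : ℕ) : ∃ L : ℝ, ∀ a : ℕ, 1 ≤ a →
    ((a + E).choose t : ℝ) ≤ (a : ℝ) ^ t / (Nat.factorial t : ℝ) + L * (a : ℝ) ^ (t - 1) := by
  refine ⟨(1 + E) ^ t, fun a ha => ?_⟩
  have ha' : (1 : ℝ) ≤ a := by exact_mod_cast ha
  have h1 : ((a + E).choose t : ℝ) ≤ ((a + E : ℕ) : ℝ) ^ t / (Nat.factorial t : ℝ) :=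
    Nat.choose_le_pow_div t (a + E)
  have hf : (1 : ℝ) ≤ Nat.factorial t := by exact_mod_cast Nat.factorial_pos t
  have h2 := add_pow_le_pow_add ha' (Nat.cast_nonneg (α := ℝ) E) t
  push_cast at h1
  refine h1.trans ((div_le_div_of_nonneg_right h2 (by positivity)).trans ?_)
  rw [add_div]
  gcongr
  exact div_le_self (by positivity) hf

end DoubleDS

theorem mainTheorem8 :
    -- the bounds in terms of Ackermann's function; the hidden constant is absolute
    (∃ C : ℝ, 0 < C ∧ ∀ (s i : ℕ) (c : ℝ) (n m j : ℕ), 3 ≤ s → 1 ≤ i → (s : ℝ) - 2 ≤ c →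
      IsLeast {j : ℕ | 1 ≤ j ∧ (m : ℝ) ≤ (acker i j : ℝ) ^ c} j →
        (Feather s n m : ℝ) ≤ (fea s i : ℝ) * ((n : ℝ) + C * ((c * (j : ℝ)) ^ (s - 2) * (m : ℝ))) ∧
        (DS s n m : ℝ) ≤ (ds s i : ℝ) * ((n : ℝ) + C * ((c * (j : ℝ)) ^ (s - 2) * (m : ℝ))) ∧
        (dblDS s n m : ℝ) ≤
          2 * (dblds s i : ℝ) * ((n : ℝ) + C * ((c * (j : ℝ)) ^ (s - 2) * (m : ℝ)))) ∧
    -- closed forms of the coefficients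
    (∀ s : ℕ, 3 ≤ s → ds s 1 = 2 ^ (s - 1) ∧ dblds s 1 = 2 ^ (s + 1) - 2 ^ (s - 2) - 2) ∧
    (∀ s i : ℕ, 3 ≤ s → 1 ≤ i → fea s i = ((i + s - 2).choose (s - 2) : ℤ) - 1) ∧
    (∀ i : ℕ, 1 ≤ i → ds 3 i = 2 * (i : ℤ) + 2) ∧
    ((fun i : ℕ => (dblds 3 i : ℝ)) =Θ[Filter.atTop] fun i : ℕ => (i : ℝ) ^ 2) ∧
    ((fun i : ℕ => (ds 4 i : ℝ)) =Θ[Filter.atTop] fun i : ℕ => (2 : ℝ) ^ i) ∧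
    ((fun i : ℕ => (dblds 4 i : ℝ)) =Θ[Filter.atTop] fun i : ℕ => (2 : ℝ) ^ i) ∧
    ((fun i : ℕ => (ds 5 i : ℝ)) =Θ[Filter.atTop] fun i : ℕ => (i : ℝ) * (2 : ℝ) ^ i) ∧
    ((fun i : ℕ => (dblds 5 i : ℝ)) =Θ[Filter.atTop] fun i : ℕ => (i : ℝ) * (2 : ℝ) ^ i) ∧
    (∀ s : ℕ, 4 ≤ s → s ≠ 5 → ∃ D : ℕ, ∀ i : ℕ, 1 ≤ i →
      ds s i ≤ 2 ^ ((i + D).choose ((s - 2) / 2)) ∧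
      dblds s i ≤ 2 ^ ((i + D).choose ((s - 2) / 2))) ∧
    -- the resulting bounds on blocked double DS sequences
    (∃ K : ℝ, ∀ n m : ℕ, 1 ≤ n → 1 ≤ m →
      (dblDS 4 n m : ℝ) ≤ K * (((n : ℝ) + (m : ℝ)) * (2 : ℝ) ^ alpha n m)) ∧
    (∃ K : ℝ, ∀ n m : ℕ, 1 ≤ n → 1 ≤ m →
      (dblDS 5 n m : ℝ) ≤ K * (((n : ℝ) + (m : ℝ)) * ((alpha n m : ℝ) * (2 : ℝ) ^ alpha n m))) ∧
    (∀ s : ℕ, 6 ≤ s → ∃ K L : ℝ, ∀ n m : ℕ, 1 ≤ n → 1 ≤ m →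
      (dblDS s n m : ℝ) ≤ K * (((n : ℝ) + (m : ℝ)) *
        (2 : ℝ) ^ ((alpha n m : ℝ) ^ ((s - 2) / 2) / (Nat.factorial ((s - 2) / 2) : ℝ)
          + L * (alpha n m : ℝ) ^ ((s - 2) / 2 - 1)))) := by
  refine ⟨⟨4 * Real.exp 4, by positivity, fun s i c n m j hs hi hc hj =>
    extremal_le hs hi hc hj.1.1 hj.1.2⟩,
    fun s hs => ⟨ds_index_one (by omega), dblds_index_one (by omega)⟩,
    fun s i hs hi => fea_eq_choose (by omega) hi, fun i hi => ds_three hi, ?_, ?_, ?_, ?_, ?_,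
    ?_, ?_, ?_, ?_⟩
  · refine isTheta_of_bounds (a := 1) (b := 18) (fun i => by positivity) one_pos fun i hi => ?_
    rw [dblds_three hi]
    have hi' : (1 : ℝ) ≤ i := by exact_mod_cast hi
    push_cast
    constructor <;> nlinarith
  · refine isTheta_of_bounds (a := 4) (b := 10) (fun i => by positivity) (by norm_num)
      fun i hi => ?_
    exact_mod_cast ds_four_bounds hi
  · refine isTheta_of_bounds (a := 1) (b := 100) (fun i => by positivity) one_pos fun i hi => ?_
    rw [one_mul]
    exact_mod_cast dblds_four_bounds hi
  · refine isTheta_of_bounds (a := 8) (b := 148) (fun i => by positivity) (by norm_num)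
      fun i hi => ?_
    exact_mod_cast ds_five_bounds hi
  · refine isTheta_of_bounds (a := 1) (b := 3000) (fun i => by positivity) one_pos fun i hi => ?_
    rw [one_mul]
    exact_mod_cast dblds_five_bounds hi
  · intro s hs h5
    obtain ⟨⟨D, hD⟩, ⟨E, hE⟩⟩ := coefBounded hs h5
    exact ⟨D + E, fun i hi => ⟨(hD i hi).trans (two_pow_choose_le _ (by omega)),
      (hE i hi).trans (two_pow_choose_le _ (by omega))⟩⟩
  · obtain ⟨K, hK0, hK⟩ := dblDS_le_alpha (s := 4) (by norm_num)
    refine ⟨K * 400, fun n m _ hm => (hK n m hm).trans ?_⟩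
    have h : (dblds 4 (alpha n m + 2) : ℝ) ≤ 100 * 2 ^ (alpha n m + 2) := by
      exact_mod_cast (dblds_four_bounds (i := alpha n m + 2) (by omega)).2
    rw [pow_add] at h
    rw [mul_assoc K]
    refine mul_le_mul_of_nonneg_left ?_ hK0
    calc ((n : ℝ) + m) * dblds 4 (alpha n m + 2)
        ≤ ((n : ℝ) + m) * (100 * (2 ^ alpha n m * 2 ^ 2)) :=
          mul_le_mul_of_nonneg_left h (by positivity)
      _ = _ := by ring
  · obtain ⟨K, hK0, hK⟩ := dblDS_le_alpha (s := 5) (by norm_num)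
    refine ⟨K * 96000, fun n m _ hm => (hK n m hm).trans ?_⟩
    have h : (dblds 5 (alpha n m + 3) : ℝ) ≤
        3000 * (((alpha n m + 3 : ℕ) : ℝ) * 2 ^ (alpha n m + 3)) := by
      exact_mod_cast (dblds_five_bounds (i := alpha n m + 3) (by omega)).2
    have h1 : ((alpha n m + 3 : ℕ) : ℝ) ≤ 4 * alpha n m := by
      have := (alpha_spec n m).1
      exact_mod_cast (by omega : alpha n m + 3 ≤ 4 * alpha n m)
    rw [pow_add] at h
    rw [mul_assoc K]
    refine mul_le_mul_of_nonneg_left ?_ hK0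
    calc ((n : ℝ) + m) * dblds 5 (alpha n m + 3)
        ≤ ((n : ℝ) + m) * (3000 * ((4 * alpha n m) * (2 ^ alpha n m * 2 ^ 3))) :=
          mul_le_mul_of_nonneg_left (h.trans (by gcongr)) (by positivity)
      _ = _ := by ring
  -- the exponent `choose (α + O(1)) t` is `α ^ t / t! + O(α ^ (t - 1))`
  · intro s hs
    obtain ⟨K, hK0, hK⟩ := dblDS_le_alpha (s := s) (by omega)
    obtain ⟨-, ⟨D, hD⟩⟩ := coefBounded (s := s) (by omega) (by omega)
    obtain ⟨L, hL⟩ := choose_add_le (t := (s - 2) / 2) (s - 2 + D)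
    refine ⟨K, L, fun n m _ hm => (hK n m hm).trans ?_⟩
    refine mul_le_mul_of_nonneg_left (mul_le_mul_of_nonneg_left ?_ (by positivity)) hK0
    have h1 : (dblds s (alpha n m + (s - 2)) : ℝ) ≤
        2 ^ (alpha n m + (s - 2 + D)).choose ((s - 2) / 2) := by
      have := hD (alpha n m + (s - 2)) (by omega)
      rw [add_assoc] at this
      exact_mod_cast this
    rw [← Real.rpow_natCast] at h1
    exact h1.trans (Real.rpow_le_rpow_of_exponent_le one_le_two (hL _ (alpha_spec n m).1))
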